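/- All graphs are finite and simple and $\log$ is the natural logarithm. For a graph $G$, let $\mathcal I(G)$ be the set of its independent sets and $Z_G(\lambda)=\sum_{I\in\mathcal I(G)}\lambda^{|I|}$. The hard-core model on $G$ at fugacity $\lambda>0$ chooses $I\in\mathcal I(G)$ with probability $\lambda^{|I|}/Z_G(\lambda)$; its occupancy fraction, the expected value of $|I|/|V(G)|$, equals $\frac{1}{|V(G)|}\frac{\lambda Z_G'(\lambda)}{Z_G(\lambda)}$. Let $W:[-1/e,\infty)\to[-1,\infty)$ be the upper real branch of the Lambert function, the inverse of $y\mapsto ye^y$; the quotient $W(z)/z$ is read as $1$ at $z=0$. A fractional colouring of $G$ assigns to the sets $I\in\mathcal I(G)$ pairwise disjoint (possibly empty) half-open intervals $w(I)\subset[0,\infty)$ such that $\sum_{I\ni v}|w(I)|=1$ for every vertex $v$; the vertex $v$ is then coloured with the set $\bigcup_{I\ni v}w(I)$. The fractional chromatic number $\chi_f(G)$ is the least $k>0$ such that some probability distribution on $\mathcal I(G)$ satisfies $\Pr(v\in\mathbf I)\ge 1/k$ for every vertex $v$. A cover of $G$ is a pair $\mathscr H=(L,H)$ of a graph $H$ and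 a map $L:V(G)\to 2^{V(H)}$ such that: the sets $L(u)$ (possibly empty) partition $V(H)$; each $H[L(u)]$ is complete; if $H$ has an edge between $L(u)$ and $L(v)$ then $u=v$ or $uv\in E(G)$; and if $uv\in E(G)$ then the edges of $H$ between $L(u)$ and $L(v)$ form a (possibly empty) matching. $G$ is $\mathscr H$-colourable if $H$ has an independent set of size $|V(G)|$. The correspondence chromatic number $\chi_c(G)$ is the least $k$ such that $G$ is $\mathscr H$-colourable for every cover $\mathscr H$ with $|L(u)|=k$ for all $u$. In the displays below, the first argument of a maximum is disregarded where it is undefined (that is, where $\deg(u)=0$ or the outer logarithm vanishes). **Theorem.** Let $G$ be a graph of maximum degree $\Delta$ in which each vertex is contained in at most $t$ triangles, where $t\ge 1/2$ is real. 1. If $V(G)\neq\emptyset$ then for any $\lambda>0$ $$\frac{1}{|V(G)|}\frac{\lambda Z_G'(\lambda)}{Z_G(\lambda)}\ \ge\ \max_{0\le x\le\lambda}\left\{\frac{x}{1+x}\,\frac{W\big(\Delta(1+x)^{\sqrt{2t}}\log(1+x)\big)}{\Delta(1+x)^{\sqrt{2t}}\log(1+x)}\right\}.$$ 2. For any $\varepsilon>0$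 there exists $\delta_0>1$, depending only on $\varepsilon$, such that every such $G$ has a fractional colouring in which each $u\in V(G)$ is coloured with a subset of $$\left[0,\ (1+\varepsilon)\max\left\{\frac{\deg(u)}{\log(\deg(u)/\sqrt t)},\ \frac{\delta_0}{\log\delta_0}\sqrt t\right\}\right).$$ In particular, if $t=t(\Delta)\ge1/2$ satisfies $\Delta/\sqrt t\to\infty$ as $\Delta\to\infty$, then $\chi_f(G)\le(1+o(1))\Delta/\log(\Delta/\sqrt t)$ as $\Delta\to\infty$, where the $o(1)$ depends only on $\Delta$ and the function $t$. 3. For any $\varepsilon>0$ there exist $\delta_0>1$ and $\Delta_0$, depending only on $\varepsilon$, such that if $\Delta\ge\Delta_0$ and $\mathscr H=(L,H)$ is a cover of $G$, with all $L(u)$ finite, such that for each $u\in V(G)$ $$|L(u)|\ \ge\ (1+\varepsilon)\max\left\{\frac{\deg(u)}{\log(\deg(u)/(\sqrt t\log\Delta))},\ \frac{\delta_0}{\log\delta_0}\sqrt t\log\Delta\right\},$$ then $G$ is $\mathscr H$-colourable. In particular, if $t=t(\Delta)\ge1/2$ satisfies $t=\Delta^{o(1)}$ as $\Delta\to\infty$,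 then $\chi_c(G)\le(1+o(1))\Delta/\log\Delta$ as $\Delta\to\infty$, where the $o(1)$ depends only on $\Delta$ and the function $t$. 4. (Non-local form with $t=\Delta^2/f$.) For any $\varepsilon>0$ and $\kappa>2+2/\varepsilon$ there exists $\Delta_0$ such that for all $\Delta\ge\Delta_0$, all real $f$ with $(\log\Delta)^{\kappa}\le f\le\Delta^2+1$, and all graphs $G$ of maximum degree $\Delta$ in which each vertex is contained in at most $\Delta^2/f$ triangles, $\chi_c(G)\le(1+\varepsilon)\Delta/\log\sqrt f$. -/

import Mathlib

open Filter Topology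

universe u v

namespace SparseNbhd

noncomputable section

/-- The (principal, "upper") real branch `W : [-1/e, ∞) → [-1, ∞)` of the Lambert function, the
inverse of the strictly increasing map `y ↦ y * exp y` on `[-1, ∞)`. -/
def lambertW (z : ℝ) : ℝ :=
  Function.invFunOn (fun y : ℝ => y * Real.exp y) (Set.Ici (-1)) z

/-- The quotient `W(z) / z`, extended continuously by the value `1` at `z = 0`. -/
def lambertQuot (z : ℝ) : ℝ := if z = 0 then 1 else lambertW z / z

section Graph

variable {V : Type u} [Fintype V]

open Classical in
/-- The independent sets of `G`. -/
def indepSets (G : SimpleGraph V) : Finset (Finset V) :=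
  Finset.univ.filter fun I => G.IsIndepSet (I : Set V)

/-- The partition function `Z_G` of the hard-core model (the independence polynomial). -/
def partitionFun (G : SimpleGraph V) : Polynomial ℝ :=
  ∑ I ∈ indepSets G, Polynomial.X ^ I.card

/-- The occupancy fraction `(1 / |V(G)|) * (lam * Z_G'(lam) / Z_G(lam))` of the hard-core model on
`G` at fugacity `lam`. -/
def occupancyFraction (G : SimpleGraph V) (lam : ℝ) : ℝ :=
  1 / (Fintype.card V : ℝ) *
    (lam * (partitionFun G).derivative.eval lam / (partitionFun G).eval lam)

/-- The probability of the independent set `I` in the hard-core model on `G` at fugacity `lam`. -/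
def hardCoreProb (G : SimpleGraph V) (lam : ℝ) (I : Finset V) : ℝ :=
  lam ^ I.card / ∑ J ∈ indepSets G, lam ^ J.card

/-- The occupancy fraction is the expected density of a random independent set drawn from the
hard-core model. -/
theorem occupancyFraction_eq (G : SimpleGraph V) (lam : ℝ) :
    occupancyFraction G lam =
      (∑ I ∈ indepSets G, hardCoreProb G lam I * (I.card : ℝ)) / (Fintype.card V : ℝ) := by
  have h1 : (partitionFun G).eval lam = ∑ J ∈ indepSets G, lam ^ J.card := by
    simp [partitionFun, Polynomial.eval_finsetSum]
  have h2 : lam * (partitionFun G).derivative.eval lam =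
      ∑ I ∈ indepSets G, lam ^ I.card * (I.card : ℝ) := by
    simp only [partitionFun, Polynomial.derivative_sum, Polynomial.eval_finsetSum,
      Finset.mul_sum, Polynomial.derivative_X_pow, Polynomial.eval_mul, Polynomial.eval_pow,
      Polynomial.eval_X, Polynomial.eval_C]
    refine Finset.sum_congr rfl fun I _ => ?_
    rcases Nat.eq_zero_or_pos I.card with h | h
    · simp [h]
    · obtain ⟨k, hk⟩ := Nat.exists_eq_add_of_lt h
      rw [hk]
      simp only [zero_add, Nat.add_sub_cancel]
      ring
  simp only [occupancyFraction, hardCoreProb]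
  rw [h1, h2, one_div, inv_mul_eq_div, Finset.sum_div]
  congr 1
  refine Finset.sum_congr rfl fun I _ => ?_
  ring

/-- The number of triangles of `G` that contain the vertex `u`. -/
def triangleCount (G : SimpleGraph V) (u : V) : ℕ :=
  Set.ncard {T : Finset V | G.IsNClique 3 T ∧ u ∈ T}

/-- Every vertex of `G` is contained in at most `t` triangles. -/
def TrianglesAtMost (G : SimpleGraph V) (t : ℝ) : Prop :=
  ∀ u : V, (triangleCount G u : ℝ) ≤ t

open Classical in
/-- A fractional colouring of `G`: an assignment of pairwise disjoint (possibly empty) intervals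
`[lo I, hi I) ⊆ [0, ∞)` to the independent sets `I` of `G` such that for each vertex `x` the total
length of the intervals assigned to the independent sets containing `x` is `1`. -/
structure FractionalColouring (G : SimpleGraph V) where
  lo : Finset V → ℝ
  hi : Finset V → ℝ
  lo_nonneg : ∀ I ∈ indepSets G, 0 ≤ lo I
  lo_le_hi : ∀ I ∈ indepSets G, lo I ≤ hi I
  disjoint : ∀ I ∈ indepSets G, ∀ J ∈ indepSets G, I ≠ J →
    Disjoint (Set.Ico (lo I) (hi I)) (Set.Ico (lo J) (hi J))
  total : ∀ x : V, ∑ I ∈ (indepSets G).filter (fun I => x ∈ I), (hi I - lo I) = 1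

/-- The set of colours (of measure `1`) that a fractional colouring assigns to the vertex `x`: the
union of the intervals assigned to the independent sets containing `x`. -/
def FractionalColouring.colours {G : SimpleGraph V} (c : FractionalColouring G) (x : V) : Set ℝ :=
  ⋃ I ∈ {I : Finset V | I ∈ indepSets G ∧ x ∈ I}, Set.Ico (c.lo I) (c.hi I)

open Classical in
/-- `p` is a probability distribution on the independent sets of `G` for which a random independent
set contains each vertex with probability at least `1 / k`. -/
structure IsFractionalColouringDist (G : SimpleGraph V) (k : ℝ) (p : Finset V → ℝ) : Prop where
  nonneg : ∀ I ∈ indepSets G, 0 ≤ p I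
  sum_eq_one : ∑ I ∈ indepSets G, p I = 1
  cover : ∀ x : V, 1 / k ≤ ∑ I ∈ (indepSets G).filter (fun I => x ∈ I), p I

/-- The fractional chromatic number: the least `k` such that some probability distribution on the
independent sets of `G` hits every vertex with probability at least `1 / k`. -/
def fracChromaticNumber (G : SimpleGraph V) : ℝ :=
  sInf {k : ℝ | 0 < k ∧ ∃ p : Finset V → ℝ, IsFractionalColouringDist G k p}

/-- A cover `(L, H)` of the graph `G`; the graph `H` has vertex set `W`. -/
structure Cover (G : SimpleGraph V) (W : Type v) where
  H : SimpleGraph W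
  L : V → Finset W
  /-- The sets `L x` partition the vertices of `H` (a part may be empty). -/
  exists_unique_mem : ∀ w : W, ∃! x : V, w ∈ L x
  /-- Each `L x` induces a complete graph. -/
  complete : ∀ x : V, ∀ w ∈ L x, ∀ w' ∈ L x, w ≠ w' → H.Adj w w'
  /-- There are edges of `H` between `L x` and `L y` only if `x = y` or `x` and `y` are adjacent. -/
  adj_of_adj : ∀ x y : V, ∀ w ∈ L x, ∀ w' ∈ L y, H.Adj w w' → x = y ∨ G.Adj x y
  /-- If `x` and `y` are adjacent, the edges of `H` between `L x` and `L y` form a matching: each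
  `w ∈ L x` has at most one neighbour in `L y`, and (by symmetry of `x` and `y`) conversely. -/
  matching : ∀ x y : V, G.Adj x y → ∀ w ∈ L x, ∀ w₁ ∈ L y, ∀ w₂ ∈ L y,
    H.Adj w w₁ → H.Adj w w₂ → w₁ = w₂

/-- The graph `G` is colourable from its cover `(L, H)`: the graph `H` has an independent set of
size `|V(G)|`. -/
def Cover.Colourable {G : SimpleGraph V} {W : Type v} (C : Cover G W) : Prop :=
  ∃ S : Finset W, C.H.IsIndepSet (S : Set W) ∧ S.card = Fintype.card V

/-- The correspondence chromatic number: the least `k` such that `G` is colourable from each of its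
`k`-fold covers. (The graph `H` of a `k`-fold cover is finite, so its vertex set may be taken in the
lowest universe.) -/
def corrChromaticNumber (G : SimpleGraph V) : ℕ :=
  sInf {k : ℕ | ∀ (W : Type) (C : Cover G W), (∀ x : V, (C.L x).card = k) → C.Colourable}

end Graph

end

end SparseNbhd

/-! Everything rests on one local estimate for the hard-core model. Let F be a set of vertices
spanning at most t edges. Its degree sum is at most 2t and at most |F|², so its average degree is at
most √(2t). A vertex of degree d in F is occupied with probability at least λ/(1+λ)·(1+λ)^(-d), so
by convexity the expected size of I∩F is at least λ/(1+λ)·|F|/(1+λ)^√(2t). On the other hand I∩F is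
empty with probability 1/Z_F ≥ (1+λ)^(-|F|).

In G, the neighbourhood of u spans as many edges as there are triangles at u. Reveal the hard-core
set outside N(u) and let F be the set of neighbours still available. If F is small then N(u) is
likely to be left empty, so u is likely to be occupied; if F is large then many neighbours are
occupied on average. A tangent line of exp interpolates between the two and gives β·P(u∈I) +
γ·∑_{v∼u} P(v∈I) ≥ 1, where β and γ depend on a free parameter a (`local_occupancy`).

Occupancy fraction: sum this inequality over u. The optimal a satisfies a·e^a = Δ(1+λ)^√(2t)
log(1+λ), whence the Lambert function.

Fractional colouring: run the hard-core measure on the vertices not yet fully coloured until one of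
them is finished, delete it and repeat (`exists_greedy_weights`). By local occupancy the potential
β·(remaining demand of u) + γ·(remaining demand around u) falls at least at unit rate, so u finishes
by time β + γ·deg(u). Scheduling the sets by deadline turns finishing times into initial segments of
colours.

Correspondence colouring: a hard-core set I of the cover graph H is a partial colouring. The
neighbours of a colour c in other lists form its layer; a layer embeds in a neighbourhood of G,
hence is sparse, and layers of colours in the same list are disjoint. Resampling layer by layer, an
exponential moment shows that residual lists are rarely short (`Cover.sum_short_le`), and an
available colour rarely has many uncovered conflicts (`Cover.sum_conflict_le`). The lopsided Local
Lemma yields I with neither flaw anywhere, and an independent transversal of the residual lists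
completes the colouring. -/

namespace SparseNbhd

/-! ### Hard-core partition functions and sparse graphs. -/

section HardCore

variable {W : Type*}

open Classical in
/-- The independent sets of `H` contained in `A`. -/
noncomputable def indepOn (H : SimpleGraph W) (A : Finset W) : Finset (Finset W) :=
  A.powerset.filter fun I => H.IsIndepSet (I : Set W)

/-- The partition function of the hard-core model on `H[A]`. -/
noncomputable def hcZ (H : SimpleGraph W) (A : Finset W) (lam : ℝ) : ℝ :=
  ∑ I ∈ indepOn H A, lam ^ I.card

/-- The unnormalised expected size of a hard-core random independent set of `H[A]`. -/
noncomputable def hcSize (H : SimpleGraph W) (A : Finset W) (lam : ℝ) : ℝ :=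
  ∑ I ∈ indepOn H A, (I.card : ℝ) * lam ^ I.card

open Classical in
/-- The unnormalised probability that `v` lies in a hard-core random independent set of `H[A]`. -/
noncomputable def hcOcc (H : SimpleGraph W) (A : Finset W) (lam : ℝ) (v : W) : ℝ :=
  ∑ I ∈ indepOn H A with v ∈ I, lam ^ I.card

open Classical in
/-- The vertices of `A` with no neighbour in `M`. -/
noncomputable def uncov (H : SimpleGraph W) (A M : Finset W) : Finset W :=
  A.filter fun x => ∀ y ∈ M, ¬ H.Adj x y

open Classical in
/-- The sum of the degrees of `H[A]`. -/
noncomputable def degSum (H : SimpleGraph W) (A : Finset W) : ℕ :=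
  ∑ x ∈ A, (A.filter (H.Adj x)).card

variable {H : SimpleGraph W} {A B M I : Finset W} {lam : ℝ}

theorem mem_indepOn : I ∈ indepOn H A ↔ I ⊆ A ∧ ∀ x ∈ I, ∀ y ∈ I, ¬ H.Adj x y := by
  classical
  simp only [indepOn, Finset.mem_filter, Finset.mem_powerset]
  refine and_congr_right fun _ => ⟨fun h x hx y hy hxy => h hx hy hxy.ne hxy,
    fun h x hx y hy _ => h x hx y hy⟩

theorem mem_uncov {x : W} : x ∈ uncov H A M ↔ x ∈ A ∧ ∀ y ∈ M, ¬ H.Adj x y := by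
  classical
  simp [uncov]

theorem uncov_subset : uncov H A M ⊆ A := fun _ hx => (mem_uncov.1 hx).1

theorem empty_mem_indepOn : ∅ ∈ indepOn H A := by simp [mem_indepOn]

theorem indepOn_mono (h : A ⊆ B) : indepOn H A ⊆ indepOn H B := fun I hI => by
  rw [mem_indepOn] at hI ⊢
  exact ⟨hI.1.trans h, hI.2⟩

theorem degSum_mono (h : A ⊆ B) : degSum H A ≤ degSum H B := by
  classical
  unfold degSum
  calc _ ≤ ∑ x ∈ A, (B.filter (H.Adj x)).card :=
        Finset.sum_le_sum fun x _ => Finset.card_le_card (Finset.filter_subset_filter _ h)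
    _ ≤ _ := Finset.sum_le_sum_of_subset h

open Classical in
/-- Revealing an independent set first outside `B`, then inside `B`. -/
theorem sum_indepOn_eq (hB : B ⊆ A) (f : Finset W → ℝ) :
    ∑ I ∈ indepOn H A, f I =
      ∑ M ∈ indepOn H (A \ B), ∑ K ∈ indepOn H (uncov H B M), f (M ∪ K) := by
  rw [Finset.sum_sigma']
  refine Finset.sum_bij' (fun I _ => (⟨I \ B, I ∩ B⟩ : Σ _ : Finset W, Finset W))
    (fun p _ => p.1 ∪ p.2) ?_ ?_ ?_ ?_ ?_
  · intro I hI
    rw [mem_indepOn] at hI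
    simp only [Finset.mem_sigma, mem_indepOn]
    refine ⟨⟨Finset.sdiff_subset_sdiff hI.1 subset_rfl, fun x hx y hy => hI.2 x
      (Finset.mem_sdiff.1 hx).1 y (Finset.mem_sdiff.1 hy).1⟩, fun x hx => ?_, fun x hx y hy =>
      hI.2 x (Finset.mem_inter.1 hx).1 y (Finset.mem_inter.1 hy).1⟩
    rw [Finset.mem_inter] at hx
    exact mem_uncov.2 ⟨hx.2, fun y hy => hI.2 x hx.1 y (Finset.mem_sdiff.1 hy).1⟩
  · rintro ⟨M, K⟩ hp
    simp only [Finset.mem_sigma, mem_indepOn] at hp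
    obtain ⟨⟨hM, hM'⟩, hK, hK'⟩ := hp
    rw [mem_indepOn]
    refine ⟨Finset.union_subset (hM.trans Finset.sdiff_subset) ((hK.trans uncov_subset).trans hB),
      fun x hx y hy => ?_⟩
    rw [Finset.mem_union] at hx hy
    rcases hx with hx | hx <;> rcases hy with hy | hy
    · exact hM' x hx y hy
    · exact fun h => (mem_uncov.1 (hK hy)).2 x hx h.symm
    · exact (mem_uncov.1 (hK hx)).2 y hy
    · exact hK' x hx y hy
  · intro I _
    exact Finset.sdiff_union_inter I B
  · rintro ⟨M, K⟩ hp
    simp only [Finset.mem_sigma, mem_indepOn] at hp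
    obtain ⟨⟨hM, -⟩, hK, -⟩ := hp
    have h1 : ∀ x ∈ M, x ∉ B := fun x hx => (Finset.mem_sdiff.1 (hM hx)).2
    have h2 : ∀ x ∈ K, x ∈ B := fun x hx => uncov_subset (hK hx)
    have e1 : (M ∪ K) \ B = M := by
      ext x; simp only [Finset.mem_sdiff, Finset.mem_union]
      exact ⟨fun h => h.1.resolve_right fun h' => h.2 (h2 x h'), fun h => ⟨Or.inl h, h1 x h⟩⟩
    have e2 : (M ∪ K) ∩ B = K := by
      ext x; simp only [Finset.mem_inter, Finset.mem_union]
      exact ⟨fun h => h.1.resolve_left fun h' => h1 x h' h.2, fun h => ⟨Or.inr h, h2 x h⟩⟩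
    simp [e1, e2]
  · intro I _
    simp [Finset.sdiff_union_inter]

open Classical in
theorem disjoint_of_mem_indepOn {K : Finset W} (hM : M ∈ indepOn H (A \ B))
    (hK : K ∈ indepOn H (uncov H B M)) : Disjoint M K := by
  rw [mem_indepOn] at hM hK
  exact Finset.disjoint_left.2 fun x hx hx' =>
    (Finset.mem_sdiff.1 (hM.1 hx)).2 (uncov_subset (hK.1 hx'))

open Classical in
theorem sum_pow_indepOn_eq (hB : B ⊆ A) (f : Finset W → ℝ) :
    ∑ I ∈ indepOn H A, lam ^ I.card * f I =
      ∑ M ∈ indepOn H (A \ B), lam ^ M.card *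
        ∑ K ∈ indepOn H (uncov H B M), lam ^ K.card * f (M ∪ K) := by
  rw [sum_indepOn_eq hB]
  refine Finset.sum_congr rfl fun M hM => ?_
  rw [Finset.mul_sum]
  refine Finset.sum_congr rfl fun K hK => ?_
  rw [Finset.card_union_of_disjoint (disjoint_of_mem_indepOn hM hK), pow_add, mul_assoc]

theorem hcZ_pos (hl : 0 ≤ lam) : 0 < hcZ H A lam := by
  refine Finset.sum_pos' (fun I _ => by positivity) ⟨∅, empty_mem_indepOn, by simp⟩

theorem hcZ_zero : hcZ H A 0 = 1 := by
  unfold hcZ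
  rw [Finset.sum_eq_single ∅]
  · simp
  · intro I _ hI
    simp [Finset.card_eq_zero, hI]
  · exact fun h => absurd empty_mem_indepOn h

theorem hcZ_mono (hl : 0 ≤ lam) (h : A ⊆ B) : hcZ H A lam ≤ hcZ H B lam :=
  Finset.sum_le_sum_of_subset_of_nonneg (indepOn_mono h) fun _ _ _ => by positivity

open Classical in
theorem hcOcc_eq {v : W} (hv : v ∈ A) :
    hcOcc H A lam v = lam * hcZ H (A.filter fun x => x ≠ v ∧ ¬ H.Adj v x) lam := by
  unfold hcOcc hcZ
  rw [Finset.mul_sum]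
  refine Finset.sum_bij' (fun I _ => I.erase v) (fun I _ => insert v I) ?_ ?_ ?_ ?_ ?_
  · intro I hI
    rw [Finset.mem_filter, mem_indepOn] at hI
    obtain ⟨⟨hI, hI'⟩, hv'⟩ := hI
    rw [mem_indepOn]
    refine ⟨fun x hx => ?_, fun x hx y hy => hI' x (Finset.mem_of_mem_erase hx) y
      (Finset.mem_of_mem_erase hy)⟩
    rw [Finset.mem_erase] at hx
    exact Finset.mem_filter.2 ⟨hI hx.2, hx.1, hI' v hv' x hx.2⟩
  · intro I hI
    rw [mem_indepOn] at hI
    rw [Finset.mem_filter, mem_indepOn]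
    refine ⟨⟨Finset.insert_subset hv (hI.1.trans (Finset.filter_subset _ _)), ?_⟩,
      Finset.mem_insert_self _ _⟩
    intro x hx y hy
    rw [Finset.mem_insert] at hx hy
    rcases hx with rfl | hx <;> rcases hy with rfl | hy
    · exact H.loopless.irrefl _
    · exact (Finset.mem_filter.1 (hI.1 hy)).2.2
    · exact fun h => (Finset.mem_filter.1 (hI.1 hx)).2.2 h.symm
    · exact hI.2 x hx y hy
  · intro I hI
    exact Finset.insert_erase (Finset.mem_filter.1 hI).2
  · intro I hI
    rw [mem_indepOn] at hI
    exact Finset.erase_insert fun h => (Finset.mem_filter.1 (hI.1 h)).2.1 rfl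
  · intro I hI
    have hv' := (Finset.mem_filter.1 hI).2
    rw [← pow_succ', Finset.card_erase_add_one hv']

open Classical in
theorem hcZ_insert_le (hl : 0 ≤ lam) {v : W} (hv : v ∉ A) :
    hcZ H (insert v A) lam ≤ (1 + lam) * hcZ H A lam := by
  have h1 : hcZ H (insert v A) lam =
      hcOcc H (insert v A) lam v + ∑ I ∈ indepOn H (insert v A) with v ∉ I, lam ^ I.card :=
    (Finset.sum_filter_add_sum_filter_not _ _ _).symm
  have h2 : ∑ I ∈ indepOn H (insert v A) with v ∉ I, lam ^ I.card = hcZ H A lam := by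
    unfold hcZ
    refine Finset.sum_congr ?_ fun _ _ => rfl
    ext I
    simp only [Finset.mem_filter, mem_indepOn]
    constructor
    · rintro ⟨⟨h, h'⟩, hvI⟩
      exact ⟨(Finset.subset_insert_iff_of_notMem hvI).1 h, h'⟩
    · rintro ⟨h, h'⟩
      exact ⟨⟨h.trans (Finset.subset_insert _ _), h'⟩, fun hv' => hv (h hv')⟩
  have h3 : hcOcc H (insert v A) lam v ≤ lam * hcZ H A lam := by
    rw [hcOcc_eq (Finset.mem_insert_self _ _)]
    refine mul_le_mul_of_nonneg_left (hcZ_mono hl fun x hx => ?_) hl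
    rw [Finset.mem_filter, Finset.mem_insert] at hx
    exact hx.1.resolve_left hx.2.1
  rw [h1, h2]
  linarith

open Classical in
theorem hcZ_union_le (hl : 0 ≤ lam) (A B : Finset W) :
    hcZ H (A ∪ B) lam ≤ (1 + lam) ^ B.card * hcZ H A lam := by
  induction B using Finset.induction_on with
  | empty => simp
  | insert v B hv ih =>
    rw [Finset.union_insert]
    by_cases h : v ∈ A ∪ B
    · rw [Finset.insert_eq_of_mem h, Finset.card_insert_of_notMem hv, pow_succ', mul_assoc]
      have : 0 ≤ (1 + lam) ^ B.card * hcZ H A lam :=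
        mul_nonneg (by positivity) (hcZ_pos hl).le
      nlinarith
    · rw [Finset.card_insert_of_notMem hv, pow_succ', mul_assoc]
      exact (hcZ_insert_le hl h).trans (mul_le_mul_of_nonneg_left ih (by positivity))

theorem hcZ_le_pow (hl : 0 ≤ lam) : hcZ H A lam ≤ (1 + lam) ^ A.card := by
  classical
  have h := hcZ_union_le (H := H) hl ∅ A
  have h0 : hcZ H ∅ lam = 1 := by
    unfold hcZ
    rw [show indepOn H ∅ = {∅} by ext I; simp +contextual [mem_indepOn]]
    simp
  simpa [h0] using h

theorem hcZ_le_exp (hl : 0 ≤ lam) : hcZ H A lam ≤ Real.exp (Real.log (1 + lam) * A.card) := by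
  rw [mul_comm, Real.exp_nat_mul, Real.exp_log (by positivity)]
  exact hcZ_le_pow hl

theorem hcSize_eq : hcSize H A lam = ∑ v ∈ A, hcOcc H A lam v := by
  classical
  unfold hcSize hcOcc
  simp_rw [Finset.sum_filter]
  rw [Finset.sum_comm]
  refine Finset.sum_congr rfl fun I hI => ?_
  rw [← Finset.sum_filter, Finset.filter_mem_eq_inter,
    Finset.inter_eq_right.2 (mem_indepOn.1 hI).1]
  simp

-- Deleting v and its neighbours from A costs a factor of at most 1 + lam in the partition function
-- per deleted vertex, and what is left is the partition function of the sets that can be extended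
-- by v.
open Classical in
theorem hcOcc_ge (hl : 0 ≤ lam) {v : W} (hv : v ∈ A) :
    lam / (1 + lam) * Real.exp (- (Real.log (1 + lam) * (A.filter (H.Adj v)).card)) * hcZ H A lam
      ≤ hcOcc H A lam v := by
  set d := (A.filter (H.Adj v)).card
  set Z := hcZ H (A.filter fun x => x ≠ v ∧ ¬ H.Adj v x) lam
  have h1 : hcZ H A lam ≤ (1 + lam) ^ (d + 1) * Z := by
    have : A = (A.filter fun x => x ≠ v ∧ ¬ H.Adj v x) ∪ insert v (A.filter (H.Adj v)) := by
      ext x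
      simp only [Finset.mem_union, Finset.mem_insert, Finset.mem_filter]
      by_cases hx : x = v
      · subst hx; simp [hv]
      · simp only [hx]; tauto
    calc hcZ H A lam = hcZ H ((A.filter fun x => x ≠ v ∧ ¬ H.Adj v x) ∪
          insert v (A.filter (H.Adj v))) lam := by rw [← this]
      _ ≤ _ := hcZ_union_le hl _ _
      _ = _ := by rw [Finset.card_insert_of_notMem (by simp)]
  rw [hcOcc_eq hv, Real.exp_neg, mul_comm (Real.log _), Real.exp_nat_mul,
    Real.exp_log (by positivity)]
  have hp : 0 < (1 + lam) ^ d := by positivity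
  calc lam / (1 + lam) * ((1 + lam) ^ d)⁻¹ * hcZ H A lam
      ≤ lam / (1 + lam) * ((1 + lam) ^ d)⁻¹ * ((1 + lam) ^ (d + 1) * Z) := by gcongr
    _ = lam * Z := by
      rw [pow_succ]; field_simp

/-- The degree sum is at most 2t and at most |A|², hence at most their geometric mean. -/
theorem degSum_le_sqrt {t : ℝ} (h : (degSum H A : ℝ) ≤ 2 * t) :
    (degSum H A : ℝ) ≤ Real.sqrt (2 * t) * A.card := by
  classical
  have h1 : degSum H A ≤ A.card * A.card := by
    unfold degSum
    calc _ ≤ ∑ x ∈ A, A.card := Finset.sum_le_sum fun x _ => Finset.card_filter_le _ _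
      _ = _ := by simp
  have h1' : (degSum H A : ℝ) ≤ A.card * A.card := by exact_mod_cast h1
  have h0 : (0 : ℝ) ≤ degSum H A := by positivity
  refine abs_le_of_sq_le_sq' ?_ (by positivity) |>.2
  rw [mul_pow, Real.sq_sqrt (h0.trans h)]
  nlinarith [mul_nonneg h0 (sub_nonneg.2 h1'), mul_nonneg (sub_nonneg.2 h) (by positivity : (0:ℝ) ≤ A.card * A.card)]

/-- The lower bound on the occupancy of a sparse graph. -/
theorem hcSize_ge (hl : 0 ≤ lam) {t : ℝ} (h : (degSum H A : ℝ) ≤ 2 * t) :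
    lam / (1 + lam) * ((A.card : ℝ) / (1 + lam) ^ Real.sqrt (2 * t)) * hcZ H A lam
      ≤ hcSize H A lam := by
  classical
  set m := Real.sqrt (2 * t)
  set L := Real.log (1 + lam)
  have hL : 0 ≤ L := Real.log_nonneg (by linarith)
  have h1 : (A.card : ℝ) * Real.exp (-(L * m)) ≤
      ∑ v ∈ A, Real.exp (-(L * (A.filter (H.Adj v)).card)) := by
    -- Jensen's inequality through the tangent line of `exp`, taken at degree m = √(2t). As m is at
    -- least the average degree, the linear terms sum to something nonnegative.
    have key : ∀ v ∈ A, Real.exp (-(L * m)) * (1 + L * m - L * (A.filter (H.Adj v)).card)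
        ≤ Real.exp (-(L * (A.filter (H.Adj v)).card)) := fun v _ => by
      have := Real.add_one_le_exp (L * m - L * (A.filter (H.Adj v)).card)
      calc _ ≤ Real.exp (-(L * m)) * Real.exp (L * m - L * (A.filter (H.Adj v)).card) :=
            mul_le_mul_of_nonneg_left (by linarith) (Real.exp_pos _).le
        _ = _ := by rw [← Real.exp_add]; ring_nf
    refine le_trans ?_ (Finset.sum_le_sum key)
    have hs := degSum_le_sqrt h
    have hd : (degSum H A : ℝ) = ∑ v ∈ A, ((A.filter (H.Adj v)).card : ℝ) := by
      simp [degSum]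
    rw [← Finset.mul_sum, Finset.sum_sub_distrib, ← Finset.mul_sum, ← hd, Finset.sum_const,
      nsmul_eq_mul]
    have := mul_nonneg hL (sub_nonneg.2 hs)
    have h2 := mul_nonneg (Real.exp_pos (-(L * m))).le this
    nlinarith
  have h2 : ((A.card : ℝ) / (1 + lam) ^ m) = (A.card : ℝ) * Real.exp (-(L * m)) := by
    rw [Real.rpow_def_of_pos (by linarith), Real.exp_neg, div_eq_mul_inv]
  rw [h2, hcSize_eq]
  have hZ := (hcZ_pos (H := H) (A := A) hl).le
  calc _ ≤ lam / (1 + lam) * (∑ v ∈ A, Real.exp (-(L * (A.filter (H.Adj v)).card))) * hcZ H A lam :=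
        by gcongr
    _ = ∑ v ∈ A, lam / (1 + lam) * Real.exp (-(L * (A.filter (H.Adj v)).card)) * hcZ H A lam := by
        rw [Finset.mul_sum, Finset.sum_mul]
    _ ≤ _ := Finset.sum_le_sum fun v hv => hcOcc_ge hl hv

theorem hasDerivAt_hcZ (x : ℝ) (hx : 0 < x) :
    HasDerivAt (hcZ H A) (hcSize H A x / x) x := by
  have : HasDerivAt (fun x : ℝ => ∑ I ∈ indepOn H A, x ^ I.card)
      (∑ I ∈ indepOn H A, (I.card : ℝ) * x ^ (I.card - 1)) x :=
    HasDerivAt.fun_sum fun I _ => hasDerivAt_pow _ _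
  refine this.congr_deriv (Eq.symm ?_)
  unfold hcSize
  rw [Finset.sum_div]
  refine Finset.sum_congr rfl fun I _ => ?_
  rcases Nat.eq_zero_or_pos I.card with h | h
  · simp [h]
  · rw [eq_comm, eq_div_iff hx.ne', mul_assoc, ← pow_succ, Nat.sub_add_cancel h]

theorem continuous_hcZ : Continuous (hcZ H A) := by
  unfold hcZ
  fun_prop

/-- The growth of the partition function of a sparse graph. -/
theorem hcZ_le_mul_exp {t mu : ℝ} (h : (degSum H A : ℝ) ≤ 2 * t) (h0 : 0 ≤ mu) (hm : mu ≤ lam) :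
    hcZ H A mu ≤ hcZ H A lam * Real.exp (-((A.card : ℝ) / (1 + lam) ^ Real.sqrt (2 * t) *
      (Real.log (1 + lam) - Real.log (1 + mu)))) := by
  set q := (A.card : ℝ) / (1 + lam) ^ Real.sqrt (2 * t)
  -- Integrates (log Z)' = E|I|/x ≥ q/(1+x), where q has 1 + lam in place of 1 + x and so is
  -- constant on the interval.
  have hmono : MonotoneOn (fun x => Real.log (hcZ H A x) - q * Real.log (1 + x))
      (Set.Icc 0 lam) := by
    have hd : ∀ x ∈ Set.Ioo 0 lam, HasDerivAt
        (fun x => Real.log (hcZ H A x) - q * Real.log (1 + x))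
        (hcSize H A x / x / hcZ H A x - q * (1 / (1 + x))) x := fun x hx => by
      have h1 := (hasDerivAt_hcZ (H := H) (A := A) x hx.1).log (hcZ_pos hx.1.le).ne'
      have h2 : HasDerivAt (fun x : ℝ => Real.log (1 + x)) (1 / (1 + x)) x :=
        ((hasDerivAt_id x).const_add 1).log (by simp; linarith [hx.1])
      exact h1.sub (h2.const_mul q)
    refine monotoneOn_of_deriv_nonneg (convex_Icc _ _) ?_ ?_ ?_
    · refine ContinuousOn.sub ?_ ?_
      · exact ContinuousOn.log continuous_hcZ.continuousOn fun x hx => (hcZ_pos hx.1).ne'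
      · refine ContinuousOn.mul continuousOn_const (ContinuousOn.log (by fun_prop) fun x hx => ?_)
        have := hx.1; linarith
    · rw [interior_Icc]
      exact fun x hx => (hd x hx).differentiableAt.differentiableWithinAt
    · rw [interior_Icc]
      intro x hx
      rw [(hd x hx).deriv, sub_nonneg, div_div, le_div_iff₀ (mul_pos hx.1 (hcZ_pos hx.1.le))]
      have hx0 := hx.1
      have hZ := hcZ_pos (H := H) (A := A) hx0.le
      refine le_trans ?_ (hcSize_ge hx0.le h)
      have : q ≤ (A.card : ℝ) / (1 + x) ^ Real.sqrt (2 * t) := by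
        refine div_le_div_of_nonneg_left (by positivity) (by positivity) ?_
        exact Real.rpow_le_rpow (by linarith) (by linarith [hx.2]) (Real.sqrt_nonneg _)
      calc q * (1 / (1 + x)) * (x * hcZ H A x) = x / (1 + x) * q * hcZ H A x := by ring
        _ ≤ _ := by gcongr
  have := hmono ⟨h0, hm⟩ ⟨h0.trans hm, le_rfl⟩ hm
  simp only at this
  have hZ := hcZ_pos (H := H) (A := A) h0
  have hZ' := hcZ_pos (H := H) (A := A) (h0.trans hm)
  rw [← Real.log_le_log_iff hZ (by positivity), Real.log_mul hZ'.ne' (Real.exp_pos _).ne',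
    Real.log_exp]
  linarith

theorem exp_le_hcZ {t : ℝ} (h : (degSum H A : ℝ) ≤ 2 * t) (hl : 0 ≤ lam) :
    Real.exp ((A.card : ℝ) / (1 + lam) ^ Real.sqrt (2 * t) * Real.log (1 + lam)) ≤
      hcZ H A lam := by
  have := hcZ_le_mul_exp h le_rfl hl
  rw [hcZ_zero, Real.exp_neg] at this
  have h2 := Real.exp_pos ((A.card : ℝ) / (1 + lam) ^ Real.sqrt (2 * t) *
    (Real.log (1 + lam) - Real.log (1 + 0)))
  rw [← div_eq_mul_inv, le_div_iff₀ h2] at this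
  simpa using this

end HardCore

/-! ### Edges in a neighbourhood and triangles. -/

section Triangles

/-- Sending an ordered pair (x, y) of adjacent neighbours of u to the triangle {u, x, y} is at most
two-to-one. -/
theorem degSum_le_triangleCount {V : Type u} [Fintype V] (G : SimpleGraph V)
    [DecidableRel G.Adj] (u : V) : degSum G (G.neighborFinset u) ≤ 2 * triangleCount G u := by
  classical
  set P := (G.neighborFinset u).sigma fun x => (G.neighborFinset u).filter (G.Adj x)
  have h1 : degSum G (G.neighborFinset u) = P.card := by
    rw [Finset.card_sigma]
    unfold degSum
    refine Finset.sum_congr rfl fun x _ => ?_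
    congr
  let φ : (Σ _ : V, V) → Finset V := fun p => {u, p.1, p.2}
  have hP : ∀ p ∈ P, G.Adj u p.1 ∧ G.Adj u p.2 ∧ G.Adj p.1 p.2 := fun p hp => by
    simp only [P, Finset.mem_sigma, Finset.mem_filter, SimpleGraph.mem_neighborFinset] at hp
    tauto
  have h2 : P.card ≤ 2 * (P.image φ).card := by
    refine Finset.card_le_mul_card_image P 2 fun T hT => ?_
    obtain ⟨p, hp, rfl⟩ := Finset.mem_image.1 hT
    obtain ⟨a1, a2, a3⟩ := hP p hp
    have : (P.filter fun x => φ x = φ p) ⊆ {⟨p.1, p.2⟩, ⟨p.2, p.1⟩} := by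
      intro r hr
      rw [Finset.mem_filter] at hr
      obtain ⟨b1, b2, b3⟩ := hP r hr.1
      have e1 : r.1 ∈ φ p := hr.2 ▸ (by simp [φ])
      have e2 : r.2 ∈ φ p := hr.2 ▸ (by simp [φ])
      simp only [φ, Finset.mem_insert, Finset.mem_singleton] at e1 e2
      obtain ⟨r1, r2⟩ := r
      simp only [Finset.mem_insert, Finset.mem_singleton] at *
      rcases e1 with rfl | rfl | rfl
      · exact absurd b1 (G.loopless.irrefl _)
      · rcases e2 with rfl | rfl | rfl
        · exact absurd b2 (G.loopless.irrefl _)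
        · exact absurd b3 (G.loopless.irrefl _)
        · left; rfl
      · rcases e2 with rfl | rfl | rfl
        · exact absurd b2 (G.loopless.irrefl _)
        · right; rfl
        · exact absurd b3 (G.loopless.irrefl _)
    exact (Finset.card_le_card this).trans (Finset.card_le_two)
  have h3 : (P.image φ).card ≤ triangleCount G u := by
    unfold triangleCount
    rw [← Set.ncard_coe_finset]
    refine Set.ncard_le_ncard ?_ (Set.toFinite _)
    intro T hT
    obtain ⟨p, hp, rfl⟩ := Finset.mem_image.1 (Finset.mem_coe.1 hT)
    obtain ⟨a1, a2, a3⟩ := hP p hp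
    exact ⟨SimpleGraph.is3Clique_triple_iff.2 ⟨a1, a2, a3⟩, by simp [φ]⟩
  omega

theorem degSum_le_of_trianglesAtMost {V : Type u} [Fintype V] {G : SimpleGraph V}
    [DecidableRel G.Adj] {t : ℝ} (ht : TrianglesAtMost G t) (u : V) {A : Finset V}
    (hA : A ⊆ G.neighborFinset u) : (degSum G A : ℝ) ≤ 2 * t := by
  have h1 : (degSum G A : ℝ) ≤ (degSum G (G.neighborFinset u) : ℝ) := by
    exact_mod_cast degSum_mono hA
  have h2 : (degSum G (G.neighborFinset u) : ℝ) ≤ 2 * triangleCount G u := by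
    exact_mod_cast degSum_le_triangleCount G u
  linarith [ht u]

end Triangles

/-! ### The local occupancy inequality. -/

section LocalOccupancy

variable {V : Type*} {G : SimpleGraph V} {A : Finset V} {lam t a : ℝ}

/-- The local occupancy inequality for a sparse graph. -/
theorem hcZ_le_local (hl : 0 < lam) (h : (degSum G A : ℝ) ≤ 2 * t) (ha : -1 < a) :
    hcZ G A lam ≤ Real.exp a / (1 + a) + (1 + lam) / lam *
      ((1 + lam) ^ Real.sqrt (2 * t) * Real.log (1 + lam) / (1 + a)) * hcSize G A lam := by
  set K := (1 + lam) ^ Real.sqrt (2 * t)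
  set L := Real.log (1 + lam)
  set Z := hcZ G A lam
  have hK : 0 < K := Real.rpow_pos_of_pos (by linarith) _
  have hL : 0 ≤ L := Real.log_nonneg (by linarith)
  have hZ : 0 < Z := hcZ_pos hl.le
  have ha' : 0 < 1 + a := by linarith
  have h1 := hcSize_ge hl.le h
  have h2 : Z ≤ Real.exp (L * A.card) := hcZ_le_exp hl.le
  have h3 : L * A.card / (1 + a) * Z ≤ (1 + lam) / lam * (K * L / (1 + a)) * hcSize G A lam := by
    calc _ = (1 + lam) / lam * (K * L / (1 + a)) * (lam / (1 + lam) * (A.card / K) * Z) := by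
          field_simp
      _ ≤ _ := by gcongr
  -- With y = |A|, split Z as Z(1+a-Ly)/(1+a) + Z·Ly/(1+a). The first part is controlled by Z ≤
  -- exp(Ly) and 1+s ≤ exp s, the second by the occupancy bound `h3`.
  have h4 : Real.exp a ≥ Z * (1 + (a - L * A.card)) := by
    have h5 : Z * Real.exp (a - L * A.card) ≤ Real.exp a := by
      calc _ ≤ Real.exp (L * A.card) * Real.exp (a - L * A.card) := by gcongr
        _ = _ := by rw [← Real.exp_add]; ring_nf
    have h6 := Real.add_one_le_exp (a - L * A.card)
    nlinarith
  calc Z = (Z * (1 + (a - L * A.card))) / (1 + a) + L * A.card / (1 + a) * Z := by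
        field_simp; ring
    _ ≤ _ := by gcongr

open Classical in
theorem sum_hcOcc_eq (B : Finset V) : ∑ v ∈ B, hcOcc G A lam v =
    ∑ I ∈ indepOn G A, lam ^ I.card * ((I ∩ B).card : ℝ) := by
  unfold hcOcc
  simp_rw [Finset.sum_filter]
  rw [Finset.sum_comm]
  refine Finset.sum_congr rfl fun I _ => ?_
  rw [← Finset.sum_filter, Finset.filter_mem_eq_inter, Finset.inter_comm]
  simp [mul_comm]

-- Condition on the part M of the set outside B = N(u) ∩ A. Given M, the rest is hard-core on the
-- uncovered vertices of B, which are sparse, so `hcZ_le_local` applies. The constant terms add up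
-- to the weight of the sets avoiding B, and this is a multiple of the weight of those containing u.
open Classical in
theorem local_occupancy (hl : 0 < lam) {u : V} (hu : u ∈ A) {B : Finset V}
    (hBm : ∀ v, v ∈ B ↔ v ∈ A ∧ G.Adj u v) (h : (degSum G B : ℝ) ≤ 2 * t) (ha : -1 < a) :
    hcZ G A lam ≤ (1 + lam) / lam * (Real.exp a / (1 + a)) * hcOcc G A lam u +
      (1 + lam) / lam * ((1 + lam) ^ Real.sqrt (2 * t) * Real.log (1 + lam) / (1 + a)) *
        ∑ v ∈ B, hcOcc G A lam v := by
  set b := Real.exp a / (1 + a)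
  set g := (1 + lam) / lam * ((1 + lam) ^ Real.sqrt (2 * t) * Real.log (1 + lam) / (1 + a))
  have hB : B ⊆ A := fun v hv => ((hBm v).1 hv).1
  have hcard : ∀ M ∈ indepOn G (A \ B), ∀ K ∈ indepOn G (uncov G B M),
      ((M ∪ K) ∩ B).card = K.card := fun M hM K hK => by
    congr 1
    rw [mem_indepOn] at hM hK
    ext x
    simp only [Finset.mem_inter, Finset.mem_union]
    constructor
    · rintro ⟨h | h, hx⟩
      · exact absurd hx (Finset.mem_sdiff.1 (hM.1 h)).2
      · exact h
    · exact fun h => ⟨Or.inr h, uncov_subset (hK.1 h)⟩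
  have e1 : hcZ G A lam = ∑ M ∈ indepOn G (A \ B), lam ^ M.card * hcZ G (uncov G B M) lam := by
    have := sum_pow_indepOn_eq (H := G) (lam := lam) hB fun _ => 1
    simpa [hcZ] using this
  have e2 : ∑ v ∈ B, hcOcc G A lam v =
      ∑ M ∈ indepOn G (A \ B), lam ^ M.card * hcSize G (uncov G B M) lam := by
    rw [sum_hcOcc_eq, sum_pow_indepOn_eq hB]
    refine Finset.sum_congr rfl fun M hM => ?_
    congr 1
    unfold hcSize
    refine Finset.sum_congr rfl fun K hK => ?_
    rw [hcard M hM K hK, mul_comm]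
  -- All neighbours of u have been removed, so u is isolated in A \ B and contributes a factor 1 +
  -- lam.
  have e3 : hcZ G (A \ B) lam ≤ (1 + lam) / lam * hcOcc G A lam u := by
    have hs : A \ B = insert u (A.filter fun x => x ≠ u ∧ ¬ G.Adj u x) := by
      ext x
      simp only [hBm, Finset.mem_sdiff, Finset.mem_insert, Finset.mem_filter]
      by_cases hx : x = u
      · subst hx; simp [hu]
      · simp only [hx]; tauto
    rw [hcOcc_eq hu, hs]
    refine (hcZ_insert_le hl.le (by simp)).trans (le_of_eq ?_)
    field_simp
  have hb : 0 ≤ b := div_nonneg (Real.exp_pos _).le (by linarith)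
  calc hcZ G A lam ≤ ∑ M ∈ indepOn G (A \ B), lam ^ M.card *
          (b + g * hcSize G (uncov G B M) lam) := by
        rw [e1]
        refine Finset.sum_le_sum fun M _ => mul_le_mul_of_nonneg_left ?_ (by positivity)
        refine hcZ_le_local hl (le_trans ?_ h) ha
        exact_mod_cast degSum_mono uncov_subset
    _ = b * hcZ G (A \ B) lam + g * ∑ v ∈ B, hcOcc G A lam v := by
        rw [e2, hcZ, Finset.mul_sum, Finset.mul_sum, ← Finset.sum_add_distrib]
        exact Finset.sum_congr rfl fun M _ => by ring
    _ ≤ b * ((1 + lam) / lam * hcOcc G A lam u) + g * ∑ v ∈ B, hcOcc G A lam v := by gcongr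
    _ = _ := by ring

end LocalOccupancy

/-! ### The Lambert function on [0, ∞). -/

section Lambert

theorem lambertW_spec {z : ℝ} (hz : 0 ≤ z) :
    0 ≤ lambertW z ∧ lambertW z * Real.exp (lambertW z) = z := by
  have hc : ContinuousOn (fun y : ℝ => y * Real.exp y) (Set.Icc 0 z) := by fun_prop
  have hmem : z ∈ Set.Icc ((fun y : ℝ => y * Real.exp y) 0) ((fun y : ℝ => y * Real.exp y) z) := by
    refine ⟨by simpa using hz, ?_⟩
    exact le_mul_of_one_le_right hz (Real.one_le_exp hz)
  obtain ⟨y, hy, hyz⟩ := intermediate_value_Icc hz hc hmem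
  have hex : ∃ y ∈ Set.Ici (-1 : ℝ), (fun y : ℝ => y * Real.exp y) y = z :=
    ⟨y, by have := hy.1; simp only [Set.mem_Ici]; linarith, hyz⟩
  have h2 : lambertW z * Real.exp (lambertW z) = z := Function.invFunOn_eq hex
  -- Only a preimage of z is known so far; it cannot be negative, since y·exp y has the sign of y.
  refine ⟨?_, h2⟩
  by_contra! hneg
  have := mul_neg_of_neg_of_pos hneg (Real.exp_pos (lambertW z))
  linarith

theorem lambertQuot_eq {z : ℝ} (hz : 0 ≤ z) : lambertQuot z = Real.exp (-lambertW z) := by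
  obtain ⟨h0, h1⟩ := lambertW_spec hz
  unfold lambertQuot
  split_ifs with h
  · rw [h] at h1 h0 ⊢
    have : lambertW 0 = 0 := by simpa using h1
    simp [this]
  · have hw : lambertW z ≠ 0 := fun h' => h (by rw [← h1, h', zero_mul])
    nth_rewrite 2 [← h1]
    rw [Real.exp_neg]
    field_simp

/-- The map y ↦ y·exp y has slope at least 1 on [0, ∞), so its inverse is 1-Lipschitz. This serves
only to prove continuity. -/
theorem lambertW_sub_le {y z : ℝ} (hz : 0 ≤ z) (hzy : z ≤ y) :
    |lambertW y - lambertW z| ≤ |y - z| := by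
  obtain ⟨h0, h1⟩ := lambertW_spec hz
  obtain ⟨h2, h3⟩ := lambertW_spec (hz.trans hzy)
  rw [abs_of_nonneg (sub_nonneg.2 hzy)]
  have hle : lambertW z ≤ lambertW y := by
    by_contra! hlt
    have e := Real.exp_lt_exp.2 hlt
    have := mul_lt_mul'' hlt e h2 (Real.exp_pos _).le
    linarith
  rw [abs_of_nonneg (sub_nonneg.2 hle)]
  have e1 := Real.one_le_exp h0
  have e2 := Real.exp_le_exp.2 hle
  calc lambertW y - lambertW z ≤ (lambertW y - lambertW z) * Real.exp (lambertW z) :=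
        le_mul_of_one_le_right (sub_nonneg.2 hle) e1
    _ ≤ y - z := by nlinarith [mul_nonneg h2 (sub_nonneg.2 e2)]

theorem continuousOn_lambertW : ContinuousOn lambertW (Set.Ici 0) := by
  refine LipschitzOnWith.continuousOn (K := 1) ?_
  refine LipschitzOnWith.of_dist_le_mul fun y hy z hz => ?_
  rw [NNReal.coe_one, one_mul, Real.dist_eq, Real.dist_eq]
  rcases le_total z y with h | h
  · exact lambertW_sub_le hz h
  · rw [abs_sub_comm, abs_sub_comm y]
    exact lambertW_sub_le hy h

theorem continuousOn_lambertQuot : ContinuousOn lambertQuot (Set.Ici 0) := by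
  refine ContinuousOn.congr ?_ fun z hz => lambertQuot_eq hz
  exact Real.continuous_exp.comp_continuousOn continuousOn_lambertW.neg

end Lambert

/-! ### The occupancy fraction. -/

section Occupancy

variable {V : Type u} [Fintype V] (G : SimpleGraph V)

theorem indepSets_eq : indepSets G = indepOn G Finset.univ := by
  classical
  ext I
  simp [indepSets, indepOn]

theorem occupancyFraction_eq_hcSize (lam : ℝ) : occupancyFraction G lam =
    hcSize G Finset.univ lam / hcZ G Finset.univ lam / Fintype.card V := by
  rw [occupancyFraction_eq, indepSets_eq]
  congr 1
  unfold hcSize hardCoreProb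
  rw [Finset.sum_div]
  refine Finset.sum_congr rfl fun I _ => ?_
  rw [indepSets_eq, ← hcZ]
  ring

/-- Cross-multiply and symmetrise over pairs (I, J): with i = |I| and j = |J| every term (i-j)(xⁱyʲ
- xʲyⁱ) is nonpositive. Monotonicity in the fugacity lets a bound at any x ≤ lam serve at lam. -/
theorem hcSize_div_mono {W : Type*} {H : SimpleGraph W} {A : Finset W} {x y : ℝ} (hx : 0 ≤ x)
    (hxy : x ≤ y) : hcSize H A x / hcZ H A x ≤ hcSize H A y / hcZ H A y := by
  rw [div_le_div_iff₀ (hcZ_pos hx) (hcZ_pos (hx.trans hxy))]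
  have hpow : ∀ i j : ℕ, i ≤ j → x ^ j * y ^ i ≤ x ^ i * y ^ j := fun i j hij => by
    obtain ⟨k, rfl⟩ := Nat.exists_eq_add_of_le hij
    have : x ^ k ≤ y ^ k := pow_le_pow_left₀ hx hxy k
    have h2 : 0 ≤ x ^ i * y ^ i := mul_nonneg (pow_nonneg hx _) (pow_nonneg (hx.trans hxy) _)
    rw [pow_add, pow_add]
    nlinarith
  have hterm : ∀ i j : ℕ, ((i : ℝ) - j) * (x ^ i * y ^ j - x ^ j * y ^ i) ≤ 0 := fun i j => by
    rcases le_total i j with h | h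
    · have h1 : (i : ℝ) - j ≤ 0 := by simpa using h
      exact mul_nonpos_of_nonpos_of_nonneg h1 (sub_nonneg.2 (hpow i j h))
    · have h1 : 0 ≤ (i : ℝ) - j := by simpa using h
      refine mul_nonpos_of_nonneg_of_nonpos h1 (sub_nonpos.2 (hpow j i h))
  have hsum : ∑ I ∈ indepOn H A, ∑ J ∈ indepOn H A,
      ((I.card : ℝ) - J.card) * (x ^ I.card * y ^ J.card - x ^ J.card * y ^ I.card) ≤ 0 :=
    Finset.sum_nonpos fun I _ => Finset.sum_nonpos fun J _ => hterm _ _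
  have e : ∀ (f g : Finset W → ℝ), (∑ I ∈ indepOn H A, f I) * (∑ J ∈ indepOn H A, g J) =
      ∑ I ∈ indepOn H A, ∑ J ∈ indepOn H A, f I * g J := fun f g => Finset.sum_mul_sum _ _ _ _
  have e1 : ∑ I ∈ indepOn H A, ∑ J ∈ indepOn H A,
      ((I.card : ℝ) - J.card) * (x ^ I.card * y ^ J.card - x ^ J.card * y ^ I.card) =
      2 * (hcSize H A x * hcZ H A y) - 2 * (hcSize H A y * hcZ H A x) := by
    have s1 : hcSize H A x * hcZ H A y = ∑ I ∈ indepOn H A, ∑ J ∈ indepOn H A,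
        (I.card : ℝ) * x ^ I.card * y ^ J.card := e _ _
    have s2 : hcSize H A x * hcZ H A y = ∑ I ∈ indepOn H A, ∑ J ∈ indepOn H A,
        (J.card : ℝ) * x ^ J.card * y ^ I.card := by rw [s1, Finset.sum_comm]
    have s3 : hcSize H A y * hcZ H A x = ∑ I ∈ indepOn H A, ∑ J ∈ indepOn H A,
        (I.card : ℝ) * y ^ I.card * x ^ J.card := e _ _
    have s4 : hcSize H A y * hcZ H A x = ∑ I ∈ indepOn H A, ∑ J ∈ indepOn H A,
        (J.card : ℝ) * y ^ J.card * x ^ I.card := by rw [s3, Finset.sum_comm]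
    rw [two_mul, two_mul]
    nth_rewrite 1 [s1]
    nth_rewrite 1 [s2]
    nth_rewrite 1 [s3]
    nth_rewrite 1 [s4]
    simp_rw [← Finset.sum_add_distrib, ← Finset.sum_sub_distrib]
    exact Finset.sum_congr rfl fun I _ => Finset.sum_congr rfl fun J _ => by ring
  linarith

/-- Sum `local_occupancy` over u; each v is counted deg(v) ≤ Δ times, so with c = ΔKL the
coefficient of the expected size is (1+x)/x·(e^a + c)/(1+a). This is smallest when a·e^a = c, that
is a = W(c), and is then (1+x)/x·e^a. -/
theorem occupancyFraction_ge [Nonempty V] [DecidableRel G.Adj] {t : ℝ}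
    (ht : TrianglesAtMost G t) {x : ℝ} (hx : 0 < x) :
    x / (1 + x) * lambertQuot
        ((G.maxDegree : ℝ) * (1 + x) ^ Real.sqrt (2 * t) * Real.log (1 + x)) ≤
      occupancyFraction G x := by
  classical
  set K := (1 + x) ^ Real.sqrt (2 * t)
  set L := Real.log (1 + x)
  set Δ := (G.maxDegree : ℝ)
  have hK : 0 < K := Real.rpow_pos_of_pos (by linarith) _
  have hL : 0 ≤ L := Real.log_nonneg (by linarith)
  have hz : 0 ≤ Δ * K * L := by positivity
  rw [lambertQuot_eq hz]
  obtain ⟨hw, hwz⟩ := lambertW_spec hz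
  set w := lambertW (Δ * K * L)
  set Z := hcZ G Finset.univ x
  set S := hcSize G Finset.univ x
  have hZ : 0 < Z := hcZ_pos hx.le
  have hocc : ∀ v, 0 ≤ hcOcc G Finset.univ x v := fun v =>
    Finset.sum_nonneg fun _ _ => by positivity
  have h1 : ∀ u, Z ≤ (1 + x) / x * (Real.exp w / (1 + w)) * hcOcc G Finset.univ x u +
      (1 + x) / x * (K * L / (1 + w)) * ∑ v ∈ G.neighborFinset u, hcOcc G Finset.univ x v := by
    intro u
    exact local_occupancy hx (Finset.mem_univ u) (by simp)
      (degSum_le_of_trianglesAtMost ht u subset_rfl) (show -1 < w by linarith)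
  have h2 : ∑ u, ∑ v ∈ G.neighborFinset u, hcOcc G Finset.univ x v ≤ Δ * S := by
    have : ∀ u, ∑ v ∈ G.neighborFinset u, hcOcc G Finset.univ x v =
        ∑ v, if G.Adj u v then hcOcc G Finset.univ x v else 0 := fun u => by
      rw [← Finset.sum_filter]
      exact Finset.sum_congr (by ext; simp) fun _ _ => rfl
    simp_rw [this]
    rw [Finset.sum_comm, show S = ∑ v, hcOcc G Finset.univ x v from hcSize_eq, Finset.mul_sum]
    refine Finset.sum_le_sum fun v _ => ?_
    rw [← Finset.sum_filter, Finset.sum_const, nsmul_eq_mul]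
    refine mul_le_mul_of_nonneg_right ?_ (hocc v)
    have : (Finset.univ.filter fun u => G.Adj u v) = G.neighborFinset v := by
      ext; simp [G.adj_comm]
    rw [this, G.card_neighborFinset_eq_degree]
    exact Nat.cast_le.2 (G.degree_le_maxDegree v)
  have h3 : (Fintype.card V : ℝ) * Z ≤ (1 + x) / x * (Real.exp w / (1 + w)) * S +
      (1 + x) / x * (K * L / (1 + w)) * (Δ * S) := by
    calc (Fintype.card V : ℝ) * Z = ∑ _u : V, Z := by simp
      _ ≤ _ := Finset.sum_le_sum fun u _ => h1 u
      _ = (1 + x) / x * (Real.exp w / (1 + w)) * S + (1 + x) / x * (K * L / (1 + w)) *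
          ∑ u, ∑ v ∈ G.neighborFinset u, hcOcc G Finset.univ x v := by
          rw [Finset.sum_add_distrib, ← Finset.mul_sum, ← Finset.mul_sum,
            show S = ∑ v, hcOcc G Finset.univ x v from hcSize_eq]
      _ ≤ _ := by gcongr
  have h4 : (1 + x) / x * (Real.exp w / (1 + w)) * S + (1 + x) / x * (K * L / (1 + w)) * (Δ * S) =
      (1 + x) / x * Real.exp w * S := by
    have : (1 + x) / x * (Real.exp w / (1 + w)) * S + (1 + x) / x * (K * L / (1 + w)) * (Δ * S) =
      (1 + x) / x * ((Real.exp w + Δ * K * L) / (1 + w)) * S := by ring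
    rw [this, ← hwz]
    field_simp
  rw [h4] at h3
  rw [occupancyFraction_eq_hcSize]
  have hn : (0 : ℝ) < Fintype.card V := by exact_mod_cast Fintype.card_pos
  rw [le_div_iff₀ hn, le_div_iff₀ hZ, Real.exp_neg]
  calc x / (1 + x) * (Real.exp w)⁻¹ * (Fintype.card V) * Z
      = x / (1 + x) * (Real.exp w)⁻¹ * (Fintype.card V * Z) := by ring
    _ ≤ x / (1 + x) * (Real.exp w)⁻¹ * ((1 + x) / x * Real.exp w * S) := by gcongr
    _ = S := by field_simp

theorem exists_isGreatest_occupancy [Nonempty V] [DecidableRel G.Adj] {t : ℝ}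
    (ht : TrianglesAtMost G t) {lam : ℝ} (hl : 0 < lam) :
    ∃ m : ℝ, IsGreatest ((fun x : ℝ => x / (1 + x) *
        lambertQuot ((G.maxDegree : ℝ) * (1 + x) ^ Real.sqrt (2 * t) * Real.log (1 + x))) ''
        Set.Icc 0 lam) m ∧ m ≤ occupancyFraction G lam := by
  have hpos : ∀ x ∈ Set.Icc 0 lam, 0 < 1 + x := fun x hx => by have := hx.1; linarith
  have hcont : ContinuousOn (fun x : ℝ => x / (1 + x) *
        lambertQuot ((G.maxDegree : ℝ) * (1 + x) ^ Real.sqrt (2 * t) * Real.log (1 + x)))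
        (Set.Icc 0 lam) := by
    refine ContinuousOn.mul ?_ (continuousOn_lambertQuot.comp ?_ ?_)
    · exact ContinuousOn.div (by fun_prop) (by fun_prop) fun x hx => (hpos x hx).ne'
    · refine ContinuousOn.mul (ContinuousOn.mul continuousOn_const ?_) ?_
      · exact ContinuousOn.rpow_const (by fun_prop) fun x hx => Or.inl (hpos x hx).ne'
      · exact ContinuousOn.log (by fun_prop) fun x hx => (hpos x hx).ne'
    · intro x hx
      have h1 : 0 ≤ Real.log (1 + x) := Real.log_nonneg (by linarith [hx.1])
      have h2 : 0 ≤ (1 + x) ^ Real.sqrt (2 * t) := Real.rpow_nonneg (hpos x hx).le _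
      exact Set.mem_Ici.2 (by positivity)
  have hne : ((fun x : ℝ => x / (1 + x) *
        lambertQuot ((G.maxDegree : ℝ) * (1 + x) ^ Real.sqrt (2 * t) * Real.log (1 + x))) ''
        Set.Icc 0 lam).Nonempty := ⟨_, 0, ⟨le_rfl, hl.le⟩, rfl⟩
  obtain ⟨m, hm⟩ := (isCompact_Icc.image_of_continuousOn hcont).exists_isGreatest hne
  refine ⟨m, hm, ?_⟩
  obtain ⟨x, hx, rfl⟩ := hm.1
  have hmono : 0 ≤ x → x ≤ lam → occupancyFraction G x ≤ occupancyFraction G lam := fun h h' => by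
    rw [occupancyFraction_eq_hcSize, occupancyFraction_eq_hcSize]
    exact div_le_div_of_nonneg_right (hcSize_div_mono h h') (by positivity)
  rcases hx.1.eq_or_lt with h | h
  -- Local occupancy needs a positive fugacity; at x = 0 both sides vanish.
  · subst h
    refine le_trans (le_of_eq ?_) (hmono le_rfl hx.2)
    simp [occupancyFraction]
  · exact (occupancyFraction_ge G ht h).trans (hmono hx.1 hx.2)

end Occupancy

/-! ### Fractional colouring. -/

section Fractional

variable {V : Type u} [Fintype V] {G : SimpleGraph V}

open Classical in
/-- The greedy fractional colouring algorithm: weights `m` on independent sets that give each vertex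
`v` of `A` total weight `r v`, with a finishing time `T v` for each vertex. -/
theorem exists_greedy_weights {lam : ℝ} (hl : 0 < lam) {β γ : V → ℝ} (hβ : ∀ v, 0 ≤ β v)
    (hγ : ∀ v, 0 ≤ γ v)
    (hloc : ∀ A : Finset V, ∀ u ∈ A, hcZ G A lam ≤ β u * hcOcc G A lam u +
      γ u * ∑ v ∈ A.filter (G.Adj u), hcOcc G A lam v) (n : ℕ) :
    ∀ (A : Finset V), A.card = n → ∀ r : V → ℝ, (∀ v ∈ A, 0 < r v) →
    ∃ (m : Finset V → ℝ) (T : V → ℝ), (∀ I, 0 ≤ m I) ∧ (∀ I, I ∉ indepOn G A → m I = 0) ∧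
      (∀ v ∈ A, ∑ I with v ∈ I, m I = r v) ∧
      (∀ v ∈ A, 0 ≤ T v ∧ T v ≤ β v * r v + γ v * ∑ w ∈ A.filter (G.Adj v), r w) ∧
      ∀ b, 0 ≤ b → ∑ I with ∃ v ∈ I, T v ≤ b, m I ≤ b := by
  induction n using Nat.strong_induction_on with
  | _ n ih =>
  intro A hA r hr
  rcases A.eq_empty_or_nonempty with rfl | hne
  · exact ⟨fun _ => 0, fun _ => 0, by simp, by simp, by simp, by simp, by simp⟩
  set Z := hcZ G A lam
  have hZ : 0 < Z := hcZ_pos hl.le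
  set P : V → ℝ := fun v => hcOcc G A lam v / Z
  have hP : ∀ v ∈ A, 0 < P v := fun v hv => by
    refine div_pos ?_ hZ
    rw [hcOcc_eq hv]
    exact mul_pos hl (hcZ_pos hl.le)
  obtain ⟨v₀, hv₀, hmin⟩ := Finset.exists_min_image A (fun v => r v / P v) hne
  -- The time at which the hard-core process on A first meets a whole demand. The vertex v₀ is then
  -- finished, so the induction continues on the smaller set A' with demands r'.
  set τ := r v₀ / P v₀
  have hτ : 0 < τ := div_pos (hr _ hv₀) (hP _ hv₀)
  set r' : V → ℝ := fun v => r v - τ * P v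
  have hr' : ∀ v ∈ A, 0 ≤ r' v := fun v hv => by
    have := hmin v hv
    rw [le_div_iff₀ (hP v hv)] at this
    exact sub_nonneg.2 this
  set A' := A.filter fun v => 0 < r' v
  have hA' : A' ⊆ A := Finset.filter_subset _ _
  have hcard : A'.card < n := by
    rw [← hA]
    refine Finset.card_lt_card (Finset.filter_ssubset.2 ⟨v₀, hv₀, ?_⟩)
    have : τ * P v₀ = r v₀ := div_mul_cancel₀ _ (hP v₀ hv₀).ne'
    simp [r', this]
  obtain ⟨m', T', hm', hs', ht', hT', hb'⟩ := ih _ hcard A' rfl r'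
    fun v hv => (Finset.mem_filter.1 hv).2
  set m₀ : Finset V → ℝ := fun I => if I ∈ indepOn G A then τ * (lam ^ I.card / Z) else 0
  have hm₀ : ∀ I, 0 ≤ m₀ I := fun I => by
    simp only [m₀]; split_ifs <;> positivity
  have hm₀sum : ∑ I, m₀ I = τ := by
    simp only [m₀]
    rw [← Finset.sum_filter, ← Finset.mul_sum, ← Finset.sum_div]
    rw [Finset.filter_mem_eq_inter, Finset.univ_inter]
    change τ * (Z / Z) = τ
    rw [div_self hZ.ne', mul_one]
  have hm₀v : ∀ v, ∑ I with v ∈ I, m₀ I = τ * P v := fun v => by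
    simp only [m₀, P, hcOcc]
    rw [← Finset.sum_filter, ← Finset.mul_sum, ← Finset.sum_div, Finset.filter_filter]
    congr 3
    ext I
    simp [and_comm]
  have hsub : ∀ I, m' I ≠ 0 → I ⊆ A' := fun I hI => by
    by_contra h
    exact hI (hs' I fun h' => h (mem_indepOn.1 h').1)
  set T : V → ℝ := fun v => if v ∈ A' then τ + T' v else τ
  have hTτ : ∀ v, τ ≤ T v := fun v => by
    simp only [T]
    split_ifs with h
    · linarith [(hT' v h).1]
    · exact le_rfl
  refine ⟨fun I => m₀ I + m' I, T, fun I => add_nonneg (hm₀ I) (hm' I), ?_, ?_, ?_, ?_⟩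
  · intro I hI
    have h1 : m' I = 0 := hs' I fun h => hI (indepOn_mono hA' h)
    simp [m₀, hI, h1]
  · intro v hv
    rw [Finset.sum_add_distrib, hm₀v]
    by_cases h : v ∈ A'
    · rw [ht' v h]; simp [r']
    · have h0 : r' v = 0 := le_antisymm
        (not_lt.1 fun h' => h (Finset.mem_filter.2 ⟨hv, h'⟩)) (hr' v hv)
      rw [Finset.sum_eq_zero (s := Finset.univ.filter fun I : Finset V => v ∈ I) (f := m')]
      · simp only [r'] at h0; linarith
      · intro I hI
        by_contra hI'
        exact h (hsub I hI' (Finset.mem_filter.1 hI).2)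
  · intro v hv
    refine ⟨hτ.le.trans (hTτ v), ?_⟩
    have h1 : T v ≤ τ + (β v * r' v + γ v * ∑ w ∈ A.filter (G.Adj v), r' w) := by
      have hn : ∀ w ∈ A.filter (G.Adj v), 0 ≤ r' w := fun w hw => hr' w (Finset.mem_filter.1 hw).1
      simp only [T]
      split_ifs with h
      · have h2 : ∑ w ∈ A'.filter (G.Adj v), r' w ≤ ∑ w ∈ A.filter (G.Adj v), r' w :=
          Finset.sum_le_sum_of_subset_of_nonneg (Finset.filter_subset_filter _ hA')
            fun w hw _ => hn w hw
        have h3 := mul_le_mul_of_nonneg_left h2 (hγ v)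
        linarith [(hT' v h).2]
      · have := mul_nonneg (hβ v) (hr' v hv)
        have := mul_nonneg (hγ v) (Finset.sum_nonneg hn)
        linarith
    -- Local occupancy, scaled by τ: the potential of v drops by at least τ during a phase of length
    -- τ.
    have h2 : τ ≤ β v * (τ * P v) + γ v * ∑ w ∈ A.filter (G.Adj v), τ * P w := by
      have h3 := hloc A v hv
      have h4 : 1 ≤ β v * P v + γ v * ∑ w ∈ A.filter (G.Adj v), P w := by
        simp only [P]
        rw [← Finset.sum_div, ← mul_div_assoc, ← mul_div_assoc, ← add_div, le_div_iff₀ hZ, one_mul]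
        exact h3
      rw [← Finset.mul_sum]
      nlinarith
    calc T v ≤ τ + (β v * r' v + γ v * ∑ w ∈ A.filter (G.Adj v), r' w) := h1
      _ = τ + (β v * r v + γ v * ∑ w ∈ A.filter (G.Adj v), r w) -
          (β v * (τ * P v) + γ v * ∑ w ∈ A.filter (G.Adj v), τ * P w) := by
          simp only [r', Finset.sum_sub_distrib]; ring
      _ ≤ _ := by linarith
  · intro b hb
    -- No vertex finishes before τ. Later the first phase accounts for weight at most τ, and the
    -- recursive run for at most b - τ.
    rcases lt_or_ge b τ with h | h
    · rw [Finset.sum_eq_zero]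
      · exact hb
      · intro I hI
        obtain ⟨v, hv, hTv⟩ := (Finset.mem_filter.1 hI).2
        linarith [hTτ v]
    · rw [Finset.sum_add_distrib]
      have h1 : ∑ I with ∃ v ∈ I, T v ≤ b, m₀ I ≤ τ := by
        rw [← hm₀sum]
        exact Finset.sum_le_sum_of_subset_of_nonneg (Finset.filter_subset _ _) fun I _ _ => hm₀ I
      have h2 : ∑ I with ∃ v ∈ I, T v ≤ b, m' I ≤ ∑ I with ∃ v ∈ I, T' v ≤ b - τ, m' I := by
        rw [Finset.sum_filter, Finset.sum_filter]
        refine Finset.sum_le_sum fun I _ => ?_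
        by_cases hI : m' I = 0
        · simp [hI]
        · split_ifs with c1 c2 c2
          · exact le_rfl
          · obtain ⟨v, hv, hTv⟩ := c1
            refine absurd ⟨v, hv, ?_⟩ c2
            simp only [T, hsub I hI hv, if_true] at hTv
            linarith
          · exact hm' I
          · exact le_rfl
      linarith [hb' (b - τ) (by linarith)]

open Classical in
/-- Scheduling the independent sets by their deadlines yields a fractional colouring. -/
theorem exists_fractionalColouring_of_weights {m : Finset V → ℝ} {T : V → ℝ} (hm : ∀ I, 0 ≤ m I)
    (hs : ∀ I, I ∉ indepSets G → m I = 0) (ht : ∀ v, ∑ I with v ∈ I, m I = 1)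
    (hT : ∀ v, 0 ≤ T v) (hb : ∀ b, 0 ≤ b → ∑ I with ∃ v ∈ I, T v ≤ b, m I ≤ b) :
    ∃ c : FractionalColouring G, ∀ x, c.colours x ⊆ Set.Ico 0 (T x) := by
  -- The deadline of I is the earliest finishing time of its vertices, ⊤ for the empty set. Pairing
  -- it with an enumeration breaks ties and gives a linear order on the sets.
  let d : Finset V → WithTop ℝ := fun I => I.inf fun v => (T v : WithTop ℝ)
  let key : Finset V → Lex (WithTop ℝ × Fin (Fintype.card (Finset V))) :=
    fun I => toLex (d I, Fintype.equivFin _ I)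
  have hkey : Function.Injective key := fun I J h => by
    have h' := congrArg (fun x => (ofLex x).2) h
    exact (Fintype.equivFin _).injective h'
  let lo : Finset V → ℝ := fun I => ∑ J with key J < key I, m J
  have hlo : ∀ I, 0 ≤ lo I := fun I => Finset.sum_nonneg fun J _ => hm J
  have hhi : ∀ I, lo I + m I = ∑ J with key J ≤ key I, m J := fun I => by
    have : (Finset.univ.filter fun J => key J ≤ key I) =
        insert I (Finset.univ.filter fun J => key J < key I) := by
      ext J
      simp only [Finset.mem_filter, Finset.mem_univ, true_and, Finset.mem_insert, le_iff_eq_or_lt,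
        hkey.eq_iff]
    rw [this, Finset.sum_insert (by simp), add_comm]
  have hlt : ∀ I J, key I < key J → lo I + m I ≤ lo J := fun I J h => by
    rw [hhi]
    refine Finset.sum_le_sum_of_subset_of_nonneg (fun K hK => ?_) fun K _ _ => hm K
    simp only [Finset.mem_filter, Finset.mem_univ, true_and] at hK ⊢
    exact hK.trans_lt h
  have hdisj : ∀ I J, key I < key J →
      Disjoint (Set.Ico (lo I) (lo I + m I)) (Set.Ico (lo J) (lo J + m J)) := fun I J h => by
    refine Set.disjoint_left.2 fun x hx hx' => ?_
    linarith [hx.2, hx'.1, hlt I J h]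
  refine ⟨⟨lo, fun I => lo I + m I, fun I _ => hlo I, fun I _ => by linarith [hm I], ?_, ?_⟩, ?_⟩
  · intro I _ J _ hIJ
    rcases lt_or_gt_of_ne (hkey.ne hIJ) with h | h
    · exact hdisj I J h
    · exact (hdisj J I h).symm
  · intro x
    rw [← ht x]
    refine (Finset.sum_congr rfl fun I _ => by ring).trans
      (Finset.sum_subset (Finset.filter_subset_filter _ (Finset.subset_univ _)) fun I hI hI' => ?_)
    refine hs I fun h => hI' ?_
    rw [Finset.mem_filter] at hI ⊢
    exact ⟨h, hI.2⟩
  · intro x y hy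
    simp only [FractionalColouring.colours, Set.mem_iUnion] at hy
    obtain ⟨I, ⟨hI, hxI⟩, h1, h2⟩ := hy
    refine ⟨(hlo I).trans h1, h2.trans_le ?_⟩
    -- Every set placed no later than I, which contains x, has a deadline of at most T x, and such
    -- sets have total weight at most T x.
    refine le_trans ?_ (hb (T x) (hT x))
    rw [hhi]
    refine Finset.sum_le_sum_of_subset_of_nonneg (fun J hJ => ?_) fun J _ _ => hm J
    simp only [Finset.mem_filter, Finset.mem_univ, true_and] at hJ ⊢
    have h3 : d J ≤ d I := by
      rcases (Prod.Lex.le_iff.1 hJ) with h | h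
      · exact h.le
      · exact h.1.le
    have h4 : d J ≤ (T x : WithTop ℝ) := h3.trans (Finset.inf_le hxI)
    obtain ⟨w, hw, hw'⟩ := (Finset.inf_le_iff (WithTop.coe_lt_top _)).1 h4
    exact ⟨w, hw, WithTop.coe_le_coe.1 hw'⟩

-- Taking b = k, the nonempty sets weigh at most k in total. Dividing by k leaves a nonnegative
-- remainder, which goes to the empty set.
open Classical in
theorem fracChromaticNumber_le_of_weights {m : Finset V → ℝ} {T : V → ℝ} (hm : ∀ I, 0 ≤ m I)
    (hs : ∀ I, I ∉ indepSets G → m I = 0) (ht : ∀ v, ∑ I with v ∈ I, m I = 1)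
    (hb : ∀ b, 0 ≤ b → ∑ I with ∃ v ∈ I, T v ≤ b, m I ≤ b) {k : ℝ} (hk : 0 < k)
    (hT : ∀ v, T v ≤ k) : fracChromaticNumber G ≤ k := by
  refine csInf_le ⟨0, fun x hx => hx.1.le⟩ ⟨hk, ?_⟩
  have hempty : (∅ : Finset V) ∈ indepSets G := by rw [indepSets_eq]; exact empty_mem_indepOn
  set s := ∑ I ∈ (indepSets G).erase ∅, m I
  have hsk : s ≤ k := by
    refine le_trans ?_ (hb k hk.le)
    refine Finset.sum_le_sum_of_subset_of_nonneg (fun I hI => ?_) fun J _ _ => hm J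
    obtain ⟨v, hv⟩ := Finset.nonempty_iff_ne_empty.2 (Finset.mem_erase.1 hI).1
    exact Finset.mem_filter.2 ⟨Finset.mem_univ _, v, hv, hT v⟩
  refine ⟨fun I => if I = ∅ then 1 - s / k else m I / k, ?_, ?_, ?_⟩
  · intro I _
    split_ifs
    · exact sub_nonneg.2 ((div_le_one hk).2 hsk)
    · exact div_nonneg (hm I) hk.le
  · rw [← Finset.add_sum_erase _ _ hempty, if_pos rfl,
      Finset.sum_congr rfl fun I hI => if_neg (Finset.mem_erase.1 hI).1, ← Finset.sum_div]
    ring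
  · intro x
    rw [← ht x, Finset.sum_div]
    refine le_of_eq ?_
    rw [← Finset.sum_subset (Finset.filter_subset_filter _ (Finset.subset_univ (indepSets G)))]
    · refine Finset.sum_congr rfl fun I hI => ?_
      rw [if_neg]
      rintro rfl
      simp at hI
    · intro I hI hI'
      rw [hs I fun h => hI' ?_, zero_div]
      rw [Finset.mem_filter] at hI ⊢
      exact ⟨h, hI.2⟩

/-- The choice of the parameters of the local occupancy inequality. -/
theorem exists_fractional_params {ε : ℝ} (hε : 0 < ε) (hε1 : ε ≤ 1) :
    ∃ δ₀ : ℝ, Real.exp 1 ≤ δ₀ ∧ ∀ t : ℝ, 1 / 2 ≤ t → ∃ lam : ℝ, 0 < lam ∧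
      ∀ D : ℝ, δ₀ * Real.sqrt t ≤ D → ∃ a : ℝ, 0 < 1 + a ∧
        (1 + lam) / lam * (Real.exp a / (1 + a)) +
          (1 + lam) / lam * ((1 + lam) ^ Real.sqrt (2 * t) * Real.log (1 + lam) / (1 + a)) * D ≤
        (1 + ε) * (D / Real.log (D / Real.sqrt t)) := by
  -- 1/Q = (ε/20)(ε/40) is the loss between D/√t and exp a below; δ₀ is chosen so that log Q ≤
  -- (ε/20)·log(D/√t).
  set Q := 800 / ε ^ 2
  have hQ : 800 ≤ Q := by
    rw [le_div_iff₀ (by positivity)]; nlinarith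
  have hlogQ : 1 ≤ Real.log Q := by
    rw [Real.le_log_iff_exp_le (by linarith)]
    linarith [Real.exp_one_lt_d9]
  refine ⟨Real.exp (20 / ε * Real.log Q), ?_, fun t ht => ?_⟩
  · refine Real.exp_le_exp.2 ?_
    have : 1 ≤ 20 / ε := by rw [le_div_iff₀ hε]; linarith
    nlinarith
  set st := Real.sqrt t
  have hst : 0 < st := Real.sqrt_pos.2 (by linarith)
  have hst7 : 7 / 10 ≤ st := Real.le_sqrt_of_sq_le (by norm_num; linarith)
  have hs2 : Real.sqrt (2 * t) ≤ 3 / 2 * st := by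
    refine Real.sqrt_le_iff.2 ⟨by positivity, ?_⟩
    rw [mul_pow, Real.sq_sqrt (by linarith)]
    linarith
  -- Of order 1/√t, so that K = (1+lam)^√(2t) is at most exp(3ε/40), while lam·D is still of the
  -- order of D/√t.
  set lam := ε / 20 / st
  have hlam : 0 < lam := by positivity
  have hlam1 : lam ≤ ε / 10 := by
    rw [div_le_iff₀ hst]; nlinarith
  set K := (1 + lam) ^ Real.sqrt (2 * t)
  set L := Real.log (1 + lam)
  have hL1 : L ≤ lam := by have := Real.log_le_sub_one_of_pos (show 0 < 1 + lam by linarith); linarith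
  have hL2 : lam / (1 + lam) ≤ L := by
    have := Real.one_sub_inv_le_log_of_pos (show 0 < 1 + lam by linarith)
    refine le_trans (le_of_eq ?_) this
    field_simp; ring
  have hL0 : 0 < L := lt_of_lt_of_le (by positivity) hL2
  have hK1 : 1 ≤ K := Real.one_le_rpow (by linarith) (Real.sqrt_nonneg _)
  have hK2 : K ≤ 1 + ε / 10 := by
    have h1 : K ≤ Real.exp (3 / 40 * ε) := by
      rw [show K = _ from Real.rpow_def_of_pos (by linarith) _]
      refine Real.exp_le_exp.2 ?_
      calc L * Real.sqrt (2 * t) ≤ lam * (3 / 2 * st) := by gcongr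
        _ = 3 / 40 * ε := by simp only [lam]; field_simp; norm_num
    refine h1.trans ?_
    have h2 := Real.exp_bound_div_one_sub_of_interval (x := 3 / 40 * ε) (by positivity) (by linarith)
    refine h2.trans ?_
    rw [div_le_iff₀ (by linarith)]
    nlinarith
  refine ⟨lam, hlam, fun D hD => ?_⟩
  have hD0 : 0 < D := lt_of_lt_of_le (by positivity) hD
  set q := Real.log (D / st)
  have hq : 20 / ε * Real.log Q ≤ q := by
    rw [Real.le_log_iff_exp_le (by positivity), le_div_iff₀ hst]
    exact hD
  have hq' : Real.log Q ≤ ε / 20 * q := by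
    rw [div_mul_eq_mul_div, div_le_iff₀ hε] at hq
    linarith
  have hq0 : 0 < q := by
    by_contra! h
    nlinarith
  set M := K * L * D
  have hM : ε / 40 * (D / st) ≤ M := by
    calc ε / 40 * (D / st) = 1 * (lam / 2) * D := by simp only [lam]; ring
      _ ≤ 1 * (lam / (1 + lam)) * D := by
          have h2 : lam / 2 ≤ lam / (1 + lam) :=
            div_le_div_of_nonneg_left hlam.le (by linarith) (by linarith)
          gcongr
      _ ≤ K * L * D := by gcongr
  have hM0 : 0 < M := lt_of_lt_of_le (by positivity) hM
  -- This makes exp a only ε/20 of the neighbour term M = KLD, while a stays within a factor 1 -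
  -- ε/20 of log(D/√t). The bound becomes about D/(1+a).
  refine ⟨Real.log (ε / 20 * M), ?_⟩
  have ha : (1 - ε / 20) * q ≤ Real.log (ε / 20 * M) := by
    have h1 : (D / st) / Q ≤ ε / 20 * M := by
      calc (D / st) / Q = ε / 20 * (ε / 40 * (D / st)) := by simp only [Q]; field_simp; norm_num
        _ ≤ _ := by gcongr
    have h2 := Real.log_le_log (by positivity) h1
    rw [Real.log_div (by positivity) (by positivity)] at h2
    linarith
  set a := Real.log (ε / 20 * M)
  have ha0 : 0 < (1 - ε / 20) * q := mul_pos (by linarith) hq0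
  refine ⟨by linarith, ?_⟩
  rw [show Real.exp a = ε / 20 * M from Real.exp_log (by positivity)]
  have e : (1 + lam) / lam * (ε / 20 * M / (1 + a)) + (1 + lam) / lam * (K * L / (1 + a)) * D =
      (1 + lam) * (1 + ε / 20) * K * (L / lam) * D / (1 + a) := by
    simp only [M]; ring
  rw [e]
  have h1a : (1 - ε / 20) * q ≤ 1 + a := by linarith
  have hLl : L / lam ≤ 1 := (div_le_one hlam).2 hL1
  calc (1 + lam) * (1 + ε / 20) * K * (L / lam) * D / (1 + a)
      ≤ (1 + ε / 10) * (1 + ε / 20) * (1 + ε / 10) * 1 * D / ((1 - ε / 20) * q) := by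
        gcongr
    _ = ((1 + ε / 10) * (1 + ε / 20) * (1 + ε / 10) / (1 - ε / 20)) * (D / q) := by
        field_simp
    _ ≤ (1 + ε) * (D / q) := by
        refine mul_le_mul_of_nonneg_right ?_ (by positivity)
        rw [div_le_iff₀ (by linarith)]
        have h2 : ε ^ 2 ≤ ε := by nlinarith
        have h3 : ε ^ 3 ≤ ε := by nlinarith
        nlinarith

-- The fugacity must be common to all vertices, but a may vary with the vertex. Degrees below δ₀√t
-- are replaced by δ₀√t, the least value for which the parameters work.
open Classical in
theorem exists_weights_of_sparse {ε : ℝ} (hε : 0 < ε) (hε1 : ε ≤ 1) :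
    ∃ δ₀ : ℝ, Real.exp 1 ≤ δ₀ ∧ ∀ (V : Type u) [Fintype V] (G : SimpleGraph V)
      [DecidableRel G.Adj] (t : ℝ), 1 / 2 ≤ t → TrianglesAtMost G t →
      ∃ (m : Finset V → ℝ) (T : V → ℝ), (∀ I, 0 ≤ m I) ∧ (∀ I, I ∉ indepSets G → m I = 0) ∧
        (∀ v, ∑ I with v ∈ I, m I = 1) ∧ (∀ v, 0 ≤ T v) ∧
        (∀ v, T v ≤ (1 + ε) * (max (G.degree v : ℝ) (δ₀ * Real.sqrt t) /
          Real.log (max (G.degree v : ℝ) (δ₀ * Real.sqrt t) / Real.sqrt t))) ∧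
        ∀ b, 0 ≤ b → ∑ I with ∃ v ∈ I, T v ≤ b, m I ≤ b := by
  obtain ⟨δ₀, hδ, hpar⟩ := exists_fractional_params hε hε1
  refine ⟨δ₀, hδ, fun V _ G _ t ht htri => ?_⟩
  obtain ⟨lam, hlam, hpar⟩ := hpar t ht
  choose a ha hab using fun v : V => hpar (max (G.degree v : ℝ) (δ₀ * Real.sqrt t))
    (le_max_right _ _)
  have hL : 0 ≤ Real.log (1 + lam) := Real.log_nonneg (by linarith)
  have hβ : ∀ v, 0 ≤ (1 + lam) / lam * (Real.exp (a v) / (1 + a v)) := fun v => by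
    have := (ha v).le; positivity
  have hγ : ∀ v, 0 ≤ (1 + lam) / lam *
      ((1 + lam) ^ Real.sqrt (2 * t) * Real.log (1 + lam) / (1 + a v)) := fun v => by
    have := (ha v).le; positivity
  obtain ⟨m, T, hm, hs, h1, hT, hb⟩ := exists_greedy_weights (G := G) hlam hβ hγ
    (fun A u hu => by
      refine local_occupancy (a := a u) hlam hu (by simp) ?_ (by linarith [ha u])
      exact degSum_le_of_trianglesAtMost htri u fun x hx => by
        simp only [Finset.mem_filter] at hx
        simpa using hx.2) _ Finset.univ rfl (fun _ => 1) (by simp)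
  refine ⟨m, T, hm, by rwa [indepSets_eq], fun v => h1 v (Finset.mem_univ _),
    fun v => (hT v (Finset.mem_univ _)).1, fun v => ?_, hb⟩
  refine ((hT v (Finset.mem_univ _)).2).trans (le_trans ?_ (hab v))
  rw [mul_one]
  refine add_le_add le_rfl (mul_le_mul_of_nonneg_left ?_ (hγ v))
  refine le_trans (le_of_eq ?_) (le_max_left _ _)
  rw [Finset.sum_const, nsmul_eq_mul, mul_one, ← G.card_neighborFinset_eq_degree]
  congr 2
  ext w
  simp

/-- Whichever argument attains the inner maximum, the left side equals the corresponding term on the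
right; no sign of either term is needed. -/
theorem max_div_log_le {d s δ : ℝ} (hs : 0 < s) :
    max d (δ * s) / Real.log (max d (δ * s) / s) ≤
      max (d / Real.log (d / s)) (δ / Real.log δ * s) := by
  rcases le_total d (δ * s) with h | h
  · rw [max_eq_right h, mul_div_cancel_right₀ δ hs.ne']
    refine le_trans (le_of_eq ?_) (le_max_right _ _)
    ring
  · rw [max_eq_left h]
    exact le_max_left _ _

theorem local_fractional_colouring {ε : ℝ} (hε : 0 < ε) : ∃ δ₀ : ℝ, 1 < δ₀ ∧
    ∀ (V : Type u) [Fintype V] (G : SimpleGraph V) [DecidableRel G.Adj] (t : ℝ),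
      1 / 2 ≤ t → TrianglesAtMost G t →
      ∃ c : FractionalColouring G, ∀ x : V,
        c.colours x ⊆ Set.Ico 0 ((1 + ε) *
          max ((G.degree x : ℝ) / Real.log ((G.degree x : ℝ) / Real.sqrt t))
            (δ₀ / Real.log δ₀ * Real.sqrt t)) := by
  -- The parameters need ε ≤ 1, and a smaller ε gives a stronger conclusion.
  obtain ⟨δ₀, hδ, h⟩ := exists_weights_of_sparse (lt_min hε one_pos) (min_le_right ε 1)
  have hδ1 : 1 < δ₀ := lt_of_lt_of_le (by linarith [Real.exp_one_gt_d9]) hδ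
  refine ⟨δ₀, hδ1, fun V _ G _ t ht htri => ?_⟩
  obtain ⟨m, T, hm, hs, h1, hT0, hT, hb⟩ := h V G t ht htri
  obtain ⟨c, hc⟩ := exists_fractionalColouring_of_weights hm hs h1 hT0 hb
  refine ⟨c, fun x => (hc x).trans (Set.Ico_subset_Ico_right ((hT x).trans ?_))⟩
  have hst : 0 < Real.sqrt t := Real.sqrt_pos.2 (by linarith)
  have h2 := max_div_log_le (d := G.degree x) (δ := δ₀) hst
  -- The second argument is positive, so an undefined first quotient, which has the value 0, never
  -- decides the maximum.
  have h3 : 0 ≤ max ((G.degree x : ℝ) / Real.log ((G.degree x : ℝ) / Real.sqrt t))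
      (δ₀ / Real.log δ₀ * Real.sqrt t) := by
    refine le_trans ?_ (le_max_right _ _)
    have := Real.log_pos hδ1
    positivity
  refine (mul_le_mul_of_nonneg_left h2 (by positivity)).trans ?_
  gcongr
  exact min_le_left _ _

/-- The function `x ↦ x / log (x / s)` is increasing for `x ≥ e s`. -/
theorem div_log_mono {x y s : ℝ} (hs : 0 < s) (hx : Real.exp 1 * s ≤ x) (hxy : x ≤ y) :
    x / Real.log (x / s) ≤ y / Real.log (y / s) := by
  have hx0 : 0 < x := lt_of_lt_of_le (by positivity) hx
  have h1 : Real.exp 1 ≤ x / s := (le_div_iff₀ hs).2 hx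
  have h2 : x / s ≤ y / s := by gcongr
  have hlog : ∀ z, Real.exp 1 ≤ z → 0 < Real.log z := fun z hz =>
    Real.log_pos (lt_of_lt_of_le (by linarith [Real.exp_one_gt_d9]) hz)
  have h3 := Real.log_div_self_antitoneOn (Set.mem_ofPred.2 h1) (Set.mem_ofPred.2 (h1.trans h2)) h2
  simp only at h3
  have hxs : 0 < x / s := by positivity
  have hys : 0 < y / s := lt_of_lt_of_le hxs h2
  rw [div_le_div_iff₀ hys hxs] at h3
  rw [div_le_div_iff₀ (hlog _ h1) (hlog _ (h1.trans h2))]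
  have e1 : x = x / s * s := by field_simp
  have e2 : y = y / s * s := by field_simp
  calc x * Real.log (y / s) = (Real.log (y / s) * (x / s)) * s := by field_simp
    _ ≤ (Real.log (x / s) * (y / s)) * s := by gcongr
    _ = y * Real.log (x / s) := by field_simp

/-- Once Δ/√t ≥ δ₀, every truncated degree lies between δ₀√t and Δ, where x/log(x/√t) is increasing,
so all finishing times are bounded by the value at Δ. -/
theorem fracChromaticNumber_asymptotic (t : ℕ → ℝ) (ht : ∀ Δ, 1 / 2 ≤ t Δ)
    (hlim : Tendsto (fun Δ : ℕ => (Δ : ℝ) / Real.sqrt (t Δ)) atTop atTop) {ε : ℝ} (hε : 0 < ε) :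
    ∃ Δ₀ : ℕ, ∀ Δ : ℕ, Δ₀ ≤ Δ →
      ∀ (V : Type u) [Fintype V] (G : SimpleGraph V) [DecidableRel G.Adj],
        G.maxDegree = Δ → TrianglesAtMost G (t Δ) →
        fracChromaticNumber G ≤
          (1 + ε) * ((Δ : ℝ) / Real.log ((Δ : ℝ) / Real.sqrt (t Δ))) := by
  obtain ⟨δ₀, hδ, h⟩ := exists_weights_of_sparse (lt_min hε one_pos) (min_le_right ε 1)
  have hδ1 : 1 < δ₀ := lt_of_lt_of_le (by linarith [Real.exp_one_gt_d9]) hδ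
  obtain ⟨Δ₀, hΔ₀⟩ := eventually_atTop.1 (hlim.eventually_ge_atTop δ₀)
  refine ⟨Δ₀, fun Δ hΔ V _ G _ hmax htri => ?_⟩
  have hst : 0 < Real.sqrt (t Δ) := Real.sqrt_pos.2 (by linarith [ht Δ])
  have h1 := hΔ₀ Δ hΔ
  have h1' : δ₀ * Real.sqrt (t Δ) ≤ Δ := (le_div_iff₀ hst).1 h1
  obtain ⟨m, T, hm, hs, h2, hT0, hT, hb⟩ := h V G (t Δ) (ht Δ) htri
  have hlog : 0 < Real.log ((Δ : ℝ) / Real.sqrt (t Δ)) := Real.log_pos (by linarith)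
  have hΔpos : (0 : ℝ) < Δ := lt_of_lt_of_le (by positivity) h1'
  refine fracChromaticNumber_le_of_weights hm hs h2 hb (by positivity) fun v => ?_
  refine (hT v).trans ?_
  have h3 : max (G.degree v : ℝ) (δ₀ * Real.sqrt (t Δ)) ≤ Δ := by
    refine max_le ?_ h1'
    rw [← hmax]
    exact Nat.cast_le.2 (G.degree_le_maxDegree v)
  have h4 := div_log_mono hst ((mul_le_mul_of_nonneg_right hδ hst.le).trans (le_max_right _ _)) h3
  have h5 : 0 ≤ (Δ : ℝ) / Real.log ((Δ : ℝ) / Real.sqrt (t Δ)) := by positivity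
  have h6 : 0 < min ε 1 := lt_min hε one_pos
  calc _ ≤ (1 + min ε 1) * ((Δ : ℝ) / Real.log ((Δ : ℝ) / Real.sqrt (t Δ))) := by gcongr
    _ ≤ _ := by gcongr; exact min_le_left _ _

end Fractional

/-! ### The lopsided Local Lemma. -/

section LocalLemma

open Classical in
/-- The symmetric lopsided Lovász Local Lemma for a weighted finite set. -/
theorem lovasz_local_lemma {α ι : Type*} [Fintype ι] (Ω : Finset α) (w : α → ℝ)
    (hw : ∀ x ∈ Ω, 0 ≤ w x) (hΩ : 0 < ∑ x ∈ Ω, w x) (Bad : ι → α → Prop) (N : ι → Finset ι)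
    {p : ℝ} (hp : 0 ≤ p) (hp4 : 4 * p ≤ 1)
    (hN : ∀ i, 4 * p * (N i).card ≤ 1)
    (hBad : ∀ i, ∀ S : Finset ι, Disjoint S (N i) →
      ∑ x ∈ Ω with Bad i x ∧ ∀ j ∈ S, ¬ Bad j x, w x ≤
        p * ∑ x ∈ Ω with ∀ j ∈ S, ¬ Bad j x, w x) :
    ∃ x ∈ Ω, ∀ i, ¬ Bad i x := by
  set g : Finset ι → ℝ := fun S => ∑ x ∈ Ω with ∀ j ∈ S, ¬ Bad j x, w x with hg
  have hg0 : ∀ S, 0 ≤ g S := fun S =>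
    Finset.sum_nonneg fun x hx => hw x (Finset.mem_filter.1 hx).1
  -- The usual induction: conditioned on avoiding the bad events of any set S, each bad event has
  -- probability at most 2p.
  have key : ∀ n : ℕ, ∀ S : Finset ι, S.card = n → ∀ i,
      ∑ x ∈ Ω with Bad i x ∧ ∀ j ∈ S, ¬ Bad j x, w x ≤ 2 * p * g S := by
    intro n
    induction n using Nat.strong_induction_on with
    | _ n ih =>
    intro S hS i
    set S₂ := S \ N i
    have hsub : S₂ ⊆ S := Finset.sdiff_subset
    have h1 : ∑ x ∈ Ω with Bad i x ∧ ∀ j ∈ S, ¬ Bad j x, w x ≤ p * g S₂ := by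
      refine le_trans ?_ (hBad i S₂ Finset.sdiff_disjoint)
      refine Finset.sum_le_sum_of_subset_of_nonneg (fun x hx => ?_)
        fun x hx _ => hw x (Finset.mem_filter.1 hx).1
      rw [Finset.mem_filter] at hx ⊢
      exact ⟨hx.1, hx.2.1, fun j hj => hx.2.2 j (hsub hj)⟩
    rcases hsub.eq_or_ssubset with h | h
    · rw [h] at h1
      nlinarith [mul_nonneg hp (hg0 S)]
    · have hlt : S₂.card < n := hS ▸ Finset.card_lt_card h
      -- Passing from S₂ to S excludes only events of N i, each of conditional probability at most
      -- 2p; together they remove at most half of g S₂.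
      have h2 : g S₂ ≤ g S + ∑ j ∈ N i, ∑ x ∈ Ω with Bad j x ∧ ∀ k ∈ S₂, ¬ Bad k x, w x := by
        simp only [hg, Finset.sum_filter]
        rw [Finset.sum_comm, ← Finset.sum_add_distrib]
        refine Finset.sum_le_sum fun x hx => ?_
        have hnn : ∀ j ∈ N i, 0 ≤ if Bad j x ∧ ∀ k ∈ S₂, ¬ Bad k x then w x else 0 :=
          fun j _ => by split_ifs; exacts [hw x hx, le_rfl]
        have hnn' := Finset.sum_nonneg hnn
        by_cases c2 : ∀ k ∈ S₂, ¬ Bad k x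
        · by_cases c1 : ∀ k ∈ S, ¬ Bad k x
          · rw [if_pos c2, if_pos c1]
            linarith
          · rw [if_pos c2, if_neg c1, zero_add]
            push Not at c1
            obtain ⟨k, hk, hkb⟩ := c1
            have hkN : k ∈ N i := by
              by_contra hkN
              exact c2 k (Finset.mem_sdiff.2 ⟨hk, hkN⟩) hkb
            refine le_trans (le_of_eq ?_) (Finset.single_le_sum hnn hkN)
            rw [if_pos ⟨hkb, c2⟩]
        · rw [if_neg c2]
          refine add_nonneg ?_ hnn'
          split_ifs; exacts [hw x hx, le_rfl]
      have h3 : ∑ j ∈ N i, ∑ x ∈ Ω with Bad j x ∧ ∀ k ∈ S₂, ¬ Bad k x, w x ≤ 1 / 2 * g S₂ := by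
        calc _ ≤ ∑ j ∈ N i, 2 * p * g S₂ := Finset.sum_le_sum fun j _ => ih _ hlt S₂ rfl j
          _ = (4 * p * (N i).card) * (1 / 2 * g S₂) := by
            rw [Finset.sum_const, nsmul_eq_mul]; ring
          _ ≤ 1 * (1 / 2 * g S₂) :=
            mul_le_mul_of_nonneg_right (hN i) (by have := hg0 S₂; positivity)
          _ = _ := one_mul _
      have h4 : g S₂ ≤ 2 * g S := by linarith
      nlinarith
  have hpos : ∀ S : Finset ι, 0 < g S := by
    intro S
    induction S using Finset.induction_on with
    | empty => simpa [hg] using hΩ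
    | insert i S _ ih =>
      have h1 : g S = ∑ x ∈ Ω with Bad i x ∧ ∀ j ∈ S, ¬ Bad j x, w x + g (insert i S) := by
        simp only [hg, Finset.sum_filter]
        rw [← Finset.sum_add_distrib]
        refine Finset.sum_congr rfl fun x _ => ?_
        by_cases c1 : Bad i x <;> by_cases c2 : ∀ j ∈ S, ¬ Bad j x <;> simp [c1, c2]
      have h2 := key _ S rfl i
      nlinarith
  obtain ⟨x, hx, -⟩ := Finset.exists_ne_zero_of_sum_ne_zero (hpos Finset.univ).ne'
  rw [Finset.mem_filter] at hx
  exact ⟨x, hx.1, fun i => hx.2 i (Finset.mem_univ i)⟩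

end LocalLemma

/-! ### Independent transversals by counting. -/

section Transversal

variable {ι W : Type*} [Fintype ι] [DecidableEq ι]

-- As P ignores coordinate i, overwriting the fixed value c by any element of R i injects pairs (f,
-- x) into the functions satisfying P.
open Classical in
theorem card_fixed_coordinate_mul_le (R : ι → Finset W) (P : (ι → W) → Prop) (i : ι) {c : W}
    (hP : ∀ f x, P f → P (Function.update f i x)) :
    ((Fintype.piFinset R).filter fun f => P f ∧ f i = c).card * (R i).card ≤
      ((Fintype.piFinset R).filter P).card := by
  rw [← Finset.card_product]
  refine Finset.card_le_card_of_injOn (fun q => Function.update q.1 i q.2) ?_ ?_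
  · rintro ⟨f, x⟩ hq
    rw [Finset.mem_coe, Finset.mem_product, Finset.mem_filter, Fintype.mem_piFinset] at hq
    rw [Finset.mem_coe, Finset.mem_filter, Fintype.mem_piFinset]
    refine ⟨fun j => ?_, hP _ _ hq.1.2.1⟩
    by_cases h : j = i
    · subst h; simpa using hq.2
    · simpa [h] using hq.1.1 j
  · rintro ⟨f, x⟩ hq ⟨f', x'⟩ hq' h
    rw [Finset.mem_coe, Finset.mem_product, Finset.mem_filter, Fintype.mem_piFinset] at hq hq'
    dsimp only at h hq hq'
    have hx : x = x' := by simpa using congrFun h i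
    refine Prod.ext (funext fun j => ?_) hx
    by_cases hj : j = i
    · subst hj; exact hq.1.2.2.trans hq'.1.2.2.symm
    · simpa [hj] using congrFun h j

open Classical in
theorem card_fixed_two_coordinates_mul_le (R : ι → Finset W) (P : (ι → W) → Prop) {i j : ι}
    (hij : i ≠ j) {c d : W} (hPi : ∀ f x, P f → P (Function.update f i x))
    (hPj : ∀ f x, P f → P (Function.update f j x)) :
    ((Fintype.piFinset R).filter fun f => P f ∧ f i = c ∧ f j = d).card *
      ((R i).card * (R j).card) ≤ ((Fintype.piFinset R).filter P).card := by
  have h1 := card_fixed_coordinate_mul_le R (fun f => P f ∧ f i = c) j (c := d)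
    fun f x h => ⟨hPj f x h.1, by simpa [hij] using h.2⟩
  have h2 := card_fixed_coordinate_mul_le R P i (c := c) hPi
  calc _ = ((Fintype.piFinset R).filter fun f => (P f ∧ f i = c) ∧ f j = d).card * (R j).card *
        (R i).card := by simp only [and_assoc]; ring
    _ ≤ ((Fintype.piFinset R).filter fun f => P f ∧ f i = c).card * (R i).card :=
        Nat.mul_le_mul_right _ (by convert h1)
    _ ≤ _ := h2

open Classical in
/-- An independent transversal exists if each part has size at least `ℓ` and each vertex has at most
`ℓ / 4` neighbours in the other parts. -/
theorem exists_independent_transversal (H : SimpleGraph W) (R : ι → Finset W) {ℓ : ℝ}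
    (hℓ : 0 < ℓ) (hR : ∀ i, ℓ ≤ (R i).card)
    (hd : ∀ i, ∀ c ∈ R i,
      (((Finset.univ.erase i).sigma fun j => (R j).filter (H.Adj c)).card : ℝ) ≤ ℓ / 4) :
    ∃ f : ι → W, (∀ i, f i ∈ R i) ∧ ∀ i j, i ≠ j → ¬ H.Adj (f i) (f j) := by
  set P : Finset ι → (ι → W) → Prop := fun S f => ∀ i ∈ S, ∀ j ∈ S, i ≠ j → ¬ H.Adj (f i) (f j)
  set g : Finset ι → ℝ := fun S => ((Fintype.piFinset R).filter (P S)).card with hg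
  have hRpos : ∀ i, (0 : ℝ) < (R i).card := fun i => hℓ.trans_le (hR i)
  have hupd : ∀ S f i x, i ∉ S → P S f → P S (Function.update f i x) := by
    intro S f i x hi hf j hj k hk hjk
    rw [Function.update_of_ne (fun h : j = i => hi (h ▸ hj)),
      Function.update_of_ne (fun h : k = i => hi (h ▸ hk))]
    exact hf j hj k hk hjk
  -- Rosenfeld's counting argument: g S counts choices that are independent on S, and each further
  -- part keeps at least half of them.
  have key : ∀ n : ℕ, ∀ S : Finset ι, S.card = n → ∀ i, i ∉ S → 1 / 2 * g S ≤ g (insert i S) := by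
    intro n
    induction n using Nat.strong_induction_on with
    | _ n ih =>
    intro S hS i hi
    set Q := (R i).sigma fun c => (Finset.univ.erase i).sigma fun j => (R j).filter (H.Adj c)
    set Q' := Q.filter fun q => q.2.1 ∈ S
    have h1 : (Fintype.piFinset R).filter (P S) ⊆ (Fintype.piFinset R).filter (P (insert i S)) ∪
        Q'.biUnion fun q => (Fintype.piFinset R).filter
          fun f => P (S.erase q.2.1) f ∧ f i = q.1 ∧ f q.2.1 = q.2.2 := by
      intro f hf
      rw [Finset.mem_filter] at hf
      rw [Finset.mem_union]
      by_cases hc : P (insert i S) f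
      · exact Or.inl (Finset.mem_filter.2 ⟨hf.1, hc⟩)
      · right
        have hex : ∃ j ∈ S, H.Adj (f i) (f j) := by
          by_contra! hno
          refine hc fun j hj k hk hjk => ?_
          rw [Finset.mem_insert] at hj hk
          rcases hj with rfl | hj <;> rcases hk with rfl | hk
          · exact absurd rfl hjk
          · exact hno k hk
          · exact fun h => hno j hj h.symm
          · exact hf.2 j hj k hk hjk
        obtain ⟨j, hj, hadj⟩ := hex
        have hji : j ≠ i := fun h => hi (h ▸ hj)
        have hfR := Fintype.mem_piFinset.1 hf.1
        refine Finset.mem_biUnion.2 ⟨⟨f i, j, f j⟩, ?_, ?_⟩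
        · simp only [Q', Q, Finset.mem_filter, Finset.mem_sigma, Finset.mem_erase,
            Finset.mem_univ, and_true]
          exact ⟨⟨hfR i, hji, hfR j, hadj⟩, hj⟩
        · refine Finset.mem_filter.2 ⟨hf.1, ?_, rfl, rfl⟩
          exact fun a ha b hb => hf.2 a (Finset.mem_of_mem_erase ha) b (Finset.mem_of_mem_erase hb)
    -- For a conflict edge between c in R i and d in R j, fixing both coordinates leaves at most g(S
    -- \ {j})/(|R i||R j|) choices, and g(S \ {j}) ≤ 2·g S by induction. There are at most |R i|·ℓ/4
    -- such edges.
    have h2 : ∀ q ∈ Q', (((Fintype.piFinset R).filter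
          fun f => P (S.erase q.2.1) f ∧ f i = q.1 ∧ f q.2.1 = q.2.2).card : ℝ) ≤
        2 * g S / ((R i).card * ℓ) := by
      rintro ⟨c, j, d⟩ hq
      simp only [Q', Q, Finset.mem_filter, Finset.mem_sigma, Finset.mem_erase,
            Finset.mem_univ, and_true] at hq
      obtain ⟨⟨-, hji, -, -⟩, hj⟩ := hq
      have h3 : ((Fintype.piFinset R).filter
          fun f => P (S.erase j) f ∧ f i = c ∧ f j = d).card * ((R i).card * (R j).card) ≤
          ((Fintype.piFinset R).filter (P (S.erase j))).card := by
        convert card_fixed_two_coordinates_mul_le R (P (S.erase j)) (i := i) (j := j) hji.symm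
          (c := c) (d := d) (fun f x => hupd _ f i x fun h => hi (Finset.mem_of_mem_erase h))
          (fun f x => hupd _ f j x (Finset.notMem_erase _ _))
      have h3' : (((Fintype.piFinset R).filter
          fun f => P (S.erase j) f ∧ f i = c ∧ f j = d).card : ℝ) *
          ((R i).card * (R j).card) ≤ g (S.erase j) := by
        dsimp only [g]
        exact_mod_cast h3
      have h4 := ih _ (by rw [← hS]; exact Finset.card_erase_lt_of_mem hj) (S.erase j) rfl j
        (Finset.notMem_erase _ _)
      rw [Finset.insert_erase hj] at h4
      rw [le_div_iff₀ (mul_pos (hRpos i) hℓ)]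
      refine le_trans ?_ (h3'.trans (by linarith))
      have := hR j
      dsimp only
      gcongr
    have h5 : (Q'.card : ℝ) ≤ (R i).card * (ℓ / 4) := by
      calc (Q'.card : ℝ) ≤ Q.card := by exact_mod_cast Finset.card_filter_le _ _
        _ = ∑ c ∈ R i, (((Finset.univ.erase i).sigma fun j => (R j).filter (H.Adj c)).card : ℝ) := by
          simp only [Q, Finset.card_sigma]; push_cast; rfl
        _ ≤ ∑ c ∈ R i, ℓ / 4 := Finset.sum_le_sum fun c hc => hd i c hc
        _ = _ := by rw [Finset.sum_const, nsmul_eq_mul]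
    have h6 : g S ≤ g (insert i S) + ∑ q ∈ Q', (((Fintype.piFinset R).filter
          fun f => P (S.erase q.2.1) f ∧ f i = q.1 ∧ f q.2.1 = q.2.2).card : ℝ) := by
      have := (Finset.card_le_card h1).trans ((Finset.card_union_le _ _).trans
        (Nat.add_le_add_left Finset.card_biUnion_le _))
      dsimp only [g]
      exact_mod_cast this
    have h7 : ∑ q ∈ Q', (((Fintype.piFinset R).filter
          fun f => P (S.erase q.2.1) f ∧ f i = q.1 ∧ f q.2.1 = q.2.2).card : ℝ) ≤ 1 / 2 * g S := by
      have hgS : 0 ≤ g S := by positivity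
      calc _ ≤ ∑ q ∈ Q', 2 * g S / ((R i).card * ℓ) := Finset.sum_le_sum h2
        _ = Q'.card * (2 * g S / ((R i).card * ℓ)) := by rw [Finset.sum_const, nsmul_eq_mul]
        _ ≤ (R i).card * (ℓ / 4) * (2 * g S / ((R i).card * ℓ)) := by
          have := hRpos i
          gcongr
        _ = _ := by
          have := (hRpos i).ne'
          field_simp; ring
    linarith
  have hpos : ∀ S : Finset ι, 0 < g S := by
    intro S
    induction S using Finset.induction_on with
    | empty =>
      simp only [g, P, Finset.notMem_empty, false_imp_iff, imp_true_iff, Finset.filter_true,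
        Fintype.card_piFinset]
      push_cast
      exact Finset.prod_pos fun i _ => hRpos i
    | insert i S hi ih => linarith [key _ S rfl i hi]
  have h := hpos Finset.univ
  simp only [g, Nat.cast_pos, Finset.card_pos] at h
  obtain ⟨f, hf⟩ := h
  rw [Finset.mem_filter, Fintype.mem_piFinset] at hf
  exact ⟨f, hf.1, fun i j => hf.2 i (Finset.mem_univ _) j (Finset.mem_univ _)⟩

end Transversal

/-! ### Resampling and exponential moments. -/

section Resampling

variable {W : Type*} {H : SimpleGraph W} {A B : Finset W} {lam : ℝ}

open Classical in
/-- Resampling a hard-core independent set of `H[A]` inside `B`. -/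
theorem sum_resample_le (hl : 0 ≤ lam) (hB : B ⊆ A) {φ g : Finset W → ℝ} {θ : ℝ}
    (hφ0 : ∀ I, 0 ≤ φ I) (hφ : ∀ M K, K ⊆ B → φ (M ∪ K) = φ M)
    (hg : ∀ M, Disjoint M B → ∑ K ∈ indepOn H (uncov H B M), lam ^ K.card * g (M ∪ K) ≤
      θ * hcZ H (uncov H B M) lam) :
    ∑ I ∈ indepOn H A, lam ^ I.card * (φ I * g I) ≤
      θ * ∑ I ∈ indepOn H A, lam ^ I.card * φ I := by
  have hKB : ∀ M, ∀ K ∈ indepOn H (uncov H B M), K ⊆ B := fun M K hK =>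
    (mem_indepOn.1 hK).1.trans uncov_subset
  rw [sum_pow_indepOn_eq hB, sum_pow_indepOn_eq hB, Finset.mul_sum]
  refine Finset.sum_le_sum fun M hM => ?_
  have hMB : Disjoint M B := Finset.disjoint_left.2 fun x hx =>
    (Finset.mem_sdiff.1 ((mem_indepOn.1 hM).1 hx)).2
  have e1 : ∑ K ∈ indepOn H (uncov H B M), lam ^ K.card * (φ (M ∪ K) * g (M ∪ K)) =
      φ M * ∑ K ∈ indepOn H (uncov H B M), lam ^ K.card * g (M ∪ K) := by
    rw [Finset.mul_sum]
    refine Finset.sum_congr rfl fun K hK => ?_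
    rw [hφ M K (hKB M K hK)]; ring
  have e2 : ∑ K ∈ indepOn H (uncov H B M), lam ^ K.card * φ (M ∪ K) =
      φ M * hcZ H (uncov H B M) lam := by
    unfold hcZ
    rw [Finset.mul_sum]
    refine Finset.sum_congr rfl fun K hK => ?_
    rw [hφ M K (hKB M K hK)]; ring
  rw [e1, e2]
  have h1 : 0 ≤ lam ^ M.card := by positivity
  calc lam ^ M.card * (φ M * ∑ K ∈ indepOn H (uncov H B M), lam ^ K.card * g (M ∪ K))
      ≤ lam ^ M.card * (φ M * (θ * hcZ H (uncov H B M) lam)) :=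
        mul_le_mul_of_nonneg_left (mul_le_mul_of_nonneg_left (hg M hMB) (hφ0 M)) h1
    _ = _ := by ring

open Classical in
theorem union_inter_eq_right {M K : Finset W} (hM : Disjoint M B) (hK : K ⊆ B) :
    (M ∪ K) ∩ B = K := by
  rw [Finset.union_inter_distrib_right, Finset.disjoint_iff_inter_eq_empty.1 hM,
    Finset.empty_union, Finset.inter_eq_left.2 hK]

open Classical in
theorem union_inter_eq_of_disjoint {M K : Finset W} (hK : Disjoint K B) :
    (M ∪ K) ∩ B = M ∩ B := by
  rw [Finset.union_inter_distrib_right, Finset.disjoint_iff_inter_eq_empty.1 hK,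
    Finset.union_empty]

open Classical in
/-- An exponential version of the local occupancy inequality. -/
theorem sum_reward_le {t a : ℝ} (hl : 0 < lam) (h : (degSum H A : ℝ) ≤ 2 * t) (ha : 0 < 1 + a)
    (hρ : 0 ≤ 1 - (1 + lam) * ((1 + lam) ^ Real.sqrt (2 * t) * Real.exp (-a) / 2)) :
    ∑ K ∈ indepOn H A, lam ^ K.card * (if K = ∅ then 1 / 2 else
        (1 - (1 + lam) * ((1 + lam) ^ Real.sqrt (2 * t) * Real.exp (-a) / 2)) ^ K.card) ≤
      Real.exp (-((1 + a) * Real.exp (-a) / 2)) * hcZ H A lam := by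
  set D := (1 + lam) ^ Real.sqrt (2 * t)
  set κ := D * Real.exp (-a) / 2
  set ρ := 1 - (1 + lam) * κ
  set L := Real.log (1 + lam)
  set s := (1 + a) * Real.exp (-a) / 2
  set Z := hcZ H A lam
  have hD : 0 < D := Real.rpow_pos_of_pos (by linarith) _
  have hκ : 0 < κ := by positivity
  have hs : 0 < s := by positivity
  have hZ : 0 < Z := hcZ_pos hl.le
  have hL : 0 ≤ L := Real.log_nonneg (by linarith)
  have hLl : L ≤ lam := by
    have := Real.log_le_sub_one_of_pos (show 0 < 1 + lam by linarith); linarith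
  have hρ1 : ρ ≤ 1 := by simp only [ρ]; nlinarith [mul_pos (show 0 < 1 + lam by linarith) hκ]
  -- The weights ρ^|K| change the fugacity to ρ·lam; the empty set, with reward 1/2 instead of 1,
  -- accounts for the -1/2.
  have e1 : ∑ K ∈ indepOn H A, lam ^ K.card * (if K = ∅ then 1 / 2 else ρ ^ K.card) =
      hcZ H A (ρ * lam) - 1 / 2 := by
    have : ∀ K ∈ indepOn H A, lam ^ K.card * (if K = ∅ then 1 / 2 else ρ ^ K.card) =
        (ρ * lam) ^ K.card - if K = ∅ then 1 / 2 else 0 := fun K _ => by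
      split_ifs with hK
      · subst hK; norm_num
      · rw [mul_pow]; ring
    rw [Finset.sum_congr rfl this, Finset.sum_sub_distrib, Finset.sum_ite_eq',
      if_pos empty_mem_indepOn]
    rfl
  have h1 := hcZ_le_mul_exp h (mul_nonneg hρ hl.le) (mul_le_of_le_one_left hl.le hρ1)
  have h2 : κ * L ≤ L - Real.log (1 + ρ * lam) := by
    have e2 : 1 + ρ * lam = (1 + lam) * (1 - κ * lam) := by simp only [ρ]; ring
    have hp : 0 < (1 + lam) * (1 - κ * lam) := by
      rw [← e2]; have := mul_nonneg hρ hl.le; linarith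
    have hp' : 0 < 1 - κ * lam := (mul_pos_iff_of_pos_left (by linarith)).1 hp
    rw [e2, Real.log_mul (by linarith) hp'.ne']
    have := Real.log_le_sub_one_of_pos hp'
    have := mul_le_mul_of_nonneg_left hLl hκ.le
    simp only [L] at *
    linarith
  set y : ℝ := (A.card : ℝ)
  have hy : 0 ≤ y := Nat.cast_nonneg _
  set x := L * y / (1 + a)
  have hx : 0 ≤ x := by positivity
  have h3 : hcZ H A (ρ * lam) ≤ Z * Real.exp (-(s * x)) := by
    refine h1.trans (mul_le_mul_of_nonneg_left (Real.exp_le_exp.2 (neg_le_neg ?_)) hZ.le)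
    calc s * x = y / D * (κ * L) := by simp only [s, x, κ]; field_simp
      _ ≤ _ := by gcongr
  have h4 : 1 / 2 * (Z * Real.exp (-(L * y))) ≤ 1 / 2 := by
    have : Z ≤ Real.exp (L * y) := hcZ_le_exp hl.le
    rw [Real.exp_neg, ← div_eq_mul_inv]
    have := (div_le_one (Real.exp_pos (L * y))).2 this
    linarith
  -- With x = Ly/(1+a), the case x > 1 is immediate. Otherwise the excess over exp(-s) is at most
  -- s(1-x) = exp(-a)(1+a-Ly)/2 ≤ exp(-Ly)/2, which is exactly what the empty set saves in `h4`.
  have h5 : Real.exp (-(s * x)) ≤ Real.exp (-s) + 1 / 2 * Real.exp (-(L * y)) := by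
    rcases le_or_gt x 1 with hx1 | hx1
    · have h6 : Real.exp (-(s * x)) * (1 - s * (1 - x)) ≤ Real.exp (-s) := by
        have e : Real.exp (-s) = Real.exp (-(s * x)) * Real.exp (-(s * (1 - x))) := by
          rw [← Real.exp_add]; ring_nf
        rw [e]
        refine mul_le_mul_of_nonneg_left ?_ (Real.exp_pos _).le
        linarith [Real.add_one_le_exp (-(s * (1 - x)))]
      have h7 : s * (1 - x) ≤ 1 / 2 * Real.exp (-(L * y)) := by
        have e : Real.exp (-(L * y)) = Real.exp (-a) * Real.exp (a - L * y) := by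
          rw [← Real.exp_add]; ring_nf
        have e' : s * (1 - x) = 1 / 2 * (Real.exp (-a) * (a - L * y + 1)) := by
          simp only [s, x]; field_simp; ring
        rw [e, e']
        have := Real.add_one_le_exp (a - L * y)
        have := Real.exp_pos (-a)
        gcongr
      have h8 : Real.exp (-(s * x)) ≤ 1 := by
        rw [Real.exp_le_one_iff]; have := mul_nonneg hs.le hx; linarith
      have h9 : 0 ≤ s * (1 - x) := mul_nonneg hs.le (by linarith)
      nlinarith
    · have : Real.exp (-(s * x)) ≤ Real.exp (-s) := Real.exp_le_exp.2 (by nlinarith)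
      have := Real.exp_pos (-(L * y))
      linarith
  rw [e1]
  calc hcZ H A (ρ * lam) - 1 / 2 ≤ Z * Real.exp (-(s * x)) - 1 / 2 * (Z * Real.exp (-(L * y))) := by
        linarith
    _ ≤ Z * (Real.exp (-s) + 1 / 2 * Real.exp (-(L * y))) - 1 / 2 * (Z * Real.exp (-(L * y))) := by
        gcongr
    _ = _ := by ring

end Resampling

/-! ### Layers of a cover and completion of partial colourings. -/

section CoverFacts

variable {V : Type u} {W : Type v} {G : SimpleGraph V}

/-- The vertex of `G` that corresponds to the vertex `w` of the cover graph. -/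
noncomputable def Cover.owner (C : Cover G W) (w : W) : V := (C.exists_unique_mem w).choose

theorem Cover.mem_iff (C : Cover G W) {w : W} {x : V} : w ∈ C.L x ↔ C.owner w = x :=
  ⟨fun h => ((C.exists_unique_mem w).choose_spec.2 x h).symm,
    fun h => h ▸ (C.exists_unique_mem w).choose_spec.1⟩

theorem Cover.adj_of_owner_eq (C : Cover G W) {w w' : W} (h : C.owner w = C.owner w')
    (hne : w ≠ w') : C.H.Adj w w' :=
  C.complete _ w (C.mem_iff.2 rfl) w' (C.mem_iff.2 h.symm) hne

theorem Cover.adj_owner (C : Cover G W) {w w' : W} (h : C.H.Adj w w')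
    (hne : C.owner w ≠ C.owner w') : G.Adj (C.owner w) (C.owner w') :=
  (C.adj_of_adj _ _ w (C.mem_iff.2 rfl) w' (C.mem_iff.2 rfl) h).resolve_left hne

theorem Cover.eq_of_adj (C : Cover G W) {c x y : W} (hx : C.H.Adj c x) (hy : C.H.Adj c y)
    (hne : C.owner c ≠ C.owner x) (h : C.owner x = C.owner y) : x = y :=
  C.matching _ _ (C.adj_owner hx hne) c (C.mem_iff.2 rfl) x (C.mem_iff.2 rfl) y
    (C.mem_iff.2 h.symm) hx hy

variable [Fintype V]

/-- The vertices of the cover graph that belong to the lists `L`. -/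
noncomputable def listUnion (L : V → Finset W) : Finset W := by
  classical exact Finset.univ.biUnion L

theorem mem_listUnion {L : V → Finset W} {x : W} : x ∈ listUnion L ↔ ∃ v, x ∈ L v := by
  classical
  simp [listUnion]

open Classical in
/-- The neighbours of `c` in the other lists. -/
noncomputable def Cover.layer (C : Cover G W) (L : V → Finset W) (c : W) : Finset W :=
  (listUnion L).filter fun x => C.H.Adj c x ∧ C.owner c ≠ C.owner x

variable {C : Cover G W} {L : V → Finset W}

theorem Cover.mem_layer {c x : W} :
    x ∈ C.layer L c ↔ x ∈ listUnion L ∧ C.H.Adj c x ∧ C.owner c ≠ C.owner x := by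
  classical
  simp [Cover.layer]

theorem Cover.layer_subset {c : W} : C.layer L c ⊆ listUnion L := fun _ hx =>
  (Cover.mem_layer.1 hx).1

theorem Cover.injOn_owner_layer (c : W) : Set.InjOn C.owner (C.layer L c : Set W) := by
  intro x hx y hy h
  rw [Finset.mem_coe, Cover.mem_layer] at hx hy
  exact C.eq_of_adj hx.2.1 hy.2.1 hx.2.2 h

theorem Cover.disjoint_layer {c c' : W} (h : C.owner c = C.owner c') (hne : c ≠ c') :
    Disjoint (C.layer L c) (C.layer L c') := by
  refine Finset.disjoint_left.2 fun x hx hx' => hne ?_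
  rw [Cover.mem_layer] at hx hx'
  exact C.eq_of_adj hx.2.1.symm hx'.2.1.symm hx.2.2.symm h

-- A layer has at most one vertex over each vertex of G, and adjacent vertices of the layer lie over
-- adjacent vertices. Layers thereby inherit the sparsity of neighbourhoods in G.
open Classical in
theorem Cover.degSum_le_image {c : W} {F : Finset W} (hF : F ⊆ C.layer L c) :
    degSum C.H F ≤ degSum G (F.image C.owner) := by
  have hinj : Set.InjOn C.owner (F : Set W) :=
    (Cover.injOn_owner_layer c).mono (Finset.coe_subset.2 hF)
  unfold degSum
  rw [Finset.sum_image hinj]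
  refine Finset.sum_le_sum fun x hx => ?_
  refine Finset.card_le_card_of_injOn C.owner (fun y hy => ?_)
    (hinj.mono fun y hy => (Finset.mem_filter.1 hy).1)
  rw [Finset.mem_coe, Finset.mem_filter] at hy
  rw [Finset.mem_coe, Finset.mem_filter]
  refine ⟨Finset.mem_image_of_mem _ hy.1, C.adj_owner hy.2 fun h => ?_⟩
  exact C.H.ne_of_adj hy.2 (hinj hx hy.1 h)

theorem Cover.degSum_layer_le [DecidableRel G.Adj] {t : ℝ} (ht : TrianglesAtMost G t) {c : W}
    {F : Finset W} (hF : F ⊆ C.layer L c) : (degSum C.H F : ℝ) ≤ 2 * t := by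
  classical
  refine le_trans (Nat.cast_le.2 (Cover.degSum_le_image hF)) ?_
  refine degSum_le_of_trianglesAtMost ht (C.owner c) fun x hx => ?_
  obtain ⟨y, hy, rfl⟩ := Finset.mem_image.1 hx
  have := Cover.mem_layer.1 (hF hy)
  rw [SimpleGraph.mem_neighborFinset]
  exact C.adj_owner this.2.1 this.2.2

-- The layers of distinct colours of u are disjoint by the matching condition, and I meets each list
-- at most once because lists are cliques. Hence each neighbour of u is counted at most once.
open Classical in
theorem Cover.sum_card_inter_layer_le [DecidableRel G.Adj] {u : V} {S I : Finset W}
    (hS : ∀ c ∈ S, C.owner c = u) (hI : ∀ x ∈ I, ∀ y ∈ I, ¬ C.H.Adj x y) :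
    ∑ c ∈ S, (I ∩ C.layer L c).card ≤ G.degree u := by
  rw [← Finset.card_biUnion, ← G.card_neighborFinset_eq_degree]
  · refine Finset.card_le_card_of_injOn C.owner ?_ ?_
    · intro x hx
      obtain ⟨c, hc, hx⟩ := Finset.mem_biUnion.1 (Finset.mem_coe.1 hx)
      have := Cover.mem_layer.1 (Finset.mem_inter.1 hx).2
      rw [Finset.mem_coe, SimpleGraph.mem_neighborFinset, ← hS c hc]
      exact C.adj_owner this.2.1 this.2.2
    · intro x hx y hy h
      obtain ⟨c, hc, hx⟩ := Finset.mem_biUnion.1 (Finset.mem_coe.1 hx)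
      obtain ⟨c', hc', hy⟩ := Finset.mem_biUnion.1 (Finset.mem_coe.1 hy)
      by_contra hne
      exact hI x (Finset.mem_inter.1 hx).1 y (Finset.mem_inter.1 hy).1 (C.adj_of_owner_eq h hne)
  · intro c hc c' hc' hne
    exact (Cover.disjoint_layer ((hS c hc).trans (hS c' hc').symm) hne).mono
      Finset.inter_subset_right Finset.inter_subset_right

open Classical in
/-- The vertices of `L u` that have no neighbour in the part of `I` outside `L u`. -/
noncomputable def Cover.residual (C : Cover G W) (L : V → Finset W) (I : Finset W) (u : V) :
    Finset W :=
  (L u).filter fun c => I ∩ C.layer L c = ∅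

open Classical in
/-- The random independent set `I` is flawed at `u` if the residual list of `u` is short or contains
a vertex with many potential conflicts. -/
def Cover.Flawed (C : Cover G W) (L : V → Finset W) (ℓ : ℝ) (u : V) (I : Finset W) : Prop :=
  ((C.residual L I u).card : ℝ) < ℓ ∨
    ∃ c ∈ L u, I ∩ C.layer L c = ∅ ∧ ℓ / 4 < (uncov C.H (C.layer L c) I).card

open Classical in
/-- An independent set without flaws extends to a colouring. -/
theorem Cover.colourable_of_not_flawed (hL : ∀ u, L u ⊆ C.L u) {ℓ : ℝ} (hℓ : 0 < ℓ)
    {I : Finset W} (hI : I ∈ indepOn C.H (listUnion L)) (hgood : ∀ u, ¬ C.Flawed L ℓ u I) :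
    C.Colourable := by
  rw [mem_indepOn] at hI
  obtain ⟨hIU, hI⟩ := hI
  have hown : ∀ {u c}, c ∈ L u → C.owner c = u := fun hc => C.mem_iff.1 (hL _ hc)
  -- The vertices left uncoloured by I; they take their colours from an independent transversal of
  -- the residual lists.
  let ι := {u : V // ∀ x ∈ I, C.owner x ≠ u}
  have hRmem : ∀ {u : V} {c : W}, c ∈ C.residual L I u → c ∈ L u ∧ I ∩ C.layer L c = ∅ :=
    fun hc => Finset.mem_filter.1 hc
  have hRI : ∀ {u : V}, (∀ x ∈ I, C.owner x ≠ u) → ∀ {c : W}, c ∈ C.residual L I u →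
      ∀ y ∈ I, ¬ C.H.Adj c y := fun {u} hu {c} hc y hy hadj => by
    obtain ⟨hc1, hc2⟩ := hRmem hc
    have : y ∈ I ∩ C.layer L c := by
      refine Finset.mem_inter.2 ⟨hy, Cover.mem_layer.2 ⟨hIU hy, hadj, ?_⟩⟩
      rw [hown hc1]
      exact (hu y hy).symm
    rw [hc2] at this
    exact absurd this (Finset.notMem_empty _)
  obtain ⟨f, hf, hfadj⟩ := exists_independent_transversal C.H
    (fun i : ι => C.residual L I i.1) hℓ
    (fun i => not_lt.1 fun h => hgood i.1 (Or.inl h)) (by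
      rintro ⟨u, hu⟩ c hc
      obtain ⟨hc1, hc2⟩ := hRmem hc
      refine le_trans ?_ (not_lt.1 fun h => hgood u (Or.inr ⟨c, hc1, hc2, h⟩))
      refine Nat.cast_le.2 (Finset.card_le_card_of_injOn (fun q => q.2) ?_ ?_)
      -- A residual colour x of an uncoloured vertex v has no neighbour in I, not even in its own
      -- list, so every conflict of c lies in the uncovered part of the layer of c.
      · rintro ⟨⟨v, hv⟩, x⟩ hq
        simp only [Finset.coe_sigma, Set.mem_sigma_iff, Finset.mem_coe, Finset.mem_erase,
          Finset.mem_filter, Finset.mem_univ, and_true, ne_eq] at hq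
        obtain ⟨hvu, hx, hadj⟩ := hq
        obtain ⟨hx1, hx2⟩ := hRmem hx
        refine Finset.mem_coe.2 (mem_uncov.2 ⟨Cover.mem_layer.2
          ⟨mem_listUnion.2 ⟨v, hx1⟩, hadj, ?_⟩, hRI hv hx⟩)
        rw [hown hc1, hown hx1]
        exact fun h => hvu (Subtype.ext h.symm)
      · rintro ⟨⟨v, hv⟩, x⟩ hq ⟨⟨v', hv'⟩, x'⟩ hq' h
        simp only [Finset.coe_sigma, Set.mem_sigma_iff, Finset.mem_coe, Finset.mem_erase,
          Finset.mem_filter] at hq hq'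
        dsimp only at h
        subst h
        have : v = v' := (hown (hRmem hq.2.1).1).symm.trans (hown (hRmem hq'.2.1).1)
        subst this
        rfl)
  have hex : ∀ u : V, ∃ x : W, C.owner x = u ∧
      (x ∈ I ∨ ∃ hu : ∀ x ∈ I, C.owner x ≠ u, x = f ⟨u, hu⟩) := fun u => by
    by_cases hu : ∀ x ∈ I, C.owner x ≠ u
    · exact ⟨f ⟨u, hu⟩, hown (hRmem (hf ⟨u, hu⟩)).1, Or.inr ⟨hu, rfl⟩⟩
    · push Not at hu
      obtain ⟨x, hx, hxu⟩ := hu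
      exact ⟨x, hxu, Or.inl hx⟩
  choose h hown' hcase using hex
  refine ⟨Finset.univ.image h, ?_, ?_⟩
  · intro x hx y hy hxy hadj
    simp only [Finset.coe_image, Finset.coe_univ, Set.image_univ, Set.mem_range] at hx hy
    obtain ⟨a, rfl⟩ := hx
    obtain ⟨b, rfl⟩ := hy
    have hab : a ≠ b := fun h => hxy (h ▸ rfl)
    rcases hcase a with ha | ⟨ha, ha'⟩ <;> rcases hcase b with hb | ⟨hb, hb'⟩
    · exact hI _ ha _ hb hadj
    · rw [hb'] at hadj
      exact hRI hb (hf ⟨b, hb⟩) _ ha hadj.symm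
    · rw [ha'] at hadj
      exact hRI ha (hf ⟨a, ha⟩) _ hb hadj
    · rw [ha', hb'] at hadj
      exact hfadj ⟨a, ha⟩ ⟨b, hb⟩ (fun h => hab (congrArg Subtype.val h)) hadj
  · rw [Finset.card_image_of_injective, Finset.card_univ]
    intro a b hab
    rw [← hown' a, ← hown' b, hab]

end CoverFacts

/-! ### Balls in G. -/

section ClosedNeighbourhoods

variable {V : Type u} [Fintype V]

open Classical in
/-- The union of the closed neighbourhoods of the vertices of `S`. -/
noncomputable def closedNbhd (G : SimpleGraph V) (S : Finset V) : Finset V :=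
  S.biUnion fun u => insert u (Finset.univ.filter (G.Adj u))

variable {G : SimpleGraph V}

theorem mem_closedNbhd {S : Finset V} {v : V} :
    v ∈ closedNbhd G S ↔ ∃ u ∈ S, v = u ∨ G.Adj u v := by
  classical
  simp [closedNbhd]

theorem card_closedNbhd_le [DecidableRel G.Adj] {Δ : ℕ} (hΔ : ∀ u, G.degree u ≤ Δ)
    (S : Finset V) : (closedNbhd G S).card ≤ S.card * (Δ + 1) := by
  classical
  refine Finset.card_biUnion_le_card_mul _ _ _ fun u _ => (Finset.card_insert_le _ _).trans ?_
  refine Nat.add_le_add_right ((le_of_eq ?_).trans (hΔ u)) 1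
  rw [← G.card_neighborFinset_eq_degree]
  congr 1
  ext v
  simp

end ClosedNeighbourhoods

/-! ### Locality and probability of flaws. -/

section FlawProbability

variable {V : Type u} {W : Type v} [Fintype V] {G : SimpleGraph V} {C : Cover G W}
  {L : V → Finset W} {lam : ℝ}

/-- Layers of colours of v lie over neighbours of v, and whether a layer vertex is uncovered is
decided one step further away. So a flaw depends on I only within distance 2. -/
theorem Cover.flawed_congr (hL : ∀ u, L u ⊆ C.L u) {ℓ : ℝ} {v : V} {I I' : Finset W}
    (h : ∀ x, C.owner x ∈ closedNbhd G (closedNbhd G {v}) → (x ∈ I ↔ x ∈ I')) :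
    C.Flawed L ℓ v I ↔ C.Flawed L ℓ v I' := by
  classical
  have hadj : ∀ {c}, c ∈ L v → ∀ {x}, x ∈ C.layer L c → C.owner x ∈ closedNbhd G {v} :=
    fun {c} hc {x} hx => by
      have := Cover.mem_layer.1 hx
      refine mem_closedNbhd.2 ⟨v, Finset.mem_singleton_self v, Or.inr ?_⟩
      rw [← C.mem_iff.1 (hL v hc)]
      exact C.adj_owner this.2.1 this.2.2
  have h1 : ∀ c ∈ L v, I ∩ C.layer L c = I' ∩ C.layer L c := fun c hc => by
    ext x
    simp only [Finset.mem_inter]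
    refine and_congr_left fun hx => h x ?_
    exact mem_closedNbhd.2 ⟨_, hadj hc hx, Or.inl rfl⟩
  have h2 : ∀ c ∈ L v, uncov C.H (C.layer L c) I = uncov C.H (C.layer L c) I' := fun c hc => by
    ext x
    simp only [mem_uncov]
    refine and_congr_right fun hx => ?_
    have : ∀ y, C.H.Adj x y → (y ∈ I ↔ y ∈ I') := fun y hy => h y <| by
      refine mem_closedNbhd.2 ⟨_, hadj hc hx, ?_⟩
      by_cases he : C.owner x = C.owner y
      · exact Or.inl he.symm
      · exact Or.inr (C.adj_owner hy he)
    exact ⟨fun h' y hy hxy => h' y ((this y hxy).2 hy) hxy,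
      fun h' y hy hxy => h' y ((this y hxy).1 hy) hxy⟩
  have h3 : C.residual L I v = C.residual L I' v :=
    Finset.filter_congr fun c hc => by rw [h1 c hc]
  unfold Cover.Flawed
  rw [h3]
  refine or_congr_right (exists_congr fun c => and_congr_right fun hc => ?_)
  rw [h1 c hc, h2 c hc]

/-- Resampling a layer of u alters the set only over neighbours of u, which are beyond distance 2 of
v when v is beyond distance 3 of u. -/
theorem Cover.flawed_union_iff (hL : ∀ u, L u ⊆ C.L u) {ℓ : ℝ} {u v : V} [DecidableEq W]
    (huv : v ∉ closedNbhd G (closedNbhd G (closedNbhd G {u}))) {c : W} (hc : c ∈ L u)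
    {M K : Finset W} (hK : K ⊆ C.layer L c) :
    C.Flawed L ℓ v (M ∪ K) ↔ C.Flawed L ℓ v M := by
  refine Cover.flawed_congr hL fun x hx => ?_
  rw [Finset.mem_union, or_iff_left_iff_imp]
  intro hxK
  exfalso
  have hsymm : ∀ {a b : V}, (a = b ∨ G.Adj b a) → (b = a ∨ G.Adj a b) := fun h =>
    h.imp Eq.symm fun h => h.symm
  obtain ⟨w, hw, hwx⟩ := mem_closedNbhd.1 hx
  obtain ⟨v', hv', hvw⟩ := mem_closedNbhd.1 hw
  rw [Finset.mem_singleton] at hv'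
  subst hv'
  have := Cover.mem_layer.1 (hK hxK)
  refine huv (mem_closedNbhd.2 ⟨w, mem_closedNbhd.2 ⟨C.owner x, mem_closedNbhd.2
    ⟨u, Finset.mem_singleton_self u, Or.inr ?_⟩, hsymm hwx⟩, hsymm hvw⟩)
  rw [← C.mem_iff.1 (hL u hc)]
  exact C.adj_owner this.2.1 this.2.2

open Classical in
/-- The exponential moment of the rewards of a family of layers. -/
theorem Cover.sum_prod_reward_le (hl : 0 ≤ lam) {u : V} (hL : ∀ u, L u ⊆ C.L u)
    {φ r : Finset W → ℝ} (hφ0 : ∀ I, 0 ≤ φ I) (hr0 : ∀ I, 0 ≤ r I)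
    (hφ : ∀ c ∈ L u, ∀ M K, K ⊆ C.layer L c → φ (M ∪ K) = φ M) {θ : ℝ} (hθ : 0 ≤ θ)
    (hr : ∀ c ∈ L u, ∀ F ⊆ C.layer L c,
      ∑ K ∈ indepOn C.H F, lam ^ K.card * r K ≤ θ * hcZ C.H F lam)
    {S : Finset W} (hS : S ⊆ L u) :
    ∑ I ∈ indepOn C.H (listUnion L), lam ^ I.card * (φ I * ∏ c ∈ S, r (I ∩ C.layer L c)) ≤
      θ ^ S.card * ∑ I ∈ indepOn C.H (listUnion L), lam ^ I.card * φ I := by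
  induction S using Finset.induction_on with
  | empty => simp
  | insert c S hc ih =>
    have hcu : c ∈ L u := hS (Finset.mem_insert_self _ _)
    have hS' : S ⊆ L u := (Finset.subset_insert _ _).trans hS
    rw [Finset.card_insert_of_notMem hc, pow_succ', mul_assoc]
    refine le_trans ?_ (mul_le_mul_of_nonneg_left (ih hS') hθ)
    -- Resample the layer of c alone: the other layers are disjoint from it, so their rewards belong
    -- to the unaffected factor.
    have := sum_resample_le (H := C.H) (A := listUnion L) (B := C.layer L c) hl Cover.layer_subset
      (φ := fun I => φ I * ∏ c ∈ S, r (I ∩ C.layer L c)) (g := fun I => r (I ∩ C.layer L c))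
      (θ := θ) (fun I => mul_nonneg (hφ0 I) (Finset.prod_nonneg fun _ _ => hr0 _)) ?_ ?_
    · refine le_trans (le_of_eq (Finset.sum_congr rfl fun I _ => ?_)) this
      rw [Finset.prod_insert hc]
      ring
    · intro M K hK
      rw [hφ c hcu M K hK]
      congr 1
      refine Finset.prod_congr rfl fun d hd => ?_
      rw [union_inter_eq_of_disjoint]
      refine Finset.disjoint_of_subset_left hK (Cover.disjoint_layer ?_ fun h => hc (h ▸ hd))
      rw [C.mem_iff.1 (hL u hcu), C.mem_iff.1 (hL u (hS' hd))]
    · intro M hM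
      refine le_trans (le_of_eq (Finset.sum_congr rfl fun K hK => ?_))
        (hr c hcu _ uncov_subset)
      rw [union_inter_eq_right hM ((mem_indepOn.1 hK).1.trans uncov_subset)]

-- Markov's inequality for the product of rewards over L u. Fewer than ℓ layers missed by I, and
-- total intersection at most deg u, force the product to be at least ρ^(deg u)/2^ℓ, whereas its
-- mean is at most exp(-s|L u|) with s = (1+a)exp(-a)/2.
open Classical in
theorem Cover.sum_short_le [DecidableRel G.Adj] {t : ℝ} (ht : TrianglesAtMost G t) (hl : 0 < lam)
    {u : V} (hL : ∀ u, L u ⊆ C.L u) {φ : Finset W → ℝ} (hφ0 : ∀ I, 0 ≤ φ I)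
    (hφ : ∀ c ∈ L u, ∀ M K, K ⊆ C.layer L c → φ (M ∪ K) = φ M) {ℓ a ρ : ℝ} (ha : 0 < 1 + a)
    (hρ : 0 < ρ)
    (hρe : ρ = 1 - (1 + lam) * ((1 + lam) ^ Real.sqrt (2 * t) * Real.exp (-a) / 2)) :
    ∑ I ∈ indepOn C.H (listUnion L),
        lam ^ I.card * (φ I * if ((C.residual L I u).card : ℝ) < ℓ then 1 else 0) ≤
      (2 ^ ℓ / ρ ^ G.degree u * Real.exp (-((1 + a) * Real.exp (-a) / 2)) ^ (L u).card) *
        ∑ I ∈ indepOn C.H (listUnion L), lam ^ I.card * φ I := by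
  have hρ1 : ρ ≤ 1 := by
    have : 0 ≤ (1 + lam) * ((1 + lam) ^ Real.sqrt (2 * t) * Real.exp (-a) / 2) := by positivity
    linarith
  have h := Cover.sum_prod_reward_le (C := C) (L := L) hl.le (u := u) hL hφ0
    (r := fun K => if K = ∅ then 1 / 2 else ρ ^ K.card)
    (fun K => by split_ifs; exacts [by norm_num, by positivity]) hφ
    (Real.exp_pos (-((1 + a) * Real.exp (-a) / 2))).le (fun c _ F hF => by
      subst hρe
      exact sum_reward_le hl (Cover.degSum_layer_le ht hF) ha hρ.le) subset_rfl
  rw [mul_assoc]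
  refine le_trans ?_ (mul_le_mul_of_nonneg_left h (by positivity))
  rw [Finset.mul_sum]
  refine Finset.sum_le_sum fun I hI => ?_
  set X := ∏ c ∈ L u, if I ∩ C.layer L c = ∅ then (1 / 2 : ℝ) else
    ρ ^ (I ∩ C.layer L c).card
  have hX0 : 0 ≤ X := Finset.prod_nonneg fun c _ => by
    split_ifs; exacts [by norm_num, by positivity]
  have hlI : 0 ≤ lam ^ I.card * φ I := mul_nonneg (by positivity) (hφ0 I)
  split_ifs with hshort
  · have h1 : (1 / 2 : ℝ) ^ (C.residual L I u).card * ρ ^ G.degree u ≤ X := by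
      have e : ∀ c ∈ L u, (if I ∩ C.layer L c = ∅ then (1 / 2 : ℝ) else
          ρ ^ (I ∩ C.layer L c).card) =
          (if I ∩ C.layer L c = ∅ then (1 / 2 : ℝ) else 1) * ρ ^ (I ∩ C.layer L c).card :=
        fun c _ => by
          split_ifs with hc
          · simp [hc]
          · simp
      simp only [X]
      rw [Finset.prod_congr rfl e, Finset.prod_mul_distrib, Finset.prod_pow_eq_pow_sum,
        ← Finset.prod_filter, Finset.prod_const]
      refine mul_le_mul_of_nonneg_left ?_ (by positivity)
      exact pow_le_pow_of_le_one hρ.le hρ1 (Cover.sum_card_inter_layer_le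
        (fun c hc => C.mem_iff.1 (hL u hc)) (mem_indepOn.1 hI).2)
    have h2 : (1 : ℝ) ≤ 2 ^ ℓ * (1 / 2 : ℝ) ^ (C.residual L I u).card := by
      rw [one_div, inv_pow, ← div_eq_mul_inv, one_le_div (by positivity), ← Real.rpow_natCast]
      exact Real.rpow_le_rpow_of_exponent_le (by norm_num) hshort.le
    have h3 : 1 ≤ 2 ^ ℓ / ρ ^ G.degree u * X := by
      calc (1 : ℝ) ≤ 2 ^ ℓ * (1 / 2 : ℝ) ^ (C.residual L I u).card := h2
        _ = 2 ^ ℓ / ρ ^ G.degree u *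
            ((1 / 2 : ℝ) ^ (C.residual L I u).card * ρ ^ G.degree u) := by
            field_simp
        _ ≤ _ := by gcongr
    calc lam ^ I.card * (φ I * 1) = (lam ^ I.card * φ I) * 1 := by ring
      _ ≤ (lam ^ I.card * φ I) * (2 ^ ℓ / ρ ^ G.degree u * X) := by gcongr
      _ = _ := by ring
  · rw [mul_zero, mul_zero]
    have : 0 ≤ lam ^ I.card * (φ I * X) := by rw [← mul_assoc]; positivity
    have h2 : (0 : ℝ) ≤ 2 ^ ℓ / ρ ^ G.degree u := by positivity
    exact mul_nonneg h2 this

-- Given the set outside the layer, the layer is missed with probability 1/Z(F), F being its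
-- uncovered part. For |F| > ℓ/4 sparsity makes Z(F) exponentially large.
open Classical in
theorem Cover.sum_conflict_le [DecidableRel G.Adj] {t : ℝ} (ht : TrianglesAtMost G t)
    (hl : 0 < lam) {φ : Finset W → ℝ} (hφ0 : ∀ I, 0 ≤ φ I) {c : W}
    (hφ : ∀ M K, K ⊆ C.layer L c → φ (M ∪ K) = φ M) {ℓ : ℝ} :
    ∑ I ∈ indepOn C.H (listUnion L), lam ^ I.card * (φ I *
        if I ∩ C.layer L c = ∅ ∧ ℓ / 4 < (uncov C.H (C.layer L c) I).card then 1 else 0) ≤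
      Real.exp (-(ℓ / 4 / (1 + lam) ^ Real.sqrt (2 * t) * Real.log (1 + lam))) *
        ∑ I ∈ indepOn C.H (listUnion L), lam ^ I.card * φ I := by
  refine sum_resample_le hl.le Cover.layer_subset hφ0 hφ fun M hM => ?_
  set B := C.layer L c
  set F := uncov C.H B M
  have h1 : ∑ K ∈ indepOn C.H F, lam ^ K.card *
      (if (M ∪ K) ∩ B = ∅ ∧ ℓ / 4 < (uncov C.H B (M ∪ K)).card then (1 : ℝ) else 0) =
      if ℓ / 4 < F.card then 1 else 0 := by
    rw [Finset.sum_eq_single ∅]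
    · simp [Finset.disjoint_iff_inter_eq_empty.1 hM, F]
    · intro K hK hK0
      rw [union_inter_eq_right hM ((mem_indepOn.1 hK).1.trans uncov_subset), if_neg, mul_zero]
      exact fun h => hK0 h.1
    · exact fun h => absurd empty_mem_indepOn h
  rw [h1]
  split_ifs with h
  · rw [Real.exp_neg, ← div_eq_inv_mul, one_le_div (Real.exp_pos _)]
    refine le_trans (Real.exp_le_exp.2 ?_)
      (exp_le_hcZ (Cover.degSum_layer_le ht uncov_subset) hl.le)
    have : 0 ≤ Real.log (1 + lam) := Real.log_nonneg (by linarith)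
    gcongr
  · exact mul_nonneg (Real.exp_pos _).le (hcZ_pos hl.le).le

/-- Colouring from a cover via the Lovász Local Lemma. -/
theorem Cover.colourable_of_bounds [DecidableRel G.Adj] {t : ℝ} (ht : TrianglesAtMost G t)
    (hl : 0 < lam) (hL : ∀ u, L u ⊆ C.L u) {Δ : ℕ} (hΔ : ∀ u, G.degree u ≤ Δ) {ℓ p : ℝ}
    (hℓ : 0 < ℓ) (hp : 0 ≤ p) (hpΔ : 4 * p * ((Δ : ℝ) + 1) ^ 3 ≤ 1)
    (hshort : ∀ u, ∃ a ρ : ℝ, 0 < 1 + a ∧ 0 < ρ ∧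
      ρ = 1 - (1 + lam) * ((1 + lam) ^ Real.sqrt (2 * t) * Real.exp (-a) / 2) ∧
      2 ^ ℓ / ρ ^ G.degree u * Real.exp (-((1 + a) * Real.exp (-a) / 2)) ^ (L u).card ≤ p / 2)
    (hconf : ∀ u, (L u).card *
      Real.exp (-(ℓ / 4 / (1 + lam) ^ Real.sqrt (2 * t) * Real.log (1 + lam))) ≤ p / 2) :
    C.Colourable := by
  classical
  set Ω := indepOn C.H (listUnion L)
  suffices h : ∃ I ∈ Ω, ∀ u, ¬ C.Flawed L ℓ u I by
    obtain ⟨I, hI, hgood⟩ := h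
    exact Cover.colourable_of_not_flawed hL hℓ hI hgood
  -- The excluded events are those in the ball of radius 3 around u, which has at most (Δ+1)³
  -- vertices.
  refine lovasz_local_lemma Ω (fun I => lam ^ I.card)
    (fun I _ => by positivity) (hcZ_pos hl.le) (fun u I => C.Flawed L ℓ u I)
    (fun u => closedNbhd G (closedNbhd G (closedNbhd G {u}))) hp ?_ ?_ ?_
  · have : (1 : ℝ) ≤ ((Δ : ℝ) + 1) ^ 3 := one_le_pow₀ (by linarith [(Nat.cast_nonneg Δ : (0:ℝ) ≤ Δ)])
    nlinarith
  · intro u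
    have h1 : (closedNbhd G (closedNbhd G (closedNbhd G {u}))).card ≤ (Δ + 1) ^ 3 := by
      refine (card_closedNbhd_le hΔ _).trans ?_
      calc _ ≤ ((({u} : Finset V).card * (Δ + 1)) * (Δ + 1)) * (Δ + 1) := by
            refine Nat.mul_le_mul_right _ ((card_closedNbhd_le hΔ _).trans ?_)
            exact Nat.mul_le_mul_right _ (card_closedNbhd_le hΔ _)
        _ = _ := by rw [Finset.card_singleton]; ring
    have h2 : ((closedNbhd G (closedNbhd G (closedNbhd G {u}))).card : ℝ) ≤ ((Δ : ℝ) + 1) ^ 3 := by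
      exact_mod_cast h1
    exact (mul_le_mul_of_nonneg_left h2 (by positivity)).trans hpΔ
  · intro u S hS
    -- Conditioning on no flaw in S becomes a weight that resampling any layer of u leaves
    -- unchanged, so both flaw bounds hold conditionally.
    set φ : Finset W → ℝ := fun I => if ∀ j ∈ S, ¬ C.Flawed L ℓ j I then 1 else 0
    have hφ0 : ∀ I, 0 ≤ φ I := fun I => by simp only [φ]; split_ifs <;> norm_num
    have hφ : ∀ c ∈ L u, ∀ M K, K ⊆ C.layer L c → φ (M ∪ K) = φ M := fun c hc M K hK => by
      have : (∀ j ∈ S, ¬ C.Flawed L ℓ j (M ∪ K)) ↔ ∀ j ∈ S, ¬ C.Flawed L ℓ j M :=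
        forall₂_congr fun j hj => not_congr
          (Cover.flawed_union_iff hL (Finset.disjoint_left.1 hS hj) hc hK)
      simp only [φ, this]
    obtain ⟨a, ρ, ha, hρ, hρe, hab⟩ := hshort u
    have e1 : ∑ I ∈ Ω with ∀ j ∈ S, ¬ C.Flawed L ℓ j I, lam ^ I.card =
        ∑ I ∈ Ω, lam ^ I.card * φ I := by
      rw [Finset.sum_filter]
      exact Finset.sum_congr rfl fun I _ => by simp [φ]
    set Z := ∑ I ∈ Ω, lam ^ I.card * φ I
    have hZ : 0 ≤ Z := Finset.sum_nonneg fun I _ => mul_nonneg (by positivity) (hφ0 I)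
    have h1 := Cover.sum_short_le (ℓ := ℓ) ht hl hL hφ0 hφ ha hρ hρe
    have h2 : ∀ c ∈ L u, _ := fun c hc =>
      Cover.sum_conflict_le (ℓ := ℓ) ht hl hφ0 (c := c) (L := L) (hφ c hc)
    rw [e1]
    have h3 : ∑ I ∈ Ω with C.Flawed L ℓ u I ∧ ∀ j ∈ S, ¬ C.Flawed L ℓ j I, lam ^ I.card ≤
        ∑ I ∈ Ω, lam ^ I.card * (φ I * if ((C.residual L I u).card : ℝ) < ℓ then 1 else 0) +
        ∑ c ∈ L u, ∑ I ∈ Ω, lam ^ I.card * (φ I *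
          if I ∩ C.layer L c = ∅ ∧ ℓ / 4 < (uncov C.H (C.layer L c) I).card then 1 else 0) := by
      rw [Finset.sum_comm, ← Finset.sum_add_distrib, Finset.sum_filter]
      refine Finset.sum_le_sum fun I _ => ?_
      have hlI : 0 ≤ lam ^ I.card := by positivity
      have hn1 : 0 ≤ lam ^ I.card * (φ I * if ((C.residual L I u).card : ℝ) < ℓ then 1 else 0) :=
        mul_nonneg hlI (mul_nonneg (hφ0 I) (by split_ifs <;> norm_num))
      have hn2 : ∀ c ∈ L u, 0 ≤ lam ^ I.card * (φ I *
          if I ∩ C.layer L c = ∅ ∧ ℓ / 4 < (uncov C.H (C.layer L c) I).card then 1 else 0) :=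
        fun c _ => mul_nonneg hlI (mul_nonneg (hφ0 I) (by split_ifs <;> norm_num))
      by_cases hbad : C.Flawed L ℓ u I ∧ ∀ j ∈ S, ¬ C.Flawed L ℓ j I
      · rw [if_pos hbad]
        have hφ1 : φ I = 1 := if_pos hbad.2
        rcases hbad.1 with hb | ⟨c, hc, hb⟩
        · rw [if_pos hb, hφ1, mul_one, mul_one]
          exact le_add_of_nonneg_right (by rw [hφ1] at hn2; exact Finset.sum_nonneg hn2)
        · refine le_add_of_nonneg_of_le hn1 (le_trans ?_ (Finset.single_le_sum hn2 hc))
          rw [if_pos hb, hφ1, mul_one, mul_one]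
      · rw [if_neg hbad]
        exact add_nonneg hn1 (Finset.sum_nonneg hn2)
    refine h3.trans ?_
    have h4 := Finset.sum_le_sum h2
    rw [Finset.sum_const, nsmul_eq_mul, ← mul_assoc] at h4
    have h5 := mul_le_mul_of_nonneg_right hab hZ
    have h6 := mul_le_mul_of_nonneg_right (hconf u) hZ
    linarith

end FlawProbability

/-! ### Parameters for the Local Lemma. -/

section Parameters

/-- The probability bound for short residual lists. -/
theorem exists_short_list_params {ε τ lam K N D : ℝ} {d k : ℕ} (hε : 0 < ε) (hε1 : ε ≤ 1)
    (hlam : 0 < lam) (hlam1 : lam ≤ ε / 20) (hK1 : 1 ≤ K) (hK2 : K ≤ 1 + ε / 20) (hτ : 0 < τ)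
    (hD0 : 0 < D) (hN : 6 * N ≤ 9 * τ)
    (hq : 20 / ε * Real.log (160000 / ε ^ 2) ≤ Real.log (D / τ)) (hd : (d : ℝ) ≤ D)
    (hk : (1 + ε) * (D / Real.log (D / τ)) ≤ k) :
    ∃ a ρ : ℝ, 0 < 1 + a ∧ 0 < ρ ∧ ρ = 1 - (1 + lam) * (K * Real.exp (-a) / 2) ∧
      2 ^ (3840 * τ / ε) / ρ ^ d * Real.exp (-((1 + a) * Real.exp (-a) / 2)) ^ k ≤
        Real.exp (-(6 * N)) := by
  -- Chosen so that (ε/40)·Qτ = 4000τ/ε exceeds 9τ + 3840τ/ε, the cost of the factor exp(-6N) and of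
  -- 2^ℓ.
  obtain ⟨Q, hQe⟩ : ∃ Q, Q = 160000 / ε ^ 2 := ⟨_, rfl⟩
  rw [← hQe] at hq
  have hεε : ε ^ 2 ≤ ε := by nlinarith
  have hQ : 160000 / ε ≤ Q := by
    rw [hQe]
    gcongr
  have hQ' : 160000 ≤ 160000 / ε := by rw [le_div_iff₀ hε]; nlinarith
  have hlogQ : 1 ≤ Real.log Q := by
    rw [Real.le_log_iff_exp_le (by linarith)]
    linarith [Real.exp_one_lt_d9]
  set q := Real.log (D / τ) with hqe
  obtain ⟨ℓ, hℓe⟩ : ∃ ℓ, ℓ = 3840 * τ / ε := ⟨_, rfl⟩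
  rw [← hℓe]
  have hq' : Real.log Q ≤ ε / 20 * q := by
    rw [div_mul_eq_mul_div, div_le_iff₀ hε] at hq
    linarith
  have hq0 : 0 < q := lt_of_lt_of_le (by positivity) hq
  have hQ0 : 0 < Q := by linarith
  -- Then exp(-a) = τQ/D: small enough to keep ρ near 1, yet a is still almost log(D/τ).
  obtain ⟨a, hae⟩ : ∃ a, a = Real.log (D / τ / Q) := ⟨_, rfl⟩
  have ha : (1 - ε / 20) * q ≤ a := by
    rw [hae, Real.log_div (by positivity) (by positivity)]
    linarith
  clear_value q
  have haQ : Real.log Q ≤ a := by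
    have := mul_le_mul_of_nonneg_right (show ε / 20 ≤ 1 - ε / 20 by linarith) hq0.le
    linarith
  obtain ⟨E, hEe⟩ : ∃ E, E = Real.exp (-a) := ⟨_, rfl⟩
  have hE : E = τ * Q / D := by
    rw [hEe, hae, Real.exp_neg, Real.exp_log (by positivity)]
    field_simp
  have hE0 : 0 < E := hEe ▸ Real.exp_pos _
  have hE1 : E ≤ ε / 20 := by
    calc E ≤ Real.exp (-Real.log Q) := hEe ▸ Real.exp_le_exp.2 (by linarith)
      _ = Q⁻¹ := by rw [Real.exp_neg, Real.exp_log hQ0]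
      _ ≤ (160000 / ε)⁻¹ := inv_anti₀ (by positivity) hQ
      _ ≤ ε / 20 := by rw [inv_div]; linarith
  obtain ⟨ρ, hρe⟩ : ∃ ρ, ρ = 1 - (1 + lam) * (K * E / 2) := ⟨_, rfl⟩
  have hKE : (1 + lam) * K ≤ 1 + ε / 8 := by
    calc (1 + lam) * K ≤ (1 + ε / 20) * (1 + ε / 20) := by gcongr
      _ = 1 + ε / 10 + ε ^ 2 / 400 := by ring
      _ ≤ _ := by linarith
  have hρ1 : 1 - ρ ≤ (1 + ε / 8) * (E / 2) := by
    calc 1 - ρ = (1 + lam) * K * (E / 2) := by rw [hρe]; ring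
      _ ≤ _ := by gcongr
  have hρ : 1 - ε / 20 ≤ ρ := by
    have : (1 + ε / 8) * (E / 2) ≤ (1 + 1 / 8) * (ε / 20 / 2) := by gcongr
    linarith
  have hρ0 : 0 < ρ := by linarith
  refine ⟨a, ρ, by linarith, hρ0, hEe ▸ hρe, ?_⟩
  rw [← hEe]
  have hlogρ : -Real.log ρ ≤ (1 + ε / 8) * (E / 2) / (1 - ε / 20) := by
    have h1 := Real.one_sub_inv_le_log_of_pos hρ0
    have h2 : -Real.log ρ ≤ (1 - ρ) / ρ := by
      have : (1 - ρ) / ρ = ρ⁻¹ - 1 := by field_simp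
      linarith
    refine h2.trans ?_
    have : 0 < 1 - ε / 20 := by linarith
    gcongr
  have hfrac : (1 + ε / 8) / (1 - ε / 20) ≤ 1 + ε / 4 := by
    rw [div_le_iff₀ (by linarith)]
    have : (1 + ε / 4) * (1 - ε / 20) = 1 + ε / 5 - ε ^ 2 / 80 := by ring
    linarith
  have hA : d * (-Real.log ρ) ≤ E / 2 * ((1 + ε / 4) * D) := by
    calc d * (-Real.log ρ) ≤ D * ((1 + ε / 8) * (E / 2) / (1 - ε / 20)) := by
          have : 0 < 1 - ε / 20 := by linarith
          refine (mul_le_mul_of_nonneg_left hlogρ (Nat.cast_nonneg d)).trans ?_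
          gcongr
      _ = E / 2 * ((1 + ε / 8) / (1 - ε / 20) * D) := by ring
      _ ≤ _ := by gcongr
  have hB : 6 * N + Real.log 2 * ℓ ≤ E / 2 * (ε / 20 * D) := by
    have h2 : Real.log 2 * ℓ ≤ 3840 * τ / ε := by
      rw [hℓe]
      exact mul_le_of_le_one_left (by positivity) (by linarith [Real.log_two_lt_d9])
    have h3 : 9 * τ ≤ 9 * τ / ε := by rw [le_div_iff₀ hε]; nlinarith
    have h4 : E / 2 * (ε / 20 * D) = 4000 * τ / ε := by
      rw [hE, hQe]; field_simp; norm_num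
    rw [h4]
    calc _ ≤ 9 * τ / ε + 3840 * τ / ε := by linarith
      _ = 3849 * τ / ε := by ring
      _ ≤ _ := by gcongr; norm_num
  have hC : (1 + ε / 2) * D ≤ (1 + a) * k := by
    calc (1 + ε / 2) * D ≤ ((1 - ε / 20) * (1 + ε)) * D := by
          have : (1 - ε / 20) * (1 + ε) = 1 + 19 / 20 * ε - ε ^ 2 / 20 := by ring
          gcongr
          linarith
      _ = ((1 - ε / 20) * q) * ((1 + ε) * (D / q)) := by field_simp
      _ ≤ (1 + a) * k := by
          have : 0 ≤ 1 + a := by linarith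
          gcongr
          linarith
  -- In units of D·E/2, the factor ρ^(-d) costs 1 + ε/4 and the remaining losses cost ε/20, while
  -- the k rewards gain at least 1 + ε/2.
  have hmain : Real.log 2 * ℓ - d * Real.log ρ + k * (-((1 + a) * E / 2)) ≤
      -(6 * N) := by
    have h1 : E / 2 * ((1 + ε / 4) * D) + E / 2 * (ε / 20 * D) ≤ E / 2 * ((1 + a) * k) := by
      rw [← mul_add]
      refine mul_le_mul_of_nonneg_left (le_trans ?_ hC) (by positivity)
      rw [← add_mul]
      exact mul_le_mul_of_nonneg_right (by linarith) hD0.le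
    linarith
  have e1 : 2 ^ ℓ / ρ ^ d * Real.exp (-((1 + a) * E / 2)) ^ k =
      Real.exp (Real.log 2 * ℓ - d * Real.log ρ + k * (-((1 + a) * E / 2))) := by
    rw [Real.exp_add, Real.exp_sub, ← Real.rpow_def_of_pos (by norm_num), Real.exp_nat_mul,
      Real.exp_nat_mul, Real.exp_log hρ0]
  rw [e1]
  exact Real.exp_le_exp.2 hmain

/-- The choice of the parameters in the Lovász Local Lemma. -/
theorem exists_cover_params {ε : ℝ} (hε : 0 < ε) (hε1 : ε ≤ 1) :
    ∃ δ₀ : ℝ, Real.exp 1 ≤ δ₀ ∧ ∀ Δ : ℕ, 20 ≤ Δ → ∀ t : ℝ, 1 / 2 ≤ t →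
      ∃ lam ℓ p : ℝ, 0 < lam ∧ 0 < ℓ ∧ 0 ≤ p ∧ 4 * p * ((Δ : ℝ) + 1) ^ 3 ≤ 1 ∧
      (∀ k : ℕ, k ≤ 5 * Δ → (k : ℝ) *
        Real.exp (-(ℓ / 4 / (1 + lam) ^ Real.sqrt (2 * t) * Real.log (1 + lam))) ≤ p / 2) ∧
      ∀ (D : ℝ) (d k : ℕ), δ₀ * (Real.sqrt t * Real.log Δ) ≤ D → (d : ℝ) ≤ D →
        (1 + ε) * (D / Real.log (D / (Real.sqrt t * Real.log Δ))) ≤ k →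
        ∃ a ρ : ℝ, 0 < 1 + a ∧ 0 < ρ ∧
          ρ = 1 - (1 + lam) * ((1 + lam) ^ Real.sqrt (2 * t) * Real.exp (-a) / 2) ∧
          2 ^ ℓ / ρ ^ d * Real.exp (-((1 + a) * Real.exp (-a) / 2)) ^ k ≤ p / 2 := by
  set Q := 160000 / ε ^ 2
  have hQ : 160000 / ε ≤ Q := by
    rw [div_le_div_iff₀ hε (by positivity)]; nlinarith
  have hQ' : 160000 ≤ 160000 / ε := by rw [le_div_iff₀ hε]; nlinarith
  have hlogQ : 1 ≤ Real.log Q := by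
    rw [Real.le_log_iff_exp_le (by linarith)]
    linarith [Real.exp_one_lt_d9]
  refine ⟨Real.exp (20 / ε * Real.log Q), ?_, fun Δ hΔ t ht => ?_⟩
  · refine Real.exp_le_exp.2 ?_
    have : 1 ≤ 20 / ε := by rw [le_div_iff₀ hε]; linarith
    nlinarith
  have hΔ' : (20 : ℝ) ≤ Δ := by exact_mod_cast hΔ
  set st := Real.sqrt t
  have hst : 0 < st := Real.sqrt_pos.2 (by linarith)
  have hst7 : 7 / 10 ≤ st := Real.le_sqrt_of_sq_le (by norm_num; linarith)
  have hs2 : Real.sqrt (2 * t) ≤ 3 / 2 * st := by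
    refine Real.sqrt_le_iff.2 ⟨by positivity, ?_⟩
    rw [mul_pow, Real.sq_sqrt (by linarith)]
    linarith
  have hlogΔ : 0 < Real.log Δ := Real.log_pos (by linarith)
  set τ := st * Real.log Δ
  have hτ : 0 < τ := mul_pos hst hlogΔ
  set lam := ε / 40 / st
  have hlam : 0 < lam := by positivity
  have hlam1 : lam ≤ ε / 20 := by
    rw [div_le_iff₀ hst]; nlinarith
  set K := (1 + lam) ^ Real.sqrt (2 * t)
  set L := Real.log (1 + lam)
  have hL2 : lam / (1 + lam) ≤ L := by
    have := Real.one_sub_inv_le_log_of_pos (show 0 < 1 + lam by linarith)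
    refine le_trans (le_of_eq ?_) this
    field_simp; ring
  have hL1 : L ≤ lam := by have := Real.log_le_sub_one_of_pos (show 0 < 1 + lam by linarith); linarith
  have hL3 : lam / 2 ≤ L :=
    (div_le_div_of_nonneg_left hlam.le (by linarith) (by linarith)).trans hL2
  have hK1 : 1 ≤ K := Real.one_le_rpow (by linarith) (Real.sqrt_nonneg _)
  have hK2 : K ≤ 1 + ε / 20 := by
    have h1 : K ≤ Real.exp (3 / 80 * ε) := by
      rw [show K = _ from Real.rpow_def_of_pos (by linarith) _]
      refine Real.exp_le_exp.2 ?_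
      calc L * Real.sqrt (2 * t) ≤ lam * (3 / 2 * st) := by gcongr
        _ = 3 / 80 * ε := by simp only [lam]; field_simp; norm_num
    refine h1.trans ?_
    have h2 := Real.exp_bound_div_one_sub_of_interval (x := 3 / 80 * ε) (by positivity) (by linarith)
    refine h2.trans ?_
    rw [div_le_iff₀ (by linarith)]
    nlinarith
  -- Gives (ℓ/4)/2·(lam/2) = 6 log Δ, so a conflict has probability at most Δ^(-6), enough for a
  -- union bound over 5Δ colours.
  set ℓ := 96 * τ / (ε / 40)
  have hℓ : 0 < ℓ := by positivity
  set p : ℝ := 1 / (4 * ((Δ : ℝ) + 1) ^ 3)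
  have hp : 0 < p := by positivity
  have hΔ6 : Real.exp (6 * Real.log Δ) = (Δ : ℝ) ^ 6 := by
    rw [show (6 : ℝ) = ((6 : ℕ) : ℝ) by norm_num, Real.exp_nat_mul, Real.exp_log (by linarith)]
  have hpow : ((Δ : ℝ) + 1) ^ 3 ≤ (2 * (Δ : ℝ)) ^ 3 :=
    pow_le_pow_left₀ (by linarith) (by linarith) 3
  have hΔ2 : (400 : ℝ) ≤ (Δ : ℝ) ^ 2 := by nlinarith
  have hΔ3 : (64 : ℝ) ≤ (Δ : ℝ) ^ 3 := by nlinarith [pow_pos (show (0:ℝ) < Δ by linarith) 2]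
  refine ⟨lam, ℓ, p, hlam, hℓ, hp.le, ?_, ?_, ?_⟩
  · refine le_of_eq ?_
    simp only [p]; field_simp
  · intro k hk
    have hk' : (k : ℝ) ≤ 5 * Δ := by exact_mod_cast hk
    have h1 : 6 * Real.log Δ ≤ ℓ / 4 / K * L := by
      calc 6 * Real.log Δ = ℓ / 4 / 2 * (lam / 2) := by
            simp only [ℓ, lam, τ]; field_simp; norm_num
        _ ≤ ℓ / 4 / K * L := by gcongr; linarith
    calc (k : ℝ) * Real.exp (-(ℓ / 4 / K * L)) ≤ 5 * Δ * Real.exp (-(6 * Real.log Δ)) := by gcongr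
      _ = 5 * Δ / (Δ : ℝ) ^ 6 := by rw [Real.exp_neg, hΔ6, div_eq_mul_inv]
      _ ≤ p / 2 := by
        simp only [p]
        rw [div_div, div_le_div_iff₀ (by positivity) (by positivity), one_mul]
        calc 5 * (Δ : ℝ) * (4 * ((Δ : ℝ) + 1) ^ 3 * 2)
            ≤ 5 * (Δ : ℝ) * (4 * (2 * (Δ : ℝ)) ^ 3 * 2) := by gcongr
          _ = 320 * (Δ : ℝ) ^ 4 := by ring
          _ ≤ (Δ : ℝ) ^ 2 * (Δ : ℝ) ^ 4 := by gcongr; linarith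
          _ = (Δ : ℝ) ^ 6 := by ring
  · intro D d k hD hd hk
    have hD0 : 0 < D := lt_of_lt_of_le (by positivity) hD
    have hq : 20 / ε * Real.log Q ≤ Real.log (D / τ) := by
      rw [Real.le_log_iff_exp_le (by positivity), le_div_iff₀ hτ]
      exact hD
    have hN : 6 * Real.log Δ ≤ 9 * τ := by
      simp only [τ]; nlinarith
    obtain ⟨a, ρ, ha, hρ, hρe, hb⟩ :=
      exists_short_list_params hε hε1 hlam hlam1 hK1 hK2 hτ hD0 hN hq hd hk
    refine ⟨a, ρ, ha, hρ, hρe, ?_⟩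
    have e : ℓ = 3840 * τ / ε := by simp only [ℓ]; field_simp; norm_num
    rw [e]
    refine hb.trans ?_
    rw [Real.exp_neg, hΔ6]
    simp only [p]
    rw [div_div, one_div]
    refine inv_anti₀ (by positivity) ?_
    calc 4 * ((Δ : ℝ) + 1) ^ 3 * 2 ≤ 4 * (2 * (Δ : ℝ)) ^ 3 * 2 := by gcongr
      _ = 64 * (Δ : ℝ) ^ 3 := by ring
      _ ≤ (Δ : ℝ) ^ 3 * (Δ : ℝ) ^ 3 := by gcongr
      _ = (Δ : ℝ) ^ 6 := by ring

end Parameters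

/-! ### Greedy colouring when lists exceed degrees. -/

section Greedy

variable {V : Type u} [Fintype V] {W : Type v} {G : SimpleGraph V}

/-- Greedy colouring from a cover. -/
theorem Cover.colourable_of_degree_lt [DecidableRel G.Adj] (C : Cover G W)
    (h : ∀ u, G.degree u < (C.L u).card) : C.Colourable := by
  classical
  have hne : ∀ u, (C.L u).Nonempty := fun u =>
    Finset.card_pos.1 ((Nat.zero_le _).trans_lt (h u))
  have key : ∀ S : Finset V, ∃ f : V → W, (∀ u, C.owner (f u) = u) ∧
      ∀ u ∈ S, ∀ v ∈ S, ¬ C.H.Adj (f u) (f v) := by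
    intro S
    induction S using Finset.induction_on with
    | empty =>
      choose f hf using hne
      exact ⟨f, fun u => C.mem_iff.1 (hf u), by simp⟩
    | insert u S hu ih =>
      obtain ⟨f, hf, hfS⟩ := ih
      -- By the matching condition each coloured neighbour of u forbids at most one colour of L u.
      have hforb : ((C.L u).filter fun c => ∃ v ∈ S, C.H.Adj c (f v)).card ≤ G.degree u := by
        have hch : ∀ c, ∃ v, (∃ v ∈ S, C.H.Adj c (f v)) → v ∈ S ∧ C.H.Adj c (f v) := fun c => by
          by_cases hc : ∃ v ∈ S, C.H.Adj c (f v)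
          · obtain ⟨v, hv⟩ := hc
            exact ⟨v, fun _ => hv⟩
          · exact ⟨u, fun h => absurd h hc⟩
        choose g hg using hch
        rw [← G.card_neighborFinset_eq_degree]
        refine Finset.card_le_card_of_injOn g ?_ ?_
        · intro c hc
          rw [Finset.mem_coe, Finset.mem_filter] at hc
          obtain ⟨h1, h2⟩ := hg c hc.2
          have hcu := C.mem_iff.1 hc.1
          rw [Finset.mem_coe, SimpleGraph.mem_neighborFinset]
          have := C.adj_owner h2 (by rw [hcu, hf]; exact fun h => hu (h ▸ h1))
          rwa [hcu, hf] at this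
        · intro c hc c' hc' hcc
          rw [Finset.mem_coe, Finset.mem_filter] at hc hc'
          obtain ⟨h1, h2⟩ := hg c hc.2
          obtain ⟨h1', h2'⟩ := hg c' hc'.2
          rw [← hcc] at h2'
          have hcu := C.mem_iff.1 hc.1
          have hcu' := C.mem_iff.1 hc'.1
          refine C.eq_of_adj h2.symm h2'.symm ?_ (hcu.trans hcu'.symm)
          rw [hcu, hf]
          exact fun h => hu (h ▸ h1)
      obtain ⟨c, hc, hcS⟩ : ∃ c ∈ C.L u, ¬ ∃ v ∈ S, C.H.Adj c (f v) := by
        by_contra! hall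
        rw [Finset.filter_true_of_mem hall] at hforb
        exact absurd (h u) (not_lt.2 hforb)
      push Not at hcS
      have hupd : ∀ v ∈ S, Function.update f u c v = f v := fun v hv =>
        Function.update_of_ne (fun h : v = u => hu (h ▸ hv)) _ _
      refine ⟨Function.update f u c, fun v => ?_, fun v hv w hw => ?_⟩
      · by_cases hv : v = u
        · subst hv; simpa using C.mem_iff.1 hc
        · simpa [hv] using hf v
      · rw [Finset.mem_insert] at hv hw
        rcases hv with rfl | hv <;> rcases hw with rfl | hw
        · exact C.H.loopless.irrefl _
        · rw [hupd w hw, Function.update_self]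
          exact hcS w hw
        · rw [hupd v hv, Function.update_self]
          exact fun h => hcS v hv h.symm
        · rw [hupd v hv, hupd w hw]
          exact hfS v hv w hw
  obtain ⟨f, hf, hfS⟩ := key Finset.univ
  refine ⟨Finset.univ.image f, ?_, ?_⟩
  · intro x hx y hy _
    simp only [Finset.coe_image, Finset.coe_univ, Set.image_univ, Set.mem_range] at hx hy
    obtain ⟨a, rfl⟩ := hx
    obtain ⟨b, rfl⟩ := hy
    exact hfS a (Finset.mem_univ _) b (Finset.mem_univ _)
  · rw [Finset.card_image_of_injective, Finset.card_univ]
    intro a b hab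
    rw [← hf a, ← hf b, hab]

end Greedy

/-! ### Correspondence colouring. -/

section Correspondence

theorem cover_colourable {ε : ℝ} (hε : 0 < ε) (hε1 : ε ≤ 1) :
    ∃ δ₀ : ℝ, Real.exp 1 ≤ δ₀ ∧ ∀ Δ : ℕ, 20 ≤ Δ →
      ∀ (V : Type u) [Fintype V] (G : SimpleGraph V) [DecidableRel G.Adj] (t : ℝ),
        (∀ u, G.degree u ≤ Δ) → 1 / 2 ≤ t → TrianglesAtMost G t →
        ∀ (W : Type v) (C : Cover G W),
          (∀ x : V, (1 + ε) *
            (max (G.degree x : ℝ) (δ₀ * (Real.sqrt t * Real.log (Δ : ℝ))) /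
              Real.log (max (G.degree x : ℝ) (δ₀ * (Real.sqrt t * Real.log (Δ : ℝ))) /
                (Real.sqrt t * Real.log (Δ : ℝ)))) ≤ ((C.L x).card : ℝ)) →
          C.Colourable := by
  obtain ⟨δ₀, hδ, hpar⟩ := exists_cover_params hε hε1
  refine ⟨δ₀, hδ, fun Δ hΔ V _ G _ t hdeg ht htri W C hC => ?_⟩
  obtain ⟨lam, ℓ, p, hlam, hℓ, hp, hpΔ, hconf, hshort⟩ := hpar Δ hΔ t ht
  have hΔ' : (20 : ℝ) ≤ Δ := by exact_mod_cast hΔ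
  set τ := Real.sqrt t * Real.log (Δ : ℝ)
  have hτ : 0 < τ := mul_pos (Real.sqrt_pos.2 (by linarith)) (Real.log_pos (by linarith))
  have hδ1 : 1 < δ₀ := lt_of_lt_of_le (by linarith [Real.exp_one_gt_d9]) hδ
  set D : V → ℝ := fun x => max (G.degree x : ℝ) (δ₀ * τ)
  have hdegΔ : ∀ x, (G.degree x : ℝ) ≤ Δ := fun x => Nat.cast_le.2 (hdeg x)
  have hδτ : δ₀ * τ / Real.log (δ₀ * τ / τ) = δ₀ * τ / Real.log δ₀ := by
    rw [mul_div_cancel_right₀ _ hτ.ne']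
  -- If the minimum list size exceeds 2Δ, greedy colouring suffices. Otherwise the required sizes
  -- are O(Δ), as the union bound over a list demands.
  rcases le_or_gt (δ₀ * τ / Real.log δ₀) (2 * Δ) with hcase | hcase
  · have hbound : ∀ x, D x / Real.log (D x / τ) ≤ 2 * Δ := fun x => by
      rcases le_total (G.degree x : ℝ) (δ₀ * τ) with h | h
      · simp only [D]
        rw [max_eq_right h, hδτ]
        exact hcase
      · simp only [D]
        rw [max_eq_left h]
        have h1 : Real.exp 1 ≤ (G.degree x : ℝ) / τ := by
          rw [le_div_iff₀ hτ]
          exact (mul_le_mul_of_nonneg_right hδ hτ.le).trans h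
        have h2 : 1 ≤ Real.log ((G.degree x : ℝ) / τ) := by
          rwa [Real.le_log_iff_exp_le (lt_of_lt_of_le (Real.exp_pos 1) h1)]
        have h3 := div_le_self (Nat.cast_nonneg (G.degree x) : (0 : ℝ) ≤ _) h2
        linarith [hdegΔ x]
    -- Longer lists are cut down to the required size, at most 4Δ rounded up, hence at most 5Δ.
    have hsub : ∀ x, ∃ S ⊆ C.L x, S.card = ⌈(1 + ε) * (D x / Real.log (D x / τ))⌉₊ := fun x =>
      Finset.exists_subset_card_eq (Nat.ceil_le.2 (hC x))
    choose L hL hLcard using hsub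
    refine Cover.colourable_of_bounds htri hlam hL hdeg hℓ hp hpΔ (fun u => ?_) fun u => ?_
    · refine hshort (D u) (G.degree u) (L u).card (le_max_right _ _) (le_max_left _ _) ?_
      rw [hLcard]
      exact Nat.le_ceil _
    · refine hconf _ ?_
      rw [hLcard, Nat.ceil_le]
      push_cast
      have := hbound u
      nlinarith
  · refine C.colourable_of_degree_lt fun x => ?_
    have h1 : δ₀ * τ / Real.log δ₀ ≤ D x / Real.log (D x / τ) := by
      rw [← hδτ]
      exact div_log_mono hτ (mul_le_mul_of_nonneg_right hδ hτ.le) (le_max_right _ _)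
    have h2 : (G.degree x : ℝ) < (C.L x).card := by
      have := hC x
      have := hdegΔ x
      have h3 : D x / Real.log (D x / τ) ≤ (1 + ε) * (D x / Real.log (D x / τ)) :=
        le_mul_of_one_le_left (by linarith) (by linarith)
      simp only [D] at *
      linarith
    exact_mod_cast h2

theorem local_correspondence_colouring {ε : ℝ} (hε : 0 < ε) :
    ∃ δ₀ : ℝ, 1 < δ₀ ∧ ∃ Δ₀ : ℕ, ∀ Δ : ℕ, Δ₀ ≤ Δ →
      ∀ (V : Type u) [Fintype V] (G : SimpleGraph V) [DecidableRel G.Adj] (t : ℝ),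
        G.maxDegree = Δ → 1 / 2 ≤ t → TrianglesAtMost G t →
        ∀ (W : Type v) (C : Cover G W),
          (∀ x : V, (1 + ε) *
            max ((G.degree x : ℝ) /
                Real.log ((G.degree x : ℝ) / (Real.sqrt t * Real.log (Δ : ℝ))))
              (δ₀ / Real.log δ₀ * (Real.sqrt t * Real.log (Δ : ℝ))) ≤ ((C.L x).card : ℝ)) →
          C.Colourable := by
  obtain ⟨δ₀, hδ, h⟩ := cover_colourable (lt_min hε one_pos) (min_le_right ε 1)
  have hδ1 : 1 < δ₀ := lt_of_lt_of_le (by linarith [Real.exp_one_gt_d9]) hδ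
  refine ⟨δ₀, hδ1, 20, fun Δ hΔ V _ G _ t hmax ht htri W C hC => ?_⟩
  have hΔ' : (20 : ℝ) ≤ Δ := by exact_mod_cast hΔ
  refine h Δ hΔ V G t (fun u => hmax ▸ G.degree_le_maxDegree u) ht htri W C fun x => ?_
  refine le_trans ?_ (hC x)
  set τ := Real.sqrt t * Real.log (Δ : ℝ)
  have hτ : 0 < τ := mul_pos (Real.sqrt_pos.2 (by linarith)) (Real.log_pos (by linarith))
  refine (mul_le_mul_of_nonneg_left (max_div_log_le hτ)
    (by have := lt_min hε one_pos; linarith)).trans ?_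
  have h3 : 0 ≤ max ((G.degree x : ℝ) / Real.log ((G.degree x : ℝ) / τ))
      (δ₀ / Real.log δ₀ * τ) := by
    refine le_trans ?_ (le_max_right _ _)
    have := Real.log_pos hδ1
    positivity
  gcongr
  exact min_le_left _ _

/-- The number of colours used is ⌊X⌋; the +1 in the hypothesis on X pays for this rounding. Since
the truncated degrees are at least δ₀τ, monotonicity of x/log(x/τ) allows Δ in place of each of
them. -/
theorem corrChromaticNumber_le {ε : ℝ} (hε : 0 < ε) (hε1 : ε ≤ 1) :
    ∃ δ₀ : ℝ, 1 < δ₀ ∧ ∀ Δ : ℕ, 20 ≤ Δ →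
      ∀ (V : Type u) [Fintype V] (G : SimpleGraph V) [DecidableRel G.Adj] (t X : ℝ),
        G.maxDegree = Δ → 1 / 2 ≤ t → TrianglesAtMost G t →
        Real.log δ₀ ≤ Real.log ((Δ : ℝ) / (Real.sqrt t * Real.log (Δ : ℝ))) →
        (1 + ε) * ((Δ : ℝ) / Real.log ((Δ : ℝ) / (Real.sqrt t * Real.log (Δ : ℝ)))) + 1 ≤ X →
        (corrChromaticNumber G : ℝ) ≤ X := by
  obtain ⟨δ₀, hδ, h⟩ := cover_colourable.{u, 0} hε hε1
  have hδ1 : 1 < δ₀ := lt_of_lt_of_le (by linarith [Real.exp_one_gt_d9]) hδ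
  refine ⟨δ₀, hδ1, fun Δ hΔ V _ G _ t X hmax ht htri hlog hX => ?_⟩
  have hΔ' : (20 : ℝ) ≤ Δ := by exact_mod_cast hΔ
  set τ := Real.sqrt t * Real.log (Δ : ℝ)
  have hτ : 0 < τ := mul_pos (Real.sqrt_pos.2 (by linarith)) (Real.log_pos (by linarith))
  have hδτ : δ₀ * τ ≤ Δ := by
    rw [← le_div_iff₀ hτ]
    exact (Real.log_le_log_iff (by linarith) (by positivity)).1 hlog
  have hlogpos : 0 < Real.log ((Δ : ℝ) / τ) := (Real.log_pos hδ1).trans_le hlog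
  have hB : 0 ≤ (1 + ε) * ((Δ : ℝ) / Real.log ((Δ : ℝ) / τ)) := by positivity
  refine le_trans (Nat.cast_le.2 (?_ : corrChromaticNumber G ≤ ⌊X⌋₊))
    (Nat.floor_le (by linarith))
  refine Nat.sInf_le fun W C hC => ?_
  refine h Δ hΔ V G t (fun u => hmax ▸ G.degree_le_maxDegree u) ht htri W C fun x => ?_
  rw [hC x]
  have h1 : max (G.degree x : ℝ) (δ₀ * τ) ≤ Δ :=
    max_le (by rw [← hmax]; exact Nat.cast_le.2 (G.degree_le_maxDegree x)) hδτ
  have h2 := div_log_mono hτ ((mul_le_mul_of_nonneg_right hδ hτ.le).trans (le_max_right _ _)) h1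
  have h3 := Nat.sub_one_lt_floor X
  have h4 := mul_le_mul_of_nonneg_left h2 (show 0 ≤ 1 + ε by linarith)
  linarith

theorem eventually_log_mul_le (M : ℝ) (hM : 0 < M) :
    ∀ᶠ Δ : ℕ in atTop, M * Real.log (Δ : ℝ) ≤ Δ := by
  have h := tendsto_natCast_atTop_atTop.eventually
    (Real.isLittleO_log_id_atTop.bound (inv_pos.2 hM))
  filter_upwards [h, eventually_ge_atTop 1] with Δ h1 h2
  have h3 : (1 : ℝ) ≤ Δ := by exact_mod_cast h2
  rw [Real.norm_of_nonneg (Real.log_nonneg h3), id, Real.norm_of_nonneg (by linarith),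
    ← div_eq_inv_mul, le_div_iff₀ hM] at h1
  linarith

theorem tendsto_log_natCast : Tendsto (fun Δ : ℕ => Real.log (Δ : ℝ)) atTop atTop :=
  Real.tendsto_log_atTop.comp tendsto_natCast_atTop_atTop

/-- Both log √t and log log Δ are o(log Δ), so log(Δ/(√t log Δ)) ≥ (1 - e/8) log Δ eventually. The
rounding term 1 is absorbed by (e/2)Δ/log Δ. -/
theorem corrChromaticNumber_asymptotic (t : ℕ → ℝ) (ht : ∀ Δ, 1 / 2 ≤ t Δ)
    (hlim : (fun Δ : ℕ => Real.log (t Δ)) =o[atTop] (fun Δ : ℕ => Real.log (Δ : ℝ)))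
    {ε : ℝ} (hε : 0 < ε) : ∃ Δ₀ : ℕ, ∀ Δ : ℕ, Δ₀ ≤ Δ →
      ∀ (V : Type u) [Fintype V] (G : SimpleGraph V) [DecidableRel G.Adj],
        G.maxDegree = Δ → TrianglesAtMost G (t Δ) →
        (corrChromaticNumber G : ℝ) ≤ (1 + ε) * ((Δ : ℝ) / Real.log (Δ : ℝ)) := by
  set e := min ε 1
  have he : 0 < e := lt_min hε one_pos
  have he1 : e ≤ 1 := min_le_right _ _
  have heε : e ≤ ε := min_le_left _ _
  obtain ⟨δ₀, hδ1, h⟩ := corrChromaticNumber_le (ε := e / 8) (by positivity) (by linarith)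
  have hev : ∀ᶠ Δ : ℕ in atTop, 20 ≤ Δ ∧ Real.log (t Δ) ≤ e / 8 * Real.log Δ ∧
      Real.log (Real.log Δ) ≤ e / 16 * Real.log Δ ∧ 2 * Real.log δ₀ ≤ Real.log Δ ∧
      2 / e * Real.log Δ ≤ Δ := by
    have h2 := hlim.bound (show 0 < e / 8 by positivity)
    have h3 := tendsto_log_natCast.eventually
      (Real.isLittleO_log_id_atTop.bound (show 0 < e / 16 by positivity))
    filter_upwards [eventually_ge_atTop 20, h2, h3,
      tendsto_log_natCast.eventually_ge_atTop (2 * Real.log δ₀),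
      eventually_log_mul_le (2 / e) (by positivity)] with Δ a1 a2 a3 a4 a5
    have b1 : (20 : ℝ) ≤ Δ := by exact_mod_cast a1
    have b2 : 0 ≤ Real.log (Δ : ℝ) := Real.log_nonneg (by linarith)
    rw [Real.norm_of_nonneg b2] at a2
    rw [id, Real.norm_of_nonneg b2] at a3
    exact ⟨a1, (le_abs_self _).trans a2, (le_abs_self _).trans a3, a4, a5⟩
  obtain ⟨Δ₀, hΔ₀⟩ := eventually_atTop.1 hev
  refine ⟨Δ₀, fun Δ hΔ V _ G _ hmax htri => ?_⟩
  obtain ⟨a1, a2, a3, a4, a5⟩ := hΔ₀ Δ hΔ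
  have b1 : (20 : ℝ) ≤ Δ := by exact_mod_cast a1
  have b2 : 0 < Real.log (Δ : ℝ) := Real.log_pos (by linarith)
  have ht0 : 0 < t Δ := by linarith [ht Δ]
  have hlog : (1 - e / 8) * Real.log Δ ≤
      Real.log ((Δ : ℝ) / (Real.sqrt (t Δ) * Real.log (Δ : ℝ))) := by
    rw [Real.log_div (by linarith) (by positivity), Real.log_mul (by positivity) b2.ne',
      Real.log_sqrt ht0.le]
    linarith
  refine h Δ a1 V G (t Δ) _ hmax (ht Δ) htri ?_ ?_
  · nlinarith
  · set ℒ := Real.log (Δ : ℝ)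
    have hpos : 0 < (1 - e / 8) * ℒ := mul_pos (by linarith) b2
    have h1 : (1 + e / 8) * ((Δ : ℝ) / Real.log ((Δ : ℝ) / (Real.sqrt (t Δ) * ℒ))) ≤
        (1 + e / 2) * (Δ / ℒ) := by
      calc _ ≤ (1 + e / 8) * ((Δ : ℝ) / ((1 - e / 8) * ℒ)) := by gcongr
        _ = ((1 + e / 8) / (1 - e / 8)) * (Δ / ℒ) := by
          have : 1 - e / 8 ≠ 0 := by linarith
          field_simp
        _ ≤ (1 + e / 2) * (Δ / ℒ) := by
          refine mul_le_mul_of_nonneg_right ?_ (by positivity)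
          rw [div_le_iff₀ (by linarith)]
          nlinarith
    have h2 : 1 ≤ e / 2 * (Δ / ℒ) := by
      rw [← mul_div_assoc, le_div_iff₀ b2]
      rw [div_mul_eq_mul_div, div_le_iff₀ he] at a5
      linarith
    calc _ ≤ (1 + e / 2) * (Δ / ℒ) + e / 2 * (Δ / ℒ) := add_le_add h1 h2
      _ = (1 + e) * (Δ / ℒ) := by ring
      _ ≤ _ := by gcongr

/-- With t = Δ²/f the logarithm becomes F - M, where F = log √f and M = log log Δ. The lower bound
on f says M ≤ (2/κ)F, so F - M ≥ F/g with g = κ/(κ-2), and κ > 2 + 2/ε is exactly the condition g <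
1 + ε. -/
theorem corrChromaticNumber_nonlocal {ε : ℝ} (hε : 0 < ε) {κ : ℝ} (hκ : 2 + 2 / ε < κ) :
    ∃ Δ₀ : ℕ, ∀ Δ : ℕ, Δ₀ ≤ Δ →
      ∀ f : ℝ, Real.log (Δ : ℝ) ^ κ ≤ f → f ≤ (Δ : ℝ) ^ 2 + 1 →
        ∀ (V : Type u) [Fintype V] (G : SimpleGraph V) [DecidableRel G.Adj],
          G.maxDegree = Δ → TrianglesAtMost G ((Δ : ℝ) ^ 2 / f) →
          (corrChromaticNumber G : ℝ) ≤
            (1 + ε) * ((Δ : ℝ) / Real.log (Real.sqrt f)) := by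
  have hκ2 : 0 < κ - 2 := by
    have : 0 < 2 / ε := by positivity
    linarith
  set g := κ / (κ - 2)
  have hg0 : 0 < g := div_pos (by linarith) hκ2
  have hg : g < 1 + ε := by
    rw [div_lt_iff₀ hκ2]
    have : 2 < ε * (κ - 2) := by
      rw [← sub_pos] at hκ
      have := mul_pos hε hκ
      have e : ε * (κ - (2 + 2 / ε)) = ε * (κ - 2) - 2 := by field_simp; ring
      linarith
    nlinarith
  set γ := (1 + ε - g) / 2
  have hγ : 0 < γ := by simp only [γ]; linarith
  set e := min 1 (γ / g)
  have he : 0 < e := lt_min one_pos (by positivity)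
  have heg : (1 + e) * g ≤ 1 + ε - γ := by
    have : e * g ≤ γ := (le_div_iff₀ hg0).1 (min_le_right _ _)
    simp only [γ] at *
    linarith
  obtain ⟨δ₀, hδ1, h⟩ := corrChromaticNumber_le he (min_le_left _ _)
  have hev : ∀ᶠ Δ : ℕ in atTop, 20 ≤ Δ ∧ 1 ≤ Real.log (Real.log (Δ : ℝ)) ∧
      2 * Real.log δ₀ / (κ - 2) ≤ Real.log (Real.log (Δ : ℝ)) ∧ 2 / γ * Real.log Δ ≤ Δ := by
    have hll := Real.tendsto_log_atTop.comp tendsto_log_natCast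
    filter_upwards [eventually_ge_atTop 20, hll.eventually_ge_atTop 1,
      hll.eventually_ge_atTop (2 * Real.log δ₀ / (κ - 2)),
      eventually_log_mul_le (2 / γ) (by positivity)] with Δ a1 a2 a3 a4
    exact ⟨a1, a2, a3, a4⟩
  obtain ⟨Δ₀, hΔ₀⟩ := eventually_atTop.1 hev
  refine ⟨Δ₀, fun Δ hΔ f hf1 hf2 V _ G _ hmax htri => ?_⟩
  obtain ⟨a1, a2, a3, a4⟩ := hΔ₀ Δ hΔ
  have b1 : (20 : ℝ) ≤ Δ := by exact_mod_cast a1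
  have b2 : 0 < Real.log (Δ : ℝ) := Real.log_pos (by linarith)
  set ℒ := Real.log (Δ : ℝ)
  set M := Real.log ℒ
  have hf0 : 0 < f := lt_of_lt_of_le (Real.rpow_pos_of_pos b2 _) hf1
  set F := Real.log (Real.sqrt f)
  have hF : F = Real.log f / 2 := Real.log_sqrt hf0.le
  have hF1 : κ / 2 * M ≤ F := by
    have := Real.log_le_log (Real.rpow_pos_of_pos b2 _) hf1
    rw [Real.log_rpow b2] at this
    rw [hF]; linarith
  have hF0 : 0 < F := lt_of_lt_of_le (by nlinarith) hF1
  -- A crude bound, used only to absorb the rounding term 1 into γΔ/F.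
  have hF2 : F ≤ 2 * ℒ := by
    have h0 : (400 : ℝ) ≤ (Δ : ℝ) ^ 2 := by nlinarith
    have h1 : f ≤ (Δ : ℝ) ^ 4 := by nlinarith [sq_nonneg ((Δ : ℝ) ^ 2 - 2)]
    have h2 := Real.log_le_log hf0 h1
    rw [Real.log_pow] at h2
    push_cast at h2
    rw [hF]; linarith
  -- This is where the upper bound f ≤ Δ² + 1 gives t ≥ 1/2.
  have ht : 1 / 2 ≤ (Δ : ℝ) ^ 2 / f := by
    rw [le_div_iff₀ hf0]; nlinarith
  have hlog : Real.log ((Δ : ℝ) / (Real.sqrt ((Δ : ℝ) ^ 2 / f) * ℒ)) = F - M := by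
    rw [Real.sqrt_div (by positivity), Real.sqrt_sq (by linarith)]
    have hsf : 0 < Real.sqrt f := Real.sqrt_pos.2 hf0
    have : (Δ : ℝ) / (Δ / Real.sqrt f * ℒ) = Real.sqrt f / ℒ := by field_simp
    rw [this, Real.log_div hsf.ne' b2.ne']
  have hFM : F / g ≤ F - M := by
    have e1 : F / g = F - 2 / κ * F := by
      have : κ ≠ 0 := by linarith
      simp only [g]; field_simp
    have e2 : M ≤ 2 / κ * F := by
      have hκ0 : 0 < κ := by linarith
      rw [div_mul_eq_mul_div, le_div_iff₀ hκ0]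
      linarith
    linarith
  refine h Δ a1 V G _ _ hmax ht htri ?_ ?_
  · rw [hlog]
    rw [div_le_iff₀ hκ2] at a3
    linarith
  · rw [hlog]
    have h1 : (1 + e) * ((Δ : ℝ) / (F - M)) ≤ (1 + ε - γ) * (Δ / F) := by
      calc _ ≤ (1 + e) * ((Δ : ℝ) / (F / g)) := by gcongr
        _ = ((1 + e) * g) * (Δ / F) := by field_simp
        _ ≤ _ := by gcongr
    have h2 : 1 ≤ γ * (Δ / F) := by
      rw [← mul_div_assoc, le_div_iff₀ hF0]
      rw [div_mul_eq_mul_div, div_le_iff₀ hγ] at a4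
      linarith
    linarith

end Correspondence

end SparseNbhd

theorem theorem5p3 :
    -- occupancy fraction
    (∀ (V : Type u) [Fintype V] [Nonempty V] (G : SimpleGraph V) [DecidableRel G.Adj] (t : ℝ),
      1 / 2 ≤ t → SparseNbhd.TrianglesAtMost G t →
      ∀ lam : ℝ, 0 < lam →
        ∃ m : ℝ,
          IsGreatest ((fun x : ℝ => x / (1 + x) *
            SparseNbhd.lambertQuot
              ((G.maxDegree : ℝ) * (1 + x) ^ Real.sqrt (2 * t) * Real.log (1 + x))) ''
            Set.Icc 0 lam) m ∧
          m ≤ SparseNbhd.occupancyFraction G lam) ∧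
    -- local fractional colouring
    (∀ ε : ℝ, 0 < ε → ∃ δ₀ : ℝ, 1 < δ₀ ∧
      ∀ (V : Type u) [Fintype V] (G : SimpleGraph V) [DecidableRel G.Adj] (t : ℝ),
        1 / 2 ≤ t → SparseNbhd.TrianglesAtMost G t →
        ∃ c : SparseNbhd.FractionalColouring G, ∀ x : V,
          c.colours x ⊆ Set.Ico 0 ((1 + ε) *
            max ((G.degree x : ℝ) / Real.log ((G.degree x : ℝ) / Real.sqrt t))
              (δ₀ / Real.log δ₀ * Real.sqrt t))) ∧
    -- fractional chromatic number
    (∀ t : ℕ → ℝ, (∀ Δ, 1 / 2 ≤ t Δ) →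
      Tendsto (fun Δ : ℕ => (Δ : ℝ) / Real.sqrt (t Δ)) atTop atTop →
      ∀ ε : ℝ, 0 < ε → ∃ Δ₀ : ℕ, ∀ Δ : ℕ, Δ₀ ≤ Δ →
        ∀ (V : Type u) [Fintype V] (G : SimpleGraph V) [DecidableRel G.Adj],
          G.maxDegree = Δ → SparseNbhd.TrianglesAtMost G (t Δ) →
          SparseNbhd.fracChromaticNumber G ≤
            (1 + ε) * ((Δ : ℝ) / Real.log ((Δ : ℝ) / Real.sqrt (t Δ)))) ∧
    -- local correspondence colouring
    (∀ ε : ℝ, 0 < ε → ∃ δ₀ : ℝ, 1 < δ₀ ∧ ∃ Δ₀ : ℕ, ∀ Δ : ℕ, Δ₀ ≤ Δ →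
      ∀ (V : Type u) [Fintype V] (G : SimpleGraph V) [DecidableRel G.Adj] (t : ℝ),
        G.maxDegree = Δ → 1 / 2 ≤ t → SparseNbhd.TrianglesAtMost G t →
        ∀ (W : Type v) (C : SparseNbhd.Cover G W),
          (∀ x : V, (1 + ε) *
            max ((G.degree x : ℝ) /
                Real.log ((G.degree x : ℝ) / (Real.sqrt t * Real.log (Δ : ℝ))))
              (δ₀ / Real.log δ₀ * (Real.sqrt t * Real.log (Δ : ℝ))) ≤ ((C.L x).card : ℝ)) →
          C.Colourable) ∧
    -- correspondence chromatic number, `t = Δ ^ o(1)`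
    (∀ t : ℕ → ℝ, (∀ Δ, 1 / 2 ≤ t Δ) →
      (fun Δ : ℕ => Real.log (t Δ)) =o[atTop] (fun Δ : ℕ => Real.log (Δ : ℝ)) →
      ∀ ε : ℝ, 0 < ε → ∃ Δ₀ : ℕ, ∀ Δ : ℕ, Δ₀ ≤ Δ →
        ∀ (V : Type u) [Fintype V] (G : SimpleGraph V) [DecidableRel G.Adj],
          G.maxDegree = Δ → SparseNbhd.TrianglesAtMost G (t Δ) →
          (SparseNbhd.corrChromaticNumber G : ℝ) ≤ (1 + ε) * ((Δ : ℝ) / Real.log (Δ : ℝ))) ∧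
    -- correspondence chromatic number, `t = Δ ^ 2 / f`
    (∀ ε : ℝ, 0 < ε → ∀ κ : ℝ, 2 + 2 / ε < κ → ∃ Δ₀ : ℕ, ∀ Δ : ℕ, Δ₀ ≤ Δ →
      ∀ f : ℝ, Real.log (Δ : ℝ) ^ κ ≤ f → f ≤ (Δ : ℝ) ^ 2 + 1 →
        ∀ (V : Type u) [Fintype V] (G : SimpleGraph V) [DecidableRel G.Adj],
          G.maxDegree = Δ → SparseNbhd.TrianglesAtMost G ((Δ : ℝ) ^ 2 / f) →
          (SparseNbhd.corrChromaticNumber G : ℝ) ≤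
            (1 + ε) * ((Δ : ℝ) / Real.log (Real.sqrt f))) := by
  exact ⟨fun V _ _ G _ t _ ht lam hl => SparseNbhd.exists_isGreatest_occupancy G ht hl,
    fun ε hε => SparseNbhd.local_fractional_colouring hε,
    fun t ht hlim ε hε => SparseNbhd.fracChromaticNumber_asymptotic t ht hlim hε,
    fun ε hε => SparseNbhd.local_correspondence_colouring hε,
    fun t ht hlim ε hε => SparseNbhd.corrChromaticNumber_asymptotic t ht hlim hε,
    fun ε hε κ hκ => SparseNbhd.corrChromaticNumber_nonlocal hε hκ⟩
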